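/- **Setting.** Consider $x_{t+1}=Ax_t+Bu_t$ in $\mathbb R^{d_x}$ with $B\ne 0$, constraints $x_t\in\mathcal X$, $u_t\in\mathcal U$, and stage cost $\ell(x,u)=x^\top Qx+u^\top Ru$, $Q\succeq 0$, $R\succ 0$. The sets $\mathcal X,\mathcal U$ are polyhedra containing the origin and $\mathcal U$ is bounded; $B_u:=\sup_{u\in\mathcal U}\|u\|$. All vector norms are Euclidean and all matrix norms are the induced operator norms. $P$ is the unique positive definite solution of the discrete algebraic Riccati equation $P=A^\top PA-A^\top PB(R+B^\top PB)^{-1}B^\top PA+Q$; $K=-(R+B^\top PB)^{-1}B^\top PA$, $A_K=A+BK$, $\pi^{\rm lqr}(x)=Kx$. Fix $\rho\in(0,1)$ and $\sigma>0$ with $\|A_K^k\|\le\sigma\rho^k$ for all $k\ge 0$, and put $\kappa=\sigma/(1-\rho)$. Fix a horizon $N\ge1$ and $V_N(x,u)=\sum_{k<N}\ell(x_k,u_k)+x_N^\top Px_N$ (with $x_0=x$). For $\varepsilon>0$ let $\mathcal W$ be the closed ball of radius $\varepsilon$ about $0$, and let $\mathcal Z\subseteq\{\|x\|\le\kappa\varepsilon\}$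 be a disturbance invariant set, i.e. a neighbourhood of $0$ with $A_K\mathcal Z+\mathcal W\subseteq\mathcal Z$. Put $\bar{\mathcal X}=\mathcal X\ominus\mathcal Z$, $\bar{\mathcal U}=\mathcal U\ominus K\mathcal Z$, where $S\ominus Y=\{s\in S: s+Y\subseteq S\}$. Let $\bar{\mathcal O}_\infty$ be the maximal set $\mathcal O\subseteq\bar{\mathcal X}$ such that from every point of $\mathcal O$ the LQR loop stays in $\mathcal O$ and its inputs stay in $\bar{\mathcal U}$. The tightened-constraint MPC problem at $x$ is to minimize $V_N(x,u)$ subject to $x_k\in\bar{\mathcal X}$, $u_k\in\bar{\mathcal U}$ $(k<N)$, $x_N\in\bar{\mathcal O}_\infty$; $\bar{\mathcal X}_0$ is the set of $x$ for which it is feasible, and $\bar\pi(x)$, $x\in\bar{\mathcal X}_0$, is the first input of its optimal solution. The robust MPC problem at $x\in(\bar{\mathcal X}_0\oplus\mathcal Z)\cap\mathcal X$ minimizes $V_N(\bar x_0,u)$ over $(\bar x_0,u)$ under the same constraints (from $\bar x_0$) and $x\in\bar x_0+\mathcal Z$; the robust MPC controller is $\pi^{\rm rmpc}(x)=\bar u_0(x)+K(x-\bar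 x_0(x))$ for an optimal solution $(\bar x_0(x),\bar u(x))$. It is extended to the other states in any way. **Training (Forward-Switch).** Let $\mathcal D$ be a probability distribution of initial states with $x_0\in\bar{\mathcal X}_0$ and $\|x_0\|\le b$ almost surely. Let $\Pi$ be a finite class of measurable controllers containing $\pi^{\rm rmpc}$, each with $\pi(\mathcal X)\subseteq\mathcal U$. Let $T,n,\ell$ be natural numbers. In stage $t=0,1,\dots$ one draws $n_t=\lceil c\,n\,t\lceil\ln^2(t+1)\rceil+n\rceil$ fresh i.i.d. initial states from $\mathcal D$, with $c=\sum_{t\ge1}1/(t\ln^2(t+1))$, runs them to time $t$ with the controllers $\hat\pi_0,\dots,\hat\pi_{t-1}$ learned so far, and lets $\hat\pi_t\in\Pi$ be a minimizer over $\Pi$ of the empirical mean of $\|\pi^{\rm rmpc}(\hat x_t^{(i)})-\pi(\hat x_t^{(i)})\|$ (ties broken measurably, without looking at later samples). After stage $t-1$ one draws $\ell$ fresh i.i.d. initial states and runs them to time $t$ with $\hat\pi_{0:t-1}$; $\hat\tau_\infty$ is the first $t\ge1$ at which all $\ell$ of these states are in $\bar{\mathcal O}_\infty$, or $T$ if this does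 not happen before $T$, and training stops there. The output is $\tilde\pi_t=\hat\pi_t$ for $t<\hat\tau_\infty$ and $\tilde\pi_t=\pi^{\rm lqr}$ for $\hat\tau_\infty\le t\le T-1$. Let $\hat x_t$ be the state at time $t$ under $\hat\pi$ from $x_0$, and let $\tilde J_T(x_0)$, $\bar J_T(x_0)$ be the $T$-step costs $\sum_{t<T}\ell(x_t,u_t)$ under $\tilde\pi$ and under $\bar\pi$. Let $\tau^\star_\infty\ge1$ be a time such that for $\mathcal D$-almost every $x_0$ and all $w_0,w_1,\ldots\in\mathcal W$ the trajectory $x_{t+1}=Ax_t+B\pi^{\rm rmpc}(x_t)+w_t$ satisfies $x_{\tau^\star_\infty}\in\bar{\mathcal O}_\infty$. **Theorem.** There is a constant $C>0$, depending only on $(A,B,Q,R,\mathcal X,\mathcal U,N)$, $(\rho,\sigma)$ and $b$, such that for all $\varepsilon,\delta\in(0,1)$ and all $\mathcal Z,\mathcal D,\Pi,\tau^\star_\infty,T,n,\ell$ as above with $$\ell\ge\frac{10\ln(T/\delta)}{\delta},\qquad n\ge\frac{14\,\ell\,\|B\|B_u\ln(2T\ell|\Pi|/\delta)}{\varepsilon\delta},$$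 the following holds. Let $\bar{\mathcal E}$ be the event of the training process that $\hat\tau_\infty\le\tau^\star_\infty$ and $$\Pr[\hat x_{\hat\tau_\infty}\in\bar{\mathcal O}_\infty\mid\hat\tau_\infty,\hat\pi]\ge1-\delta,\qquad \Pr\bigl[\forall t<\hat\tau_\infty:\ \|\pi^{\rm rmpc}(\hat x_t)-\hat\pi_t(\hat x_t)\|\le\varepsilon/\|B\|\ \big|\ \hat\tau_\infty,\hat\pi\bigr]\ge1-\delta,$$ the probabilities being over $x_0\sim\mathcal D$. If $T\ge\tau^\star_\infty$, then $\bar{\mathcal E}$ has probability at least $1-3\delta$. For every $T$, on $\bar{\mathcal E}$ and for every $x_0\in\bar{\mathcal X}_0$ with $\|x_0\|\le b$ for which $\hat x_{\hat\tau_\infty}\in\bar{\mathcal O}_\infty$ and $\|\pi^{\rm rmpc}(\hat x_t)-\hat\pi_t(\hat x_t)\|\le\varepsilon/\|B\|$ for all $t<\hat\tau_\infty$, $$\tilde J_T(x_0)-\bar J_T(x_0)\le C\,\tau^\star_\infty\,\varepsilon .$$ -/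

import Mathlib

open MeasureTheory ProbabilityTheory Metric Topology
open scoped Pointwise

/-- `ℝᵈ` with the Euclidean norm. -/
abbrev Vec (d : ℕ) : Type := EuclideanSpace ℝ (Fin d)

/-- The linear map `x ↦ M x` attached to a matrix. -/
noncomputable def mv {m n : ℕ} (M : Matrix (Fin m) (Fin n) ℝ) (x : Vec n) : Vec m :=
  Matrix.toEuclideanLin M x

/-- The operator norm of a matrix with respect to the Euclidean norms. -/
noncomputable def opNorm {m n : ℕ} (M : Matrix (Fin m) (Fin n) ℝ) : ℝ :=
  ‖(Matrix.toEuclideanLin M).toContinuousLinearMap‖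

/-- The quadratic form `xᵀ M x`. -/
noncomputable def quadForm {n : ℕ} (M : Matrix (Fin n) (Fin n) ℝ) (x : Vec n) : ℝ :=
  inner ℝ x (mv M x)

/-- `X ⊖ Y = {x ∈ X | x + Y ⊆ X}`. -/
def pontryaginDiff {n : ℕ} (X Y : Set (Vec n)) : Set (Vec n) :=
  {x | x ∈ X ∧ ∀ y ∈ Y, x + y ∈ X}

/-- A finite intersection of closed half-spaces. -/
def IsPolyhedron {n : ℕ} (X : Set (Vec n)) : Prop :=
  ∃ (m : ℕ) (a : Fin m → Vec n) (b : Fin m → ℝ), X = {x | ∀ i, inner ℝ (a i) x ≤ b i}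

/-- `P` solves the discrete algebraic Riccati equation
`P = Aᵀ P A - Aᵀ P B (R + Bᵀ P B)⁻¹ Bᵀ P A + Q`. -/
def SolvesDARE {dx du : ℕ} (A : Matrix (Fin dx) (Fin dx) ℝ) (B : Matrix (Fin dx) (Fin du) ℝ)
    (Q : Matrix (Fin dx) (Fin dx) ℝ) (R : Matrix (Fin du) (Fin du) ℝ)
    (P : Matrix (Fin dx) (Fin dx) ℝ) : Prop :=
  P = A.transpose * P * A
    - A.transpose * P * B * (R + B.transpose * P * B)⁻¹ * B.transpose * P * A + Q

/-- The data of a constrained linear-quadratic control problem: the dynamics `x⁺ = A x + B u`, the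
stage cost `xᵀ Q x + uᵀ R u`, the LQR cost matrix `P`, the MPC horizon `N`, and the constraint sets
`X` (states) and `U` (inputs). -/
structure ControlSystem (dx du : ℕ) where
  A : Matrix (Fin dx) (Fin dx) ℝ
  B : Matrix (Fin dx) (Fin du) ℝ
  Q : Matrix (Fin dx) (Fin dx) ℝ
  R : Matrix (Fin du) (Fin du) ℝ
  P : Matrix (Fin dx) (Fin dx) ℝ
  N : ℕ
  X : Set (Vec dx)
  U : Set (Vec du)

namespace ControlSystem

variable {dx du : ℕ} (S : ControlSystem dx du)

/-- The standing assumptions on the system. -/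
structure Standing : Prop where
  Q_posSemidef : S.Q.PosSemidef
  R_posDef : S.R.PosDef
  P_posDef : S.P.PosDef
  P_dare : SolvesDARE S.A S.B S.Q S.R S.P
  P_unique : ∀ P' : Matrix (Fin dx) (Fin dx) ℝ,
    P'.PosDef → SolvesDARE S.A S.B S.Q S.R P' → P' = S.P
  B_ne_zero : S.B ≠ 0
  N_pos : 0 < S.N
  X_polyhedron : IsPolyhedron S.X
  U_polyhedron : IsPolyhedron S.U
  zero_mem_X : (0 : Vec dx) ∈ S.X
  zero_mem_U : (0 : Vec du) ∈ S.U
  U_bounded : Bornology.IsBounded S.U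

/-- One step of the dynamics. -/
noncomputable def step (x : Vec dx) (u : Vec du) : Vec dx := mv S.A x + mv S.B u

/-- The stage cost `ℓ(x, u) = xᵀ Q x + uᵀ R u`. -/
noncomputable def stageCost (x : Vec dx) (u : Vec du) : ℝ := quadForm S.Q x + quadForm S.R u

/-- The LQR gain `K = -(R + Bᵀ P B)⁻¹ Bᵀ P A`. -/
noncomputable def K : Matrix (Fin du) (Fin dx) ℝ :=
  -((S.R + S.B.transpose * S.P * S.B)⁻¹ * S.B.transpose * S.P * S.A)

/-- The closed-loop matrix `A + B K`. -/
noncomputable def AK : Matrix (Fin dx) (Fin dx) ℝ := S.A + S.B * S.K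

/-- The LQR controller. -/
noncomputable def lqr (x : Vec dx) : Vec du := mv S.K x

/-- The largest input norm, `sup_{u ∈ U} ‖u‖`. -/
noncomputable def inputBound : ℝ := sSup ((fun u : Vec du => ‖u‖) '' S.U)

/-- The state at time `t` under the input sequence `u`, from `x`. -/
noncomputable def openLoop (x : Vec dx) (u : ℕ → Vec du) : ℕ → Vec dx
  | 0 => x
  | t + 1 => S.step (openLoop x u t) (u t)

/-- The state at time `t` under the time-varying feedback `π`, from `x`. -/
noncomputable def rollout (π : ℕ → Vec dx → Vec du) (x : Vec dx) : ℕ → Vec dx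
  | 0 => x
  | t + 1 => S.step (rollout π x t) (π t (rollout π x t))

/-- The state at time `t` under the feedback `π` and the additive disturbances `w`, from `x`. -/
noncomputable def disturbed (π : Vec dx → Vec du) (w : ℕ → Vec dx) (x : Vec dx) : ℕ → Vec dx
  | 0 => x
  | t + 1 => S.step (disturbed π w x t) (π (disturbed π w x t)) + w t

/-- The `T`-step cost of the time-varying feedback `π` from `x`. -/
noncomputable def cost (π : ℕ → Vec dx → Vec du) (T : ℕ) (x : Vec dx) : ℝ :=
  ∑ t ∈ Finset.range T, S.stageCost (S.rollout π x t) (π t (S.rollout π x t))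

/-- Positive invariance of `O` under the LQR controller with respect to `(X, U)`. -/
def IsPosInvariant (X : Set (Vec dx)) (U : Set (Vec du)) (O : Set (Vec dx)) : Prop :=
  O ⊆ X ∧ ∀ x ∈ O, ∀ t, S.rollout (fun _ => S.lqr) x t ∈ O ∧
    S.lqr (S.rollout (fun _ => S.lqr) x t) ∈ U

/-- The maximal positively invariant set with respect to `(X, U)`. -/
def maxInvariant (X : Set (Vec dx)) (U : Set (Vec du)) : Set (Vec dx) :=
  ⋃₀ {O | S.IsPosInvariant X U O}

/-- `Z` is a disturbance invariant set for the disturbance set `W`. -/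
def IsDisturbanceInvariant (W Z : Set (Vec dx)) : Prop :=
  Z ∈ 𝓝 (0 : Vec dx) ∧ mv S.AK '' Z + W ⊆ Z

/-- The tightened state constraint set `X ⊖ Z`. -/
def tightX (Z : Set (Vec dx)) : Set (Vec dx) := pontryaginDiff S.X Z

/-- The tightened input constraint set `U ⊖ K Z`. -/
def tightU (Z : Set (Vec dx)) : Set (Vec du) := pontryaginDiff S.U (mv S.K '' Z)

/-- The terminal set of the tightened problem, i.e. the maximal positively invariant set with
respect to the tightened constraints. -/
def tightO (Z : Set (Vec dx)) : Set (Vec dx) := S.maxInvariant (S.tightX Z) (S.tightU Z)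

/-- The states from which, within `k` steps respecting `(X, U)`, one can be steered to `Xf`. -/
def backwardReach (X : Set (Vec dx)) (U : Set (Vec du)) (Xf : Set (Vec dx)) : ℕ → Set (Vec dx)
  | 0 => Xf
  | k + 1 => {x | x ∈ X ∧ ∃ u ∈ U, S.step x u ∈ backwardReach X U Xf k}

/-- The feasible domain of the tightened MPC problem. -/
def feasible (Z : Set (Vec dx)) : Set (Vec dx) :=
  S.backwardReach (S.tightX Z) (S.tightU Z) (S.tightO Z) S.N

/-- The finite-horizon objective `V_N(x, u)`, with terminal cost `x_Nᵀ P x_N`. It depends only on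
the first `N` entries of `u`. -/
noncomputable def V (x : Vec dx) (u : ℕ → Vec du) : ℝ :=
  ∑ k ∈ Finset.range S.N, S.stageCost (S.openLoop x u k) (u k)
    + quadForm S.P (S.openLoop x u S.N)

/-- `u` satisfies the constraints of the tightened MPC problem at `x`. -/
def Admissible (Z : Set (Vec dx)) (x : Vec dx) (u : ℕ → Vec du) : Prop :=
  (∀ k < S.N, S.openLoop x u k ∈ S.tightX Z ∧ u k ∈ S.tightU Z) ∧
    S.openLoop x u S.N ∈ S.tightO Z

/-- `u` is an optimal solution of the tightened MPC problem at `x`. -/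
def IsMPCOptimal (Z : Set (Vec dx)) (x : Vec dx) (u : ℕ → Vec du) : Prop :=
  S.Admissible Z x u ∧ ∀ v, S.Admissible Z x v → S.V x u ≤ S.V x v

/-- `π` is the tightened-constraint MPC controller: on the feasible domain it plays the first input
of the optimal solution. -/
def IsTightMPC (Z : Set (Vec dx)) (π : Vec dx → Vec du) : Prop :=
  ∀ x ∈ S.feasible Z, ∃ u, S.IsMPCOptimal Z x u ∧ π x = u 0

/-- `(x₀, u)` is an optimal solution of the robust MPC problem at `x`, in which the initial state
`x₀` of the tightened problem is free subject to `x ∈ x₀ + Z`. -/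
def IsRMPCOptimal (Z : Set (Vec dx)) (x x₀ : Vec dx) (u : ℕ → Vec du) : Prop :=
  (x - x₀ ∈ Z ∧ S.Admissible Z x₀ u) ∧
    ∀ y v, x - y ∈ Z → S.Admissible Z y v → S.V x₀ u ≤ S.V y v

/-- `π` is the robust MPC controller on the domain of the robust MPC problem, extended to the other
states in any way. -/
def IsRobustMPC (Z : Set (Vec dx)) (π : Vec dx → Vec du) : Prop :=
  ∀ x ∈ (S.feasible Z + Z) ∩ S.X, ∃ x₀ u, S.IsRMPCOptimal Z x x₀ u ∧
    π x = u 0 + mv S.K (x - x₀)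

/-- `τ` is a number of steps after which the robust MPC loop, started from almost every initial
state and driven by any disturbances in the ball of radius `ε`, is in the terminal set. -/
def IsReachTime (Z : Set (Vec dx)) (ε : ℝ) (D : Measure (Vec dx)) (expert : Vec dx → Vec du)
    (τ : ℕ) : Prop :=
  1 ≤ τ ∧ ∀ᵐ x ∂D, ∀ w : ℕ → Vec dx, (∀ t, w t ∈ closedBall (0 : Vec dx) ε) →
    S.disturbed expert w x τ ∈ S.tightO Z

end ControlSystem

/-- The constant `c = ∑_{t ≥ 1} 1 / (t ln² (t + 1))` of the sampling schedule. -/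
noncomputable def scheduleConst : ℝ := ∑' t : ℕ, 1 / (((t : ℝ) + 1) * Real.log ((t : ℝ) + 2) ^ 2)

/-- The number of training samples of stage `t`, `n_t = c n t ⌈ln² (t + 1)⌉ + n`, rounded up to an
integer. -/
noncomputable def numSamples (n t : ℕ) : ℕ :=
  ⌈scheduleConst * n * t * (⌈Real.log ((t : ℝ) + 1) ^ 2⌉₊ : ℝ) + n⌉₊

/-- A record of a training run on the sample space `Ω`: `train t i` is the `i`-th initial state
sampled for training in stage `t`, `test t i` the `i`-th initial state sampled (at the end of stage
`t - 1`) for the test of time `t`, and `policy t` the controller learned in stage `t`. -/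
structure TrainingRun (Ω : Type*) (dx du : ℕ) where
  train : ℕ → ℕ → Ω → Vec dx
  test : ℕ → ℕ → Ω → Vec dx
  policy : ℕ → Ω → Vec dx → Vec du

namespace TrainingRun

variable {Ω : Type*} {dx du : ℕ} (r : TrainingRun Ω dx du) (S : ControlSystem dx du)

/-- The learned time-varying controller of the outcome `ω`. -/
def learned (ω : Ω) : ℕ → Vec dx → Vec du := fun t => r.policy t ω

/-- The switching time: the first `t ≥ 1` at which all `ℓ` test trajectories lie in the terminal
set, or `T` if there is none before `T`. -/
noncomputable def switchTime (Z : Set (Vec dx)) (T ℓ : ℕ) (ω : Ω) : ℕ :=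
  sInf ({t | 1 ≤ t ∧ ∀ i < ℓ, S.rollout (r.learned ω) (r.test t i ω) t ∈ S.tightO Z} ∪ {T})

/-- The empirical imitation loss of `π` on the training states of stage `t`. -/
noncomputable def empLoss (expert : Vec dx → Vec du) (n t : ℕ) (ω : Ω) (π : Vec dx → Vec du) : ℝ :=
  (1 / (numSamples n t : ℝ)) * ∑ i ∈ Finset.range (numSamples n t),
    ‖expert (S.rollout (r.learned ω) (r.train t i ω) t)
      - π (S.rollout (r.learned ω) (r.train t i ω) t)‖

/-- The information available when stage `t` selects its controller. -/
abbrev past (t : ℕ) : MeasurableSpace Ω :=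
  ⨆ s : {s : ℕ // s ≤ t}, ⨆ i : ℕ,
    MeasurableSpace.comap (r.train s i) inferInstance ⊔
      MeasurableSpace.comap (r.test s i) inferInstance

/-- `r` is a run of Forward-Switch: all sampled initial states are independent with law `D`, and
each stage reached before the switching time selects an empirical risk minimizer in the class
`models`, ties being broken by a measurable rule that does not look at later samples. -/
structure IsForwardSwitch [MeasurableSpace Ω] (μ : Measure Ω) (D : Measure (Vec dx))
    (Z : Set (Vec dx)) (expert : Vec dx → Vec du) (models : Finset (Vec dx → Vec du))
    (T n ℓ : ℕ) : Prop where
  train_measurable : ∀ t i, Measurable (r.train t i)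
  test_measurable : ∀ t i, Measurable (r.test t i)
  train_law : ∀ t i, μ.map (r.train t i) = D
  test_law : ∀ t i, μ.map (r.test t i) = D
  indep : iIndepFun (fun j : (ℕ × ℕ) ⊕ (ℕ × ℕ) =>
    Sum.elim (fun p : ℕ × ℕ => r.train p.1 p.2) (fun p : ℕ × ℕ => r.test p.1 p.2) j) μ
  erm : ∀ ω, ∀ t < r.switchTime S Z T ℓ ω, r.policy t ω ∈ models ∧
    ∀ π ∈ models, r.empLoss S expert n t ω (r.policy t ω) ≤ r.empLoss S expert n t ω π
  nonanticipating : ∀ t < T, ∀ π ∈ models, MeasurableSet[r.past t] {ω | r.policy t ω = π}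

/-- The output of Forward-Switch: the learned controllers before the switching time and the LQR
controller from then on. -/
noncomputable def output (Z : Set (Vec dx)) (T ℓ : ℕ) (ω : Ω) : ℕ → Vec dx → Vec du :=
  fun t => if t < r.switchTime S Z T ℓ ω then r.policy t ω else S.lqr

/-- The initial states from which the learned trajectory is in the terminal set at the switching
time. -/
def reachEvent (Z : Set (Vec dx)) (T ℓ : ℕ) (ω : Ω) : Set (Vec dx) :=
  {x | S.rollout (r.learned ω) x (r.switchTime S Z T ℓ ω) ∈ S.tightO Z}

/-- The initial states along whose learned trajectory, up to the switching time, the learned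
controller is `ε / ‖B‖`-close to the expert. -/
def closeEvent (Z : Set (Vec dx)) (ε : ℝ) (expert : Vec dx → Vec du) (T ℓ : ℕ) (ω : Ω) :
    Set (Vec dx) :=
  {x | ∀ t < r.switchTime S Z T ℓ ω,
    ‖expert (S.rollout (r.learned ω) x t) - r.policy t ω (S.rollout (r.learned ω) x t)‖
      ≤ ε / opNorm S.B}

/-- The training event: the switching time is at most `τ`, and each of the two events of the
initial state has conditional probability at least `1 - δ` given the outcome of the training. -/
def goodEvent (D : Measure (Vec dx)) (Z : Set (Vec dx)) (ε δ : ℝ) (expert : Vec dx → Vec du)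
    (T ℓ τ : ℕ) : Set Ω :=
  {ω | r.switchTime S Z T ℓ ω ≤ τ ∧
    ENNReal.ofReal (1 - δ) ≤ D (r.reachEvent S Z T ℓ ω) ∧
    ENNReal.ofReal (1 - δ) ≤ D (r.closeEvent S Z ε expert T ℓ ω)}

end TrainingRun

/-!
The distance from the reference loop to the output loop is controlled in two steps. A parametric
quadratic program with a convex piecewise affine feasible set has a Lipschitz minimizer, so the
first input of the MPC problem is Lipschitz in the state; the constant is uniform in `Z` because
tightening only moves the right-hand sides of the constraints, and because finitely many of the
half-spaces that cut out the terminal set suffice on a bounded set. The robust MPC input is within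
a multiple of `ε` of the tightened MPC input. Up to a uniform time by which the reference loop is
near the origin, a discrete Gronwall estimate thus keeps the two loops `O(ε)` apart. From then on
both controllers are LQR up to `ε`, which contracts the deviation, and after the switch it decays
geometrically. So each of the first `O(τ)` stages costs `O(ε)`, and the remaining ones `O(ε)`
together.

For the training event, the samples of stage `t` are independent of the controllers learned before
stage `t`. An empirical risk minimizer has zero empirical loss, because the expert is in the class;
it therefore disagrees with the expert with probability `Λ / n_t` at most, and the schedule makes
these errors sum to at most `2 Λ / n`. Where the learned controllers imitate the expert, their error
is a disturbance in the ball of radius `ε`, so that the test at `τ` is passed with high probability;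
conversely, a test passed by `ℓ` fresh samples certifies that the terminal set is reached.
-/

theorem lipschitzOnWith_of_finite_cover {E κ : Type*} [PseudoMetricSpace E] [Finite κ] {f : ℝ → E}
    {I : Set ℝ} {c : κ → Set ℝ} {K : NNReal} (hI : I.OrdConnected) (hf : ContinuousOn f I)
    (hcov : I ⊆ ⋃ j, c j) (hL : ∀ j, LipschitzOnWith K f (c j ∩ I)) : LipschitzOnWith K f I := by
  suffices h : ∀ a ∈ I, ∀ b ∈ I, a ≤ b → dist (f b) (f a) ≤ K * (b - a) by
    refine LipschitzOnWith.of_dist_le_mul fun a ha b hb => ?_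
    rcases le_total a b with hab | hab
    · rw [dist_comm, dist_comm a, Real.dist_eq, abs_of_nonneg (sub_nonneg.2 hab)]
      exact h a ha b hb hab
    · rw [Real.dist_eq, abs_of_nonneg (sub_nonneg.2 hab)]
      exact h b hb a ha hab
  intro a ha b hb hab
  have hsub : Set.Icc a b ⊆ I := hI.out ha hb
  have hfab : ContinuousOn f (Set.Icc a b) := hf.mono hsub
  refine image_le_of_liminf_slope_right_le_deriv_boundary (f := fun t => dist (f t) (f a))
    (B := fun t => K * (t - a)) (B' := fun _ => (K : ℝ))
    ((continuous_id.dist continuous_const).comp_continuousOn hfab) (by simp)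
    (by fun_prop) (fun x _ => ?_) (fun x hx r hr => ?_) ⟨hab, le_rfl⟩
  · simpa using (((hasDerivAt_id x).sub_const a).const_mul (K : ℝ)).hasDerivWithinAt
  have hIoo : ∀ᶠ z in 𝓝[>] x, z ∈ Set.Ioo x b := Ioo_mem_nhdsGT hx.2
  have hIcc : ∀ {z}, z ∈ Set.Ioo x b → z ∈ Set.Icc a b := fun hz => ⟨hx.1.trans hz.1.le, hz.2.le⟩
  -- Finitely many pieces: one of them accumulates at `x` from the right.
  obtain ⟨j, hj⟩ : ∃ j, ∃ᶠ z in 𝓝[>] x, z ∈ c j := by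
    rw [← Filter.frequently_exists]
    exact (hIoo.mono fun z hz => Set.mem_iUnion.1 (hcov (hsub (hIcc hz)))).frequently
  have hlip : LipschitzOnWith K f (closure (c j ∩ Set.Icc a b)) :=
    ((hL j).mono (Set.inter_subset_inter_right _ hsub)).closure
      (hfab.mono (closure_minimal Set.inter_subset_right isClosed_Icc))
  have hxcl : x ∈ closure (c j ∩ Set.Icc a b) :=
    mem_closure_iff_frequently.2 (((hj.and_eventually hIoo).mono fun z hz =>
      ⟨hz.1, hIcc hz.2⟩).filter_mono nhdsWithin_le_nhds)
  refine (hj.and_eventually hIoo).mono fun z hz => ?_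
  have hxz : 0 < z - x := sub_pos.2 hz.2.1
  have hzx := hlip.dist_le_mul z (subset_closure ⟨hz.1, hIcc hz.2⟩) x hxcl
  rw [Real.dist_eq, abs_of_pos hxz] at hzx
  refine lt_of_le_of_lt ?_ hr
  rw [slope_def_field, div_le_iff₀ hxz]
  linarith [dist_triangle (f z) (f x) (f a)]

section FiberMin

/-- `u` minimizes `Φ` over the fiber of `s` above `x`: the abstract form of an optimization problem
with parameter `x` and unknown `u`. -/
def IsFiberMin {E F β : Type*} [LE β] (Φ : E × F → β) (s : Set (E × F)) (x : E) (u : F) : Prop :=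
  (x, u) ∈ s ∧ ∀ v, (x, v) ∈ s → Φ (x, u) ≤ Φ (x, v)

theorem bilinForm_sub_add_four_mul_midpoint {V : Type*} [AddCommGroup V] [Module ℝ V]
    (q : LinearMap.BilinForm ℝ V) (z z' : V) :
    q (z - z') (z - z') + 4 * q (midpoint ℝ z z') (midpoint ℝ z z') = 2 * q z z + 2 * q z' z' := by
  simp only [midpoint_eq_smul_add, map_sub, map_add, map_smul, LinearMap.sub_apply,
    LinearMap.add_apply, LinearMap.smul_apply, smul_eq_mul, invOf_eq_inv]
  ring

theorem convexOn_bilinForm_self {V : Type*} [AddCommGroup V] [Module ℝ V]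
    {q : LinearMap.BilinForm ℝ V} (hq : ∀ z, 0 ≤ q z z) : ConvexOn ℝ Set.univ fun z => q z z := by
  refine ⟨convex_univ, fun z _ z' _ α β hα hβ hαβ => ?_⟩
  have h := mul_nonneg (mul_nonneg hα hβ) (hq (z - z'))
  obtain rfl : β = 1 - α := by linarith
  simp only [map_sub, map_add, map_smul, LinearMap.sub_apply, LinearMap.add_apply,
    LinearMap.smul_apply, smul_eq_mul] at h ⊢
  linarith

theorem continuous_bilinForm_self {V : Type*} [NormedAddCommGroup V] [NormedSpace ℝ V]
    [FiniteDimensional ℝ V] (q : LinearMap.BilinForm ℝ V) : Continuous fun z => q z z :=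
  q.toContinuousBilinearMap.continuous.clm_apply continuous_id

variable {E F ι : Type*} [NormedAddCommGroup E] [NormedSpace ℝ E]
  [NormedAddCommGroup F] [NormedSpace ℝ F]
  {q : LinearMap.BilinForm ℝ (E × F)} {μ : ℝ} {s : Set (E × F)}

theorem IsFiberMin.mul_sq_norm_sub_le (hq : ∀ z, μ * ‖z.2‖ ^ 2 ≤ q z z) (hs : Convex ℝ s) {x y : E}
    {u v w : F} (hw : IsFiberMin (fun z => q z z) s (midpoint ℝ x y) w)
    (hu : (x, u) ∈ s) (hv : (y, v) ∈ s) :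
    μ * ‖u - v‖ ^ 2 ≤ 2 * q (x, u) (x, u) + 2 * q (y, v) (y, v)
      - 4 * q (midpoint ℝ x y, w) (midpoint ℝ x y, w) := by
  have hmid : q (midpoint ℝ x y, w) (midpoint ℝ x y, w)
      ≤ q (midpoint ℝ (x, u) (y, v)) (midpoint ℝ (x, u) (y, v)) :=
    hw.2 (midpoint ℝ u v) (hs.midpoint_mem hu hv)
  have hdiff : μ * ‖u - v‖ ^ 2 ≤ q ((x, u) - (y, v)) ((x, u) - (y, v)) := hq ((x, u) - (y, v))
  linarith [bilinForm_sub_add_four_mul_midpoint q (x, u) (y, v)]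

theorem IsFiberMin.eq_of_le (hμ : 0 < μ) (hq : ∀ z, μ * ‖z.2‖ ^ 2 ≤ q z z) (hs : Convex ℝ s) {x : E}
    {u v : F} (hu : IsFiberMin (fun z => q z z) s x u) (hv : (x, v) ∈ s)
    (hle : q (x, v) (x, v) ≤ q (x, u) (x, u)) : v = u := by
  have hgap : μ * ‖v - u‖ ^ 2 ≤ 0 := by
    have := IsFiberMin.mul_sq_norm_sub_le (w := u) hq hs (by rwa [midpoint_self]) hv hu.1
    rw [midpoint_self] at this
    linarith
  simpa [sub_eq_zero] using nonpos_of_mul_nonpos_right hgap hμ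

theorem convexOn_fiberMin_value {G : Type*} [AddCommGroup G] [Module ℝ G] {γ : G →ᵃ[ℝ] E}
    {m : G → F} {D : Set G} (hq : ∀ z, 0 ≤ q z z) (hs : Convex ℝ s) (hD : Convex ℝ D)
    (hm : ∀ t ∈ D, IsFiberMin (fun z => q z z) s (γ t) (m t)) :
    ConvexOn ℝ D fun t => q (γ t, m t) (γ t, m t) := by
  refine ⟨hD, fun a ha b hb α β hα hβ hαβ => ?_⟩
  have hγ : α • γ a + β • γ b = γ (α • a + β • b) := (Convex.combo_affine_apply hαβ).symm
  have hmem := hs (hm a ha).1 (hm b hb).1 hα hβ hαβ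
  have hle := (convexOn_bilinForm_self hq).2 (Set.mem_univ (γ a, m a)) (Set.mem_univ (γ b, m b))
    hα hβ hαβ
  rw [Prod.smul_mk, Prod.smul_mk, Prod.mk_add_mk, hγ] at hmem hle
  exact ((hm _ (hD ha hb hα hβ hαβ)).2 _ hmem).trans hle

theorem IsFiberMin.stationary (hsymm : q.IsSymm) {x : E} {u w : F}
    (hu : IsFiberMin (fun z => q z z) s x u)
    (hw : ∀ᶠ c : ℝ in 𝓝 0, (x, u) + c • ((0 : E), w) ∈ s) : q (x, u) (0, w) = 0 := by
  let f : ℝ → ℝ := fun c => q (x, u) (x, u) + 2 * q (x, u) (0, w) * c + q (0, w) (0, w) * c ^ 2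
  have hf : ∀ c, f c = q ((x, u) + c • ((0 : E), w)) ((x, u) + c • ((0 : E), w)) := fun c => by
    simp only [f, map_add, map_smul, LinearMap.add_apply, LinearMap.smul_apply, smul_eq_mul,
      hsymm.eq (0, w) (x, u)]
    ring
  have hmin : IsLocalMin f 0 := by
    filter_upwards [hw] with c hc
    rw [hf, hf, zero_smul, add_zero]
    have hcu : (x, u) + c • ((0 : E), w) = (x, u + c • w) := by simp
    rw [hcu] at hc ⊢
    exact hu.2 _ hc
  have hderiv : HasDerivAt f (2 * q (x, u) (0, w)) 0 := by
    have := (((hasDerivAt_id (0 : ℝ)).const_mul (2 * q (x, u) (0, w))).const_add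
      (q (x, u) (x, u))).fun_add (((hasDerivAt_id (0 : ℝ)).fun_pow 2).const_mul (q (0, w) (0, w)))
    simpa using this
  linarith [hmin.hasDerivAt_eq_zero hderiv]

/-- The set of displacements between two fiberwise stationary points of `q` at which the same
constraints `J` are active. -/
def stationaryDisplacements (g : ι → E × F →ₗ[ℝ] ℝ) (q : LinearMap.BilinForm ℝ (E × F))
    (J : Set ι) : Submodule ℝ (E × F) where
  carrier := {z | (∀ i ∈ J, g i z = 0) ∧ ∀ w : F, (∀ i ∈ J, g i (0, w) = 0) → q z (0, w) = 0}
  zero_mem' := by simp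
  add_mem' := by
    rintro a b ⟨ha, ha'⟩ ⟨hb, hb'⟩
    exact ⟨fun i hi => by simp [ha i hi, hb i hi], fun w hw => by simp [ha' w hw, hb' w hw]⟩
  smul_mem' := by
    rintro c a ⟨ha, ha'⟩
    exact ⟨fun i hi => by simp [ha i hi], fun w hw => by simp [ha' w hw]⟩

theorem exists_norm_snd_le_of_mem_stationaryDisplacements [FiniteDimensional ℝ E]
    [FiniteDimensional ℝ F] (g : ι → E × F →ₗ[ℝ] ℝ) (hμ : 0 < μ)
    (hq : ∀ z, μ * ‖z.2‖ ^ 2 ≤ q z z) (J : Set ι) :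
    ∃ L : NNReal, ∀ z ∈ stationaryDisplacements g q J, ‖z.2‖ ≤ L * ‖z.1‖ := by
  let p : stationaryDisplacements g q J →ₗ[ℝ] E :=
    (LinearMap.fst ℝ E F).comp (stationaryDisplacements g q J).subtype
  have hker : p.ker = ⊥ := by
    rw [LinearMap.ker_eq_bot']
    rintro ⟨⟨x, u⟩, hactive, hstat⟩ h0
    obtain rfl : x = 0 := h0
    have hle : μ * ‖u‖ ^ 2 ≤ 0 := (hq (0, u)).trans_eq (hstat u hactive)
    have hu : u = 0 := by simpa using nonpos_of_mul_nonpos_right hle hμ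
    simp [hu]
  obtain ⟨L, -, hL⟩ := p.exists_antilipschitzWith hker
  refine ⟨L, fun z hz => (norm_snd_le z).trans ?_⟩
  have h := hL.le_mul_dist ⟨z, hz⟩ 0
  rwa [map_zero, dist_zero_right, dist_zero_right] at h

theorem continuousOn_fiberMin_interior {G : Type*} [NormedAddCommGroup G] [NormedSpace ℝ G]
    [FiniteDimensional ℝ G] {γ : G →ᵃ[ℝ] E} {m : G → F} {D : Set G} (hμ : 0 < μ)
    (hq : ∀ z, μ * ‖z.2‖ ^ 2 ≤ q z z) (hs : Convex ℝ s) (hD : Convex ℝ D)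
    (hm : ∀ t ∈ D, IsFiberMin (fun z => q z z) s (γ t) (m t)) :
    ContinuousOn m (interior D) := by
  let φ : G → ℝ := fun t => q (γ t, m t) (γ t, m t)
  have hφ : ConvexOn ℝ D φ := convexOn_fiberMin_value
    (fun z => (by positivity : 0 ≤ μ * ‖z.2‖ ^ 2).trans (hq z)) hs hD hm
  intro t₀ ht₀
  have hφt₀ : ContinuousAt φ t₀ :=
    hφ.continuousOn_interior.continuousAt (isOpen_interior.mem_nhds ht₀)
  have hmid : Filter.Tendsto (fun t => φ (midpoint ℝ t t₀)) (𝓝 t₀) (𝓝 (φ t₀)) := by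
    refine hφt₀.tendsto.comp ?_
    have : Continuous fun t : G => midpoint ℝ t t₀ := by
      simp only [midpoint_eq_smul_add]; fun_prop
    simpa using this.tendsto t₀
  have hgap : Filter.Tendsto (fun t => (2 * φ t + 2 * φ t₀ - 4 * φ (midpoint ℝ t t₀)) / μ)
      (𝓝 t₀) (𝓝 0) := by
    convert (((hφt₀.tendsto.const_mul 2).add_const (2 * φ t₀)).sub (hmid.const_mul 4)).div_const μ
      using 2
    ring
  have hsq : Filter.Tendsto (fun t => ‖m t - m t₀‖ ^ 2) (𝓝 t₀) (𝓝 0) := by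
    refine squeeze_zero' (Filter.Eventually.of_forall fun _ => by positivity) ?_ hgap
    filter_upwards [isOpen_interior.mem_nhds ht₀] with t ht
    have hw := hm _ (hD.midpoint_mem (interior_subset ht) (interior_subset ht₀))
    rw [γ.map_midpoint] at hw
    rw [le_div_iff₀' hμ]
    simpa only [φ, γ.map_midpoint] using hw.mul_sq_norm_sub_le hq hs
      (hm t (interior_subset ht)).1 (hm t₀ (interior_subset ht₀)).1
  refine ContinuousAt.continuousWithinAt (tendsto_iff_norm_sub_tendsto_zero.2 ?_)
  simpa [Real.sqrt_sq] using hsq.sqrt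

variable {g : ι → E × F →ₗ[ℝ] ℝ} {h : ι → ℝ}

/-- In the fiber direction, `s` is locally cut out by the constraints `g i ≤ h i` that are active:
from any point one can move a little along the directions which the active constraints ignore.
The right-hand sides `h` enter only through the active sets, which is what makes the estimates
below uniform in `h`. -/
def IsFiberwisePolyhedral (g : ι → E × F →ₗ[ℝ] ℝ) (h : ι → ℝ) (s : Set (E × F)) : Prop :=
  ∀ z ∈ s, ∀ w : F, (∀ i, g i z = h i → g i (0, w) = 0) →
    ∀ᶠ c : ℝ in 𝓝 0, z + c • ((0 : E), w) ∈ s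

theorem exists_dist_fiberMin_le_of_active_eq [FiniteDimensional ℝ E] [FiniteDimensional ℝ F]
    [Finite ι] (g : ι → E × F →ₗ[ℝ] ℝ) (hμ : 0 < μ) (hsymm : q.IsSymm)
    (hq : ∀ z, μ * ‖z.2‖ ^ 2 ≤ q z z) :
    ∃ L : NNReal, ∀ (s : Set (E × F)) (h : ι → ℝ), IsFiberwisePolyhedral g h s →
      ∀ x y u v, IsFiberMin (fun z => q z z) s x u → IsFiberMin (fun z => q z z) s y v →
        {i | g i (x, u) = h i} = {i | g i (y, v) = h i} → dist u v ≤ L * dist x y := by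
  choose LJ hLJ using exists_norm_snd_le_of_mem_stationaryDisplacements g hμ hq
  obtain ⟨L, hL⟩ := (Set.finite_range LJ).bddAbove
  refine ⟨L, fun s h hpoly x y u v hu hv hact => ?_⟩
  have hactive : ∀ i, g i (x, u) = h i ↔ g i (y, v) = h i := Set.ext_iff.1 hact
  have hmem : (x, u) - (y, v) ∈ stationaryDisplacements g q {i | g i (x, u) = h i} := by
    refine ⟨fun i hi => ?_, fun w hw => ?_⟩
    · rw [map_sub, show g i (x, u) = h i from hi, (hactive i).1 hi, sub_self]
    · rw [map_sub, LinearMap.sub_apply, hu.stationary hsymm (hpoly _ hu.1 w hw),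
        hv.stationary hsymm (hpoly _ hv.1 w fun i hi => hw i ((hactive i).2 hi)), sub_self]
  rw [dist_eq_norm, dist_eq_norm]
  refine (hLJ _ _ hmem).trans ?_
  exact mul_le_mul_of_nonneg_right (hL ⟨_, rfl⟩) (norm_nonneg (x - y))

variable {L K : NNReal} {x y : E} {m : ℝ → F}

theorem lipschitzOnWith_fiberMin_interior [Finite ι] (hμ : 0 < μ)
    (hq : ∀ z, μ * ‖z.2‖ ^ 2 ≤ q z z) (hs : Convex ℝ s) {D : Set ℝ} (hD : Convex ℝ D)
    (hm : ∀ t ∈ D, IsFiberMin (fun z => q z z) s (AffineMap.lineMap x y t) (m t))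
    (hL : ∀ x y u v, IsFiberMin (fun z => q z z) s x u → IsFiberMin (fun z => q z z) s y v →
      {i | g i (x, u) = h i} = {i | g i (y, v) = h i} → dist u v ≤ L * dist x y) :
    LipschitzOnWith (L * nndist x y) m (interior D) := by
  -- The pieces of the cover are the parameters with a given active set.
  refine lipschitzOnWith_of_finite_cover (κ := Set ι)
    (c := fun J => {t | {i | g i (AffineMap.lineMap x y t, m t) = h i} = J})
    hD.interior.ordConnected (continuousOn_fiberMin_interior hμ hq hs hD hm)
    (fun t _ => Set.mem_iUnion.2 ⟨_, rfl⟩) fun J => LipschitzOnWith.of_dist_le_mul ?_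
  rintro a ⟨haJ, ha⟩ b ⟨hbJ, hb⟩
  refine (hL _ _ _ _ (hm a (interior_subset ha)) (hm b (interior_subset hb))
    (haJ.trans (Eq.symm hbJ))).trans_eq ?_
  rw [dist_lineMap_lineMap, NNReal.coe_mul, coe_nndist]
  ring

theorem tendsto_fiberMin_endpoint [FiniteDimensional ℝ E] [FiniteDimensional ℝ F] (hμ : 0 < μ)
    (hq : ∀ z, μ * ‖z.2‖ ^ 2 ≤ q z z) (hs : Convex ℝ s) (hcl : IsClosed s)
    (hm : ∀ t ∈ Set.Icc (0 : ℝ) 1,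
      IsFiberMin (fun z => q z z) s (AffineMap.lineMap x y t) (m t))
    (hK : LipschitzOnWith K m (Set.Ioo 0 1)) {e : ℝ} (he : e = 0 ∨ e = 1) :
    Filter.Tendsto m (𝓝[Set.Ioo 0 1] e) (𝓝 (m e)) := by
  have : CompleteSpace F := FiniteDimensional.complete ℝ F
  have heI : e ∈ Set.Icc (0 : ℝ) 1 := by rcases he with rfl | rfl <;> norm_num
  have : (𝓝[Set.Ioo (0 : ℝ) 1] e).NeBot := mem_closure_iff_nhdsWithin_neBot.1
    (by rwa [closure_Ioo zero_ne_one])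
  obtain ⟨u, hu⟩ : ∃ u, Filter.Tendsto m (𝓝[Set.Ioo 0 1] e) (𝓝 u) :=
    CompleteSpace.complete ((cauchy_nhds.mono nhdsWithin_le_nhds).map_of_le
      hK.uniformContinuousOn inf_le_right)
  have hpair : Filter.Tendsto (fun t => (AffineMap.lineMap x y t, m t)) (𝓝[Set.Ioo 0 1] e)
      (𝓝 (AffineMap.lineMap x y e, u)) :=
    ((AffineMap.lineMap_continuous.tendsto e).mono_left nhdsWithin_le_nhds).prodMk_nhds hu
  have hmem : (AffineMap.lineMap x y e, u) ∈ s := hcl.mem_of_tendsto hpair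
    (Filter.mem_of_superset self_mem_nhdsWithin fun t ht => (hm t (Set.Ioo_subset_Icc_self ht)).1)
  let φ : ℝ → ℝ := fun t => q (AffineMap.lineMap x y t, m t) (AffineMap.lineMap x y t, m t)
  have hφ : ConvexOn ℝ (Set.Icc 0 1) φ := convexOn_fiberMin_value
    (fun z => (by positivity : 0 ≤ μ * ‖z.2‖ ^ 2).trans (hq z)) hs (convex_Icc 0 1) hm
  have hchord : ∀ t ∈ Set.Ioo (0 : ℝ) 1, φ t ≤ (1 - t) * φ 0 + t * φ 1 := fun t ht => by
    simpa using hφ.2 (by simp : (0 : ℝ) ∈ Set.Icc (0 : ℝ) 1) (by simp : (1 : ℝ) ∈ Set.Icc (0 : ℝ) 1)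
      (sub_nonneg.2 ht.2.le) ht.1.le (by ring)
  have hφe : (1 - e) * φ 0 + e * φ 1 = φ e := by rcases he with rfl | rfl <;> ring
  have hle : q (AffineMap.lineMap x y e, u) (AffineMap.lineMap x y e, u) ≤ φ e := by
    rw [← hφe]
    refine le_of_tendsto_of_tendsto (((continuous_bilinForm_self q).tendsto _).comp hpair)
      (((by fun_prop : Continuous fun t : ℝ => (1 - t) * φ 0 + t * φ 1).tendsto e).mono_left
        nhdsWithin_le_nhds) (Filter.mem_of_superset self_mem_nhdsWithin hchord)
  exact (hm e heI).eq_of_le hμ hq hs hmem hle ▸ hu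

/-- Parametric quadratic programming: along a segment of parameters the value function is convex,
so the minimizer is continuous inside the segment; by stationarity it is Lipschitz as long as the
active set does not change, and only finitely many active sets occur. -/
theorem exists_lipschitz_fiberMin [FiniteDimensional ℝ E] [FiniteDimensional ℝ F] [Finite ι]
    (g : ι → E × F →ₗ[ℝ] ℝ) (hμ : 0 < μ) (hsymm : q.IsSymm) (hq : ∀ z, μ * ‖z.2‖ ^ 2 ≤ q z z) :
    ∃ L : NNReal, ∀ (s : Set (E × F)) (h : ι → ℝ), Convex ℝ s → IsClosed s →
      IsFiberwisePolyhedral g h s →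
      (∀ z ∈ s, ∃ u, IsFiberMin (fun z => q z z) s z.1 u) →
      ∀ x y u v, IsFiberMin (fun z => q z z) s x u → IsFiberMin (fun z => q z z) s y v →
        dist u v ≤ L * dist x y := by
  obtain ⟨L, hL⟩ := exists_dist_fiberMin_le_of_active_eq g hμ hsymm hq
  refine ⟨L, fun s h hs hcl hpoly hex x y u v hu hv => ?_⟩
  have hmin : ∀ t ∈ Set.Icc (0 : ℝ) 1,
      ∃ w, IsFiberMin (fun z => q z z) s (AffineMap.lineMap x y t) w := fun t ht => by
    have hmem := hs.lineMap_mem hu.1 hv.1 ht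
    simpa using hex _ hmem
  choose! m hm using hmin
  have hlip : LipschitzOnWith (L * nndist x y) m (Set.Ioo 0 1) := by
    simpa only [interior_Icc] using
      lipschitzOnWith_fiberMin_interior hμ hq hs (convex_Icc 0 1) hm (hL s h hpoly)
  have h0 := tendsto_fiberMin_endpoint hμ hq hs hcl hm hlip (.inl rfl)
  have h1 := tendsto_fiberMin_endpoint hμ hq hs hcl hm hlip (.inr rfl)
  have h01 : dist (m 0) (m 1) ≤ L * dist x y := by
    have hne0 : (𝓝[Set.Ioo (0 : ℝ) 1] 0).NeBot := mem_closure_iff_nhdsWithin_neBot.1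
      (by rw [closure_Ioo zero_ne_one]; simp)
    have hne1 : (𝓝[Set.Ioo (0 : ℝ) 1] 1).NeBot := mem_closure_iff_nhdsWithin_neBot.1
      (by rw [closure_Ioo zero_ne_one]; simp)
    refine le_of_tendsto ((h0.comp Filter.tendsto_fst).dist (h1.comp Filter.tendsto_snd)) ?_
    filter_upwards [Filter.prod_mem_prod self_mem_nhdsWithin self_mem_nhdsWithin] with t ht
    refine (hlip.dist_le_mul _ ht.1 _ ht.2).trans ?_
    rw [NNReal.coe_mul, coe_nndist]
    exact mul_le_of_le_one_right (by positivity)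
      (Real.dist_le_of_mem_Icc_01 (Set.Ioo_subset_Icc_self ht.1) (Set.Ioo_subset_Icc_self ht.2))
  have hu0 : u = m 0 := by
    have := hm 0 (by norm_num)
    rw [AffineMap.lineMap_apply_zero] at this
    exact this.eq_of_le hμ hq hs hu.1 (hu.2 _ this.1)
  have hv1 : v = m 1 := by
    have := hm 1 (by norm_num)
    rw [AffineMap.lineMap_apply_one] at this
    exact this.eq_of_le hμ hq hs hv.1 (hv.2 _ this.1)
  rwa [hu0, hv1]

end FiberMin

section MatrixVector

variable {k m n : ℕ}

theorem mv_add (M : Matrix (Fin m) (Fin n) ℝ) (x y : Vec n) : mv M (x + y) = mv M x + mv M y :=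
  map_add _ _ _

theorem mv_sub (M : Matrix (Fin m) (Fin n) ℝ) (x y : Vec n) : mv M (x - y) = mv M x - mv M y :=
  map_sub _ _ _

theorem mv_smul (M : Matrix (Fin m) (Fin n) ℝ) (c : ℝ) (x : Vec n) : mv M (c • x) = c • mv M x :=
  map_smul _ _ _

@[simp]
theorem mv_zero (M : Matrix (Fin m) (Fin n) ℝ) : mv M (0 : Vec n) = 0 := map_zero _

theorem zero_mv (x : Vec n) : mv (0 : Matrix (Fin m) (Fin n) ℝ) x = 0 := by simp [mv]

theorem add_mv (M N : Matrix (Fin m) (Fin n) ℝ) (x : Vec n) :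
    mv (M + N) x = mv M x + mv N x := by
  simp [mv]

theorem mul_mv (M : Matrix (Fin m) (Fin n) ℝ) (N : Matrix (Fin n) (Fin k) ℝ) (x : Vec k) :
    mv (M * N) x = mv M (mv N x) := by
  simp [mv, Matrix.toLpLin_apply, Matrix.mulVec_mulVec]

theorem one_mv (x : Vec n) : mv (1 : Matrix (Fin n) (Fin n) ℝ) x = x := by
  simp [mv]

theorem continuous_mv (M : Matrix (Fin m) (Fin n) ℝ) : Continuous (mv M) :=
  (Matrix.toEuclideanLin M).continuous_of_finiteDimensional

theorem norm_mv_le (M : Matrix (Fin m) (Fin n) ℝ) (x : Vec n) : ‖mv M x‖ ≤ opNorm M * ‖x‖ :=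
  (Matrix.toEuclideanLin M).toContinuousLinearMap.le_opNorm x

theorem opNorm_nonneg (M : Matrix (Fin m) (Fin n) ℝ) : 0 ≤ opNorm M := norm_nonneg _

theorem opNorm_pos {M : Matrix (Fin m) (Fin n) ℝ} (hM : M ≠ 0) : 0 < opNorm M := by
  simpa [opNorm] using hM

theorem inner_mv_left (M : Matrix (Fin m) (Fin n) ℝ) (x : Vec n) (y : Vec m) :
    inner ℝ (mv M x) y = inner ℝ x (mv M.transpose y) := by
  have := Matrix.toEuclideanLin_conjTranspose_eq_adjoint M
  rw [Matrix.conjTranspose_eq_transpose_of_trivial] at this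
  simp only [mv, this, LinearMap.adjoint_inner_right]

theorem inner_mv_comm {M : Matrix (Fin n) (Fin n) ℝ} (hM : M.IsHermitian) (x y : Vec n) :
    inner ℝ x (mv M y) = inner ℝ y (mv M x) := by
  have hT : M.transpose = M := by
    simpa only [Matrix.conjTranspose_eq_transpose_of_trivial] using hM.eq
  rw [real_inner_comm, inner_mv_left, hT]

theorem inner_mv_le (M : Matrix (Fin m) (Fin n) ℝ) (x : Vec m) (y : Vec n) :
    inner ℝ x (mv M y) ≤ opNorm M * ‖x‖ * ‖y‖ :=
  calc inner ℝ x (mv M y) ≤ ‖x‖ * ‖mv M y‖ := real_inner_le_norm _ _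
    _ ≤ ‖x‖ * (opNorm M * ‖y‖) := by gcongr; exact norm_mv_le M y
    _ = opNorm M * ‖x‖ * ‖y‖ := by ring

@[simp]
theorem quadForm_zero (M : Matrix (Fin n) (Fin n) ℝ) : quadForm M 0 = 0 := by simp [quadForm]

theorem quadForm_add {M : Matrix (Fin n) (Fin n) ℝ} (hM : M.IsHermitian) (x y : Vec n) :
    quadForm M (x + y) = quadForm M x + 2 * inner ℝ y (mv M x) + quadForm M y := by
  simp only [quadForm, mv_add, inner_add_left, inner_add_right, inner_mv_comm hM x y]
  ring

theorem quadForm_smul (M : Matrix (Fin n) (Fin n) ℝ) (c : ℝ) (x : Vec n) :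
    quadForm M (c • x) = c ^ 2 * quadForm M x := by
  simp only [quadForm, mv_smul, real_inner_smul_left, real_inner_smul_right]
  ring

theorem quadForm_le (M : Matrix (Fin n) (Fin n) ℝ) (x : Vec n) :
    quadForm M x ≤ opNorm M * ‖x‖ ^ 2 :=
  (inner_mv_le M x x).trans_eq (by ring)

theorem quadForm_sub_le (M : Matrix (Fin n) (Fin n) ℝ) (x y : Vec n) :
    quadForm M x - quadForm M y ≤ opNorm M * (‖x‖ + ‖y‖) * ‖x - y‖ :=
  calc quadForm M x - quadForm M y
      = inner ℝ x (mv M (x - y)) + inner ℝ (x - y) (mv M y) := by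
        simp only [quadForm, mv_sub, inner_sub_left, inner_sub_right]
        ring
    _ ≤ opNorm M * ‖x‖ * ‖x - y‖ + opNorm M * ‖x - y‖ * ‖y‖ :=
        add_le_add (inner_mv_le M x (x - y)) (inner_mv_le M (x - y) y)
    _ = opNorm M * (‖x‖ + ‖y‖) * ‖x - y‖ := by ring

theorem quadForm_eq_dotProduct (M : Matrix (Fin n) (Fin n) ℝ) (x : Vec n) :
    quadForm M x = x.ofLp ⬝ᵥ (M.mulVec x.ofLp) := by
  simp [quadForm, mv, Matrix.toLpLin_apply, EuclideanSpace.inner_eq_star_dotProduct,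
    dotProduct_comm]

theorem quadForm_nonneg {M : Matrix (Fin n) (Fin n) ℝ} (hM : M.PosSemidef) (x : Vec n) :
    0 ≤ quadForm M x := by
  rw [quadForm_eq_dotProduct]
  simpa using hM.dotProduct_mulVec_nonneg x.ofLp

theorem quadForm_pos {M : Matrix (Fin n) (Fin n) ℝ} (hM : M.PosDef) {x : Vec n} (hx : x ≠ 0) :
    0 < quadForm M x := by
  rw [quadForm_eq_dotProduct]
  have : x.ofLp ≠ 0 := fun h => hx (by ext i; simp [h])
  simpa using hM.dotProduct_mulVec_pos this

theorem continuous_quadForm (M : Matrix (Fin n) (Fin n) ℝ) : Continuous (quadForm M) :=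
  continuous_id.inner (continuous_mv M)

theorem exists_mul_sq_norm_le_quadForm {M : Matrix (Fin n) (Fin n) ℝ} (hM : M.PosDef) :
    ∃ μ : ℝ, 0 < μ ∧ ∀ x : Vec n, μ * ‖x‖ ^ 2 ≤ quadForm M x := by
  rcases subsingleton_or_nontrivial (Vec n) with _ | _
  · exact ⟨1, one_pos, fun x => by simp [Subsingleton.elim x 0]⟩
  obtain ⟨z, hz, hmin⟩ := (isCompact_sphere (0 : Vec n) 1).exists_isMinOn
    (NormedSpace.sphere_nonempty.2 zero_le_one) (continuous_quadForm M).continuousOn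
  refine ⟨quadForm M z, quadForm_pos hM (ne_zero_of_mem_unit_sphere ⟨z, hz⟩), fun x => ?_⟩
  by_cases hx : x = 0
  · simp [hx]
  have hunit : quadForm M z ≤ quadForm M (‖x‖⁻¹ • x) :=
    hmin (show ‖x‖⁻¹ • x ∈ sphere (0 : Vec n) 1 by simp [norm_smul, hx])
  have hx' : 0 < ‖x‖ := norm_pos_iff.2 hx
  rwa [quadForm_smul, inv_pow, inv_mul_eq_div, le_div_iff₀ (by positivity)] at hunit

theorem exists_contracting_norm {M : Matrix (Fin n) (Fin n) ℝ} {ρ σ : ℝ} (hρ : 0 < ρ)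
    (hM : ∀ k : ℕ, opNorm (M ^ k) ≤ σ * ρ ^ k) :
    ∃ ν : Vec n → ℝ, (∀ x, ‖x‖ ≤ ν x) ∧ (∀ x, ν x ≤ σ * ‖x‖) ∧
      (∀ x y, ν (x + y) ≤ ν x + ν y) ∧ ∀ x, ν (mv M x) ≤ ρ * ν x := by
  let f : Vec n → ℕ → ℝ := fun x k => (ρ ^ k)⁻¹ * ‖mv (M ^ k) x‖
  have hle : ∀ x k, f x k ≤ σ * ‖x‖ := fun x k => by
    rw [inv_mul_le_iff₀ (by positivity)]
    calc ‖mv (M ^ k) x‖ ≤ opNorm (M ^ k) * ‖x‖ := norm_mv_le _ _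
      _ ≤ σ * ρ ^ k * ‖x‖ := by gcongr; exact hM k
      _ = ρ ^ k * (σ * ‖x‖) := by ring
  have hbdd : ∀ x, BddAbove (Set.range (f x)) := fun x => ⟨σ * ‖x‖, Set.forall_mem_range.2 (hle x)⟩
  refine ⟨fun x => ⨆ k, f x k, fun x => ?_, fun x => ciSup_le (hle x),
    fun x y => ciSup_le fun k => ?_, fun x => ciSup_le fun k => ?_⟩
  · simpa [f, one_mv] using le_ciSup (hbdd x) 0
  · calc f (x + y) k ≤ (ρ ^ k)⁻¹ * (‖mv (M ^ k) x‖ + ‖mv (M ^ k) y‖) := by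
          simp only [f, mv_add]; gcongr; exact norm_add_le _ _
      _ = f x k + f y k := mul_add _ _ _
      _ ≤ _ := add_le_add (le_ciSup (hbdd x) k) (le_ciSup (hbdd y) k)
  · calc f (mv M x) k = ρ * f x (k + 1) := by
          simp only [f, ← mul_mv, ← pow_succ]; rw [pow_succ ρ]; field_simp
      _ ≤ ρ * ⨆ k, f x k := by gcongr; exact le_ciSup (hbdd x) (k + 1)

theorem exists_norm_le_of_quadForm_le {M : Matrix (Fin n) (Fin n) ℝ} (hM : M.PosDef) (F : ℝ) :
    ∃ β : ℝ, ∀ x : Vec n, quadForm M x ≤ F → ‖x‖ ≤ β := by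
  obtain ⟨μ, hμ, hge⟩ := exists_mul_sq_norm_le_quadForm hM
  refine ⟨√(F / μ), fun x hx => Real.le_sqrt_of_sq_le ?_⟩
  rw [le_div_iff₀' hμ]
  exact (hge x).trans hx

end MatrixVector

section Polyhedra

variable {n : ℕ} {X Y : Set (Vec n)}

theorem IsPolyhedron.isClosed (hX : IsPolyhedron X) : IsClosed X := by
  obtain ⟨m, a, b, rfl⟩ := hX
  simp only [Set.ofPred_forall]
  exact isClosed_iInter fun i => isClosed_le (by fun_prop) continuous_const

theorem IsPolyhedron.convex (hX : IsPolyhedron X) : Convex ℝ X := by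
  obtain ⟨m, a, b, rfl⟩ := hX
  simp only [Set.ofPred_forall]
  exact convex_iInter fun i => convex_halfSpace_le (innerₗ (Vec n) (a i)).isLinear (b i)

theorem isClosed_pontryaginDiff (hX : IsClosed X) : IsClosed (pontryaginDiff X Y) := by
  have : pontryaginDiff X Y = X ∩ ⋂ y ∈ Y, (fun x => x + y) ⁻¹' X := by
    ext x
    simp [pontryaginDiff]
  rw [this]
  exact hX.inter (isClosed_biInter fun y _ => hX.preimage (by fun_prop))

theorem convex_pontryaginDiff (hX : Convex ℝ X) : Convex ℝ (pontryaginDiff X Y) := by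
  have : pontryaginDiff X Y = X ∩ ⋂ y ∈ Y, (fun x => x + y) ⁻¹' X := by
    ext x
    simp [pontryaginDiff]
  rw [this]
  exact hX.inter (convex_iInter₂ fun y _ => hX.translate_preimage_left y)

theorem exists_pontryaginDiff_eq_halfSpaces {ι : Type*} (a : ι → Vec n) (b : ι → ℝ)
    (hY : Bornology.IsBounded Y) :
    ∃ h : ι → ℝ, pontryaginDiff {x | ∀ i, inner ℝ (a i) x ≤ b i} Y
      = {x | ∀ i, inner ℝ (a i) x ≤ h i} := by
  have hbdd : ∀ i, BddBelow ((fun y => b i - inner ℝ (a i) y) '' insert 0 Y) := fun i =>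
    ((hY.insert 0).isCompact_closure.bddBelow_image (by fun_prop)).mono
      (Set.image_mono subset_closure)
  refine ⟨fun i => sInf ((fun y => b i - inner ℝ (a i) y) '' insert 0 Y), ?_⟩
  ext p
  have hmem : p ∈ pontryaginDiff {x | ∀ i, inner ℝ (a i) x ≤ b i} Y ↔
      ∀ y ∈ insert 0 Y, ∀ i, inner ℝ (a i) (p + y) ≤ b i := by
    simp [pontryaginDiff]
  simp only [hmem, Set.mem_ofPred_eq, le_csInf_iff (hbdd _) ((Set.insert_nonempty _ _).image _),
    Set.forall_mem_image, inner_add_right, le_sub_iff_add_le]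
  exact ⟨fun h i y hy => h y hy i, fun h y hy i => h i hy⟩

theorem eventually_halfSpaces_add_smul {E ι : Type*} [NormedAddCommGroup E]
    [InnerProductSpace ℝ E] [Finite ι] {a : ι → E} {h : ι → ℝ} {p v : E}
    (hp : ∀ i, inner ℝ (a i) p ≤ h i) (hv : ∀ i, inner ℝ (a i) p = h i → inner ℝ (a i) v = 0) :
    ∀ᶠ c : ℝ in 𝓝 0, ∀ i, inner ℝ (a i) (p + c • v) ≤ h i := by
  rw [Filter.eventually_all]
  intro i
  rcases (hp i).eq_or_lt with hi | hi
  · refine Filter.Eventually.of_forall fun c => ?_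
    rw [inner_add_right, inner_smul_right, hv i hi, mul_zero, add_zero, hi]
  · have hcont : Continuous fun c : ℝ => inner ℝ (a i) (p + c • v) := by fun_prop
    exact (hcont.continuousAt.eventually_lt continuousAt_const (by simpa using hi)).mono
      fun _ => le_of_lt

end Polyhedra

namespace ControlSystem

variable {dx du : ℕ} {S : ControlSystem dx du} {Z : Set (Vec dx)}

section Dynamics

theorem step_eq (S : ControlSystem dx du) (x : Vec dx) (v : Vec du) :
    S.step x (mv S.K x + v) = mv S.AK x + mv S.B v := by
  simp only [step, AK, add_mv, mul_mv, mv_add, add_assoc]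

theorem step_lqr (S : ControlSystem dx du) (x : Vec dx) : S.step x (mv S.K x) = mv S.AK x := by
  simpa using S.step_eq x 0

theorem step_add (S : ControlSystem dx du) (x y : Vec dx) (u v : Vec du) :
    S.step (x + y) (u + v) = S.step x u + S.step y v := by
  simp only [step, mv_add]
  abel

theorem step_sub (S : ControlSystem dx du) (x y : Vec dx) (u v : Vec du) :
    S.step (x - y) (u - v) = S.step x u - S.step y v := by
  simp only [step, mv_sub]
  abel

theorem step_smul (S : ControlSystem dx du) (c : ℝ) (x : Vec dx) (u : Vec du) :
    S.step (c • x) (c • u) = c • S.step x u := by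
  simp only [step, mv_smul, smul_add]

theorem norm_step_le (S : ControlSystem dx du) (x : Vec dx) (u : Vec du) :
    ‖S.step x u‖ ≤ opNorm S.A * ‖x‖ + opNorm S.B * ‖u‖ :=
  (norm_add_le _ _).trans (add_le_add (norm_mv_le _ _) (norm_mv_le _ _))

end Dynamics

section Riccati

/-- The weight `R + Bᵀ P B` of the deviations from the LQR inputs. -/
noncomputable def inputWeight (S : ControlSystem dx du) : Matrix (Fin du) (Fin du) ℝ :=
  S.R + S.B.transpose * S.P * S.B

theorem Standing.inputWeight_posDef (hS : S.Standing) : S.inputWeight.PosDef := by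
  have hBPB := hS.P_posDef.posSemidef.conjTranspose_mul_mul_same S.B
  rw [Matrix.conjTranspose_eq_transpose_of_trivial] at hBPB
  exact hS.R_posDef.add_posSemidef hBPB

theorem Standing.quadForm_inputWeight_nonneg (hS : S.Standing) (v : Vec du) :
    0 ≤ quadForm S.inputWeight v :=
  quadForm_nonneg hS.inputWeight_posDef.posSemidef v

theorem quadForm_inputWeight (S : ControlSystem dx du) (v : Vec du) :
    quadForm S.inputWeight v = quadForm S.R v + quadForm S.P (mv S.B v) := by
  simp only [quadForm, inputWeight, add_mv, inner_add_right, mul_mv, inner_mv_left]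

theorem Standing.stageCost_nonneg (hS : S.Standing) (x : Vec dx) (u : Vec du) :
    0 ≤ S.stageCost x u :=
  add_nonneg (quadForm_nonneg hS.Q_posSemidef x) (quadForm_nonneg hS.R_posDef.posSemidef u)

theorem stageCost_le (S : ControlSystem dx du) (x : Vec dx) (u : Vec du) :
    S.stageCost x u ≤ opNorm S.Q * ‖x‖ ^ 2 + opNorm S.R * ‖u‖ ^ 2 :=
  add_le_add (quadForm_le _ _) (quadForm_le _ _)

theorem Standing.R_mul_K_add (hS : S.Standing) :
    S.R * S.K + S.B.transpose * S.P * S.AK = 0 := by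
  have hdet : IsUnit S.inputWeight.det :=
    (Matrix.isUnit_iff_isUnit_det _).1 hS.inputWeight_posDef.isUnit
  have hK : S.K = -(S.inputWeight⁻¹ * (S.B.transpose * S.P * S.A)) := by
    simp only [K, inputWeight, Matrix.mul_assoc]
  have hWK : S.inputWeight * S.K = -(S.B.transpose * S.P * S.A) := by
    rw [hK, Matrix.mul_neg, ← Matrix.mul_assoc, Matrix.mul_nonsing_inv _ hdet, Matrix.one_mul]
  calc S.R * S.K + S.B.transpose * S.P * S.AK
      = S.inputWeight * S.K + S.B.transpose * S.P * S.A := by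
        simp only [inputWeight, AK, Matrix.add_mul, Matrix.mul_add, Matrix.mul_assoc]
        abel
    _ = 0 := by rw [hWK, neg_add_cancel]

theorem Standing.inner_R_K_add (hS : S.Standing) (v : Vec du) (x : Vec dx) :
    inner ℝ v (mv S.R (mv S.K x)) + inner ℝ (mv S.B v) (mv S.P (mv S.AK x)) = 0 := by
  have h := congrArg (fun M => inner ℝ v (mv M x)) hS.R_mul_K_add
  simpa only [add_mv, mul_mv, inner_add_right, inner_mv_left, zero_mv, inner_zero_right] using h

theorem Standing.P_eq (hS : S.Standing) : S.P = S.A.transpose * S.P * S.AK + S.Q := by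
  have hdare : S.P = _ := hS.P_dare
  nth_rewrite 1 [hdare]
  simp only [AK, K, Matrix.mul_add, Matrix.mul_neg, Matrix.mul_assoc, sub_eq_add_neg]

theorem Standing.stageCost_lqr_add (hS : S.Standing) (x : Vec dx) :
    S.stageCost x (mv S.K x) + quadForm S.P (mv S.AK x) = quadForm S.P x := by
  have hP : quadForm S.P x = inner ℝ (mv S.A x) (mv S.P (mv S.AK x)) + quadForm S.Q x := by
    have h := congrArg (fun M => inner ℝ x (mv M x)) hS.P_eq
    simpa only [quadForm, add_mv, mul_mv, inner_add_right, inner_mv_left] using h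
  have hAK : quadForm S.P (mv S.AK x) = inner ℝ (mv S.A x) (mv S.P (mv S.AK x))
      + inner ℝ (mv S.B (mv S.K x)) (mv S.P (mv S.AK x)) := by
    simp only [quadForm, AK, add_mv, mul_mv, inner_add_left]
  have hstat := hS.inner_R_K_add (mv S.K x) x
  rw [hP, hAK, stageCost, quadForm.eq_def S.R]
  linarith

/-- Completion of squares: the stationarity identity `R K + Bᵀ P (A + B K) = 0` kills the cross
terms. -/
theorem Standing.stageCost_add_step (hS : S.Standing) (x : Vec dx) (u : Vec du) :
    S.stageCost x u + quadForm S.P (S.step x u)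
      = quadForm S.P x + quadForm S.inputWeight (u - mv S.K x) := by
  obtain ⟨v, rfl⟩ : ∃ v, u = mv S.K x + v := ⟨u - mv S.K x, (add_sub_cancel _ _).symm⟩
  have hlqr := hS.stageCost_lqr_add x
  have hcross := hS.inner_R_K_add v x
  rw [add_sub_cancel_left, step_eq, quadForm_inputWeight, stageCost,
    quadForm_add hS.R_posDef.isHermitian, quadForm_add hS.P_posDef.isHermitian]
  rw [stageCost] at hlqr
  linarith

end Riccati

section OpenLoop

theorem openLoop_succ_left (S : ControlSystem dx du) (x : Vec dx) (u : ℕ → Vec du) (t : ℕ) :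
    S.openLoop x u (t + 1) = S.openLoop (S.step x (u 0)) (fun k => u (k + 1)) t := by
  induction t with
  | zero => rfl
  | succ t ih => rw [openLoop, ih]; rfl

theorem openLoop_congr (S : ControlSystem dx du) (x : Vec dx) {u v : ℕ → Vec du} {t : ℕ}
    (h : ∀ k < t, u k = v k) : S.openLoop x u t = S.openLoop x v t := by
  induction t with
  | zero => rfl
  | succ t ih =>
    rw [openLoop, openLoop, ih fun k hk => h k (hk.trans t.lt_succ_self), h t t.lt_succ_self]

theorem openLoop_add (S : ControlSystem dx du) (x y : Vec dx) (u v : ℕ → Vec du) (t : ℕ) :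
    S.openLoop (x + y) (u + v) t = S.openLoop x u t + S.openLoop y v t := by
  induction t with
  | zero => rfl
  | succ t ih => rw [openLoop, openLoop, openLoop, ih, Pi.add_apply, step_add]

theorem openLoop_smul (S : ControlSystem dx du) (c : ℝ) (x : Vec dx) (u : ℕ → Vec du) (t : ℕ) :
    S.openLoop (c • x) (c • u) t = c • S.openLoop x u t := by
  induction t with
  | zero => rfl
  | succ t ih => rw [openLoop, openLoop, ih, Pi.smul_apply, step_smul]

theorem V_congr (S : ControlSystem dx du) (x : Vec dx) {u v : ℕ → Vec du}
    (h : ∀ k < S.N, u k = v k) : S.V x u = S.V x v := by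
  rw [V, V, S.openLoop_congr x h]
  congr 1
  refine Finset.sum_congr rfl fun k hk => ?_
  have hk := Finset.mem_range.1 hk
  rw [h k hk, S.openLoop_congr x fun j hj => h j (hj.trans hk)]

theorem Admissible.congr {x : Vec dx} {u v : ℕ → Vec du}
    (h : ∀ k < S.N, u k = v k) (hu : S.Admissible Z x u) : S.Admissible Z x v := by
  refine ⟨fun k hk => ?_, ?_⟩
  · rw [← h k hk, ← S.openLoop_congr x fun j hj => h j (hj.trans hk)]
    exact hu.1 k hk
  · rw [← S.openLoop_congr x h]
    exact hu.2

theorem Standing.V_eq (hS : S.Standing) (x : Vec dx) (u : ℕ → Vec du) :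
    S.V x u = quadForm S.P x
      + ∑ k ∈ Finset.range S.N, quadForm S.inputWeight (u k - mv S.K (S.openLoop x u k)) := by
  rw [V]
  generalize S.N = n
  induction n with
  | zero => simp [openLoop]
  | succ n ih =>
    have hstep := hS.stageCost_add_step (S.openLoop x u n) (u n)
    rw [Finset.sum_range_succ, Finset.sum_range_succ, openLoop]
    linarith

theorem Standing.quadForm_le_V (hS : S.Standing) (x : Vec dx) (u : ℕ → Vec du) :
    quadForm S.P x ≤ S.V x u := by
  rw [hS.V_eq]
  exact le_add_of_nonneg_right (Finset.sum_nonneg fun k _ => hS.quadForm_inputWeight_nonneg _)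

theorem Standing.norm_le_inputBound (hS : S.Standing) {u : Vec du} (hu : u ∈ S.U) :
    ‖u‖ ≤ S.inputBound :=
  le_csSup (hS.U_bounded.isCompact_closure.bddAbove_image continuous_norm.continuousOn |>.mono
    (Set.image_mono subset_closure)) ⟨u, hu, rfl⟩

theorem Standing.inputBound_nonneg (hS : S.Standing) : 0 ≤ S.inputBound :=
  (norm_nonneg _).trans (hS.norm_le_inputBound hS.zero_mem_U)

theorem Standing.norm_step_le (hS : S.Standing) (x : Vec dx) {u : Vec du} (hu : u ∈ S.U) :
    ‖S.step x u‖ ≤ opNorm S.A * ‖x‖ + opNorm S.B * S.inputBound :=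
  (S.norm_step_le x u).trans <| by
    gcongr
    exacts [opNorm_nonneg _, hS.norm_le_inputBound hu]

theorem Standing.exists_openLoop_bound (hS : S.Standing) (β : ℝ) (n : ℕ) :
    ∃ β' : ℝ, 0 ≤ β' ∧ ∀ (x : Vec dx) (u : ℕ → Vec du), ‖x‖ ≤ β → (∀ k < n, u k ∈ S.U) →
      ∀ k ≤ n, ‖S.openLoop x u k‖ ≤ β' := by
  induction n with
  | zero =>
    refine ⟨|β|, abs_nonneg _, fun x u hx _ k hk => ?_⟩
    obtain rfl := Nat.le_zero.1 hk
    exact hx.trans (le_abs_self β)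
  | succ n ih =>
    obtain ⟨β', hβ', hbound⟩ := ih
    refine ⟨max β' (opNorm S.A * β' + opNorm S.B * S.inputBound), hβ'.trans (le_max_left _ _),
      fun x u hx hu k hk => ?_⟩
    have hprev := hbound x u hx fun k hk => hu k (hk.trans n.lt_succ_self)
    obtain rfl | hk := eq_or_lt_of_le hk
    · refine ((hS.norm_step_le _ (hu n n.lt_succ_self)).trans ?_).trans (le_max_right _ _)
      gcongr
      exacts [opNorm_nonneg _, hprev n le_rfl]
    · exact (hprev k (Nat.lt_succ_iff.1 hk)).trans (le_max_left _ _)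

end OpenLoop

section TerminalSet

theorem rollout_lqr (S : ControlSystem dx du) (x : Vec dx) (t : ℕ) :
    S.rollout (fun _ => S.lqr) x t = mv (S.AK ^ t) x := by
  induction t with
  | zero => simp [rollout, one_mv]
  | succ t ih => rw [rollout, ih, lqr, step_lqr, ← mul_mv, ← pow_succ']

theorem mem_tightO_iff {x : Vec dx} : x ∈ S.tightO Z ↔
    ∀ t : ℕ, mv (S.AK ^ t) x ∈ S.tightX Z ∧ mv S.K (mv (S.AK ^ t) x) ∈ S.tightU Z := by
  constructor
  · rintro ⟨O, ⟨hOX, hO⟩, hx⟩ t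
    have hstay := hO x hx t
    rw [rollout_lqr] at hstay
    exact ⟨hOX hstay.1, hstay.2⟩
  · intro h
    refine ⟨{y | ∀ t : ℕ, mv (S.AK ^ t) y ∈ S.tightX Z ∧
      mv S.K (mv (S.AK ^ t) y) ∈ S.tightU Z}, ⟨fun y hy => ?_, fun y hy t => ?_⟩, h⟩
    · simpa [one_mv] using (hy 0).1
    · rw [rollout_lqr]
      refine ⟨fun s => ?_, (hy t).2⟩
      rw [← mul_mv, ← pow_add]
      exact hy (s + t)

theorem mv_AK_pow_mem_tightO {x : Vec dx} (hx : x ∈ S.tightO Z) (t : ℕ) :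
    mv (S.AK ^ t) x ∈ S.tightO Z := by
  rw [mem_tightO_iff] at hx ⊢
  intro s
  rw [← mul_mv, ← pow_add]
  exact hx (s + t)

theorem mv_AK_mem_tightO {x : Vec dx} (hx : x ∈ S.tightO Z) : mv S.AK x ∈ S.tightO Z := by
  simpa using mv_AK_pow_mem_tightO hx 1

theorem mem_tightX_of_mem_tightO {x : Vec dx} (hx : x ∈ S.tightO Z) : x ∈ S.tightX Z := by
  simpa [one_mv] using (mem_tightO_iff.1 hx 0).1

theorem mv_K_mem_tightU {x : Vec dx} (hx : x ∈ S.tightO Z) : mv S.K x ∈ S.tightU Z := by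
  simpa [one_mv] using (mem_tightO_iff.1 hx 0).2

theorem tightO_eq_iInter (S : ControlSystem dx du) (Z : Set (Vec dx)) :
    S.tightO Z = ⋂ t : ℕ, mv (S.AK ^ t) ⁻¹' S.tightX Z ∩
      (fun x => mv S.K (mv (S.AK ^ t) x)) ⁻¹' S.tightU Z := by
  ext x
  simp [mem_tightO_iff]

theorem Standing.isClosed_tightX (hS : S.Standing) : IsClosed (S.tightX Z) :=
  isClosed_pontryaginDiff hS.X_polyhedron.isClosed

theorem Standing.isClosed_tightU (hS : S.Standing) : IsClosed (S.tightU Z) :=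
  isClosed_pontryaginDiff hS.U_polyhedron.isClosed

theorem Standing.convex_tightX (hS : S.Standing) : Convex ℝ (S.tightX Z) :=
  convex_pontryaginDiff hS.X_polyhedron.convex

theorem Standing.convex_tightU (hS : S.Standing) : Convex ℝ (S.tightU Z) :=
  convex_pontryaginDiff hS.U_polyhedron.convex

theorem Standing.isClosed_tightO (hS : S.Standing) : IsClosed (S.tightO Z) := by
  rw [tightO_eq_iInter]
  exact isClosed_iInter fun t => (hS.isClosed_tightX.preimage (continuous_mv _)).inter
    (hS.isClosed_tightU.preimage ((continuous_mv _).comp (continuous_mv _)))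

theorem Standing.convex_tightO (hS : S.Standing) : Convex ℝ (S.tightO Z) := by
  intro x hx y hy a b ha hb hab
  rw [mem_tightO_iff] at *
  intro t
  simp only [mv_add, mv_smul]
  exact ⟨hS.convex_tightX (hx t).1 (hy t).1 ha hb hab,
    hS.convex_tightU (hx t).2 (hy t).2 ha hb hab⟩

theorem mem_X_of_sub_mem {x y : Vec dx} (hy : y ∈ S.tightX Z) (hxy : x - y ∈ Z) : x ∈ S.X := by
  simpa using hy.2 _ hxy

theorem add_mv_K_mem_U {u : Vec du} {z : Vec dx} (hu : u ∈ S.tightU Z) (hz : z ∈ Z) :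
    u + mv S.K z ∈ S.U :=
  hu.2 _ ⟨z, hz, rfl⟩

end TerminalSet

section Stability

/-- The exponential decay `‖(A + B K)ᵏ‖ ≤ σ ρᵏ` of the LQR loop. -/
structure LQRDecay (S : ControlSystem dx du) (ρ σ : ℝ) : Prop where
  rate_pos : 0 < ρ
  rate_lt_one : ρ < 1
  const_pos : 0 < σ
  opNorm_le : ∀ k : ℕ, opNorm (S.AK ^ k) ≤ σ * ρ ^ k

variable {ρ σ : ℝ}

theorem LQRDecay.norm_mv_AK_pow_le (hAK : S.LQRDecay ρ σ) (k : ℕ) (x : Vec dx) :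
    ‖mv (S.AK ^ k) x‖ ≤ σ * ρ ^ k * ‖x‖ :=
  (norm_mv_le _ _).trans (mul_le_mul_of_nonneg_right (hAK.opNorm_le k) (norm_nonneg x))

theorem LQRDecay.tendsto_mv_AK_pow (hAK : S.LQRDecay ρ σ) (x : Vec dx) :
    Filter.Tendsto (fun k => mv (S.AK ^ k) x) Filter.atTop (𝓝 0) := by
  refine squeeze_zero_norm (hAK.norm_mv_AK_pow_le · x) ?_
  simpa using ((tendsto_pow_atTop_nhds_zero_of_lt_one hAK.rate_pos.le
    hAK.rate_lt_one).const_mul σ).mul_const ‖x‖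

theorem LQRDecay.subset_of_tightO_nonempty (hAK : S.LQRDecay ρ σ) (hS : S.Standing)
    (hne : (S.tightO Z).Nonempty) : Z ⊆ S.X ∩ mv S.K ⁻¹' S.U := by
  obtain ⟨x, hx⟩ := hne
  have hlim := hAK.tendsto_mv_AK_pow x
  have hX : (0 : Vec dx) ∈ S.tightX Z := hS.isClosed_tightX.mem_of_tendsto hlim
    (Filter.Eventually.of_forall fun t => (mem_tightO_iff.1 hx t).1)
  have hU : mv S.K 0 ∈ S.tightU Z :=
    hS.isClosed_tightU.mem_of_tendsto (((continuous_mv S.K).tendsto 0).comp hlim)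
      (Filter.Eventually.of_forall fun t => (mem_tightO_iff.1 hx t).2)
  exact fun z hz => ⟨mem_X_of_sub_mem hX (by simpa using hz),
    by simpa using add_mv_K_mem_U hU hz⟩

theorem mem_tight_of_forall_add_mem {x : Vec dx} (h0 : (0 : Vec dx) ∈ Z)
    (h : ∀ z ∈ Z, x + z ∈ S.X ∩ mv S.K ⁻¹' S.U) : x ∈ S.tightX Z ∧ mv S.K x ∈ S.tightU Z := by
  have hx : x ∈ S.X ∩ mv S.K ⁻¹' S.U := by simpa using h 0 h0
  refine ⟨⟨hx.1, fun z hz => (h z hz).1⟩, hx.2, ?_⟩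
  rintro _ ⟨z, hz, rfl⟩
  rw [← mv_add]
  exact (h z hz).2

/-- If the constraint sets do not contain a neighbourhood of the origin, every tightening has an
empty terminal set and the statement is vacuous. -/
theorem LQRDecay.exists_ball_subset_tight (hAK : S.LQRDecay ρ σ) (hS : S.Standing) :
    ∃ ε₀ > 0, ∃ r > 0, ∀ ε ≤ ε₀, ∀ Z ∈ 𝓝 (0 : Vec dx),
      Z ⊆ closedBall 0 (σ / (1 - ρ) * ε) → (S.tightO Z).Nonempty →
      ∀ x : Vec dx, ‖x‖ ≤ r → x ∈ S.tightX Z ∧ mv S.K x ∈ S.tightU Z := by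
  by_cases hn : S.X ∩ mv S.K ⁻¹' S.U ∈ 𝓝 (0 : Vec dx)
  · obtain ⟨r, hr, hball⟩ := nhds_basis_closedBall.mem_iff.1 hn
    have hκ : 0 < σ / (1 - ρ) := div_pos hAK.const_pos (sub_pos.2 hAK.rate_lt_one)
    refine ⟨r / 2 / (σ / (1 - ρ)), by positivity, r / 2, by positivity, ?_⟩
    intro ε hε Z hZ0 hZ _ x hx
    refine mem_tight_of_forall_add_mem (mem_of_mem_nhds hZ0) fun z hz => hball ?_
    have hzε : ‖z‖ ≤ σ / (1 - ρ) * ε := by simpa using hZ hz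
    rw [le_div_iff₀' hκ] at hε
    rw [mem_closedBall_zero_iff]
    linarith [norm_add_le x z]
  · refine ⟨1, one_pos, 1, one_pos, fun ε _ Z hZ _ hne => ?_⟩
    exact absurd (Filter.mem_of_superset hZ (hAK.subset_of_tightO_nonempty hS hne)) hn

theorem LQRDecay.mem_tightO_of_norm_le (hAK : S.LQRDecay ρ σ) {r : ℝ}
    (hr : ∀ x : Vec dx, ‖x‖ ≤ r → x ∈ S.tightX Z ∧ mv S.K x ∈ S.tightU Z) {x : Vec dx}
    (hx : σ * ‖x‖ ≤ r) : x ∈ S.tightO Z := by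
  rw [mem_tightO_iff]
  intro t
  refine hr _ ?_
  calc ‖mv (S.AK ^ t) x‖ ≤ σ * ρ ^ t * ‖x‖ := hAK.norm_mv_AK_pow_le t x
    _ ≤ σ * 1 * ‖x‖ := by
      have := hAK.const_pos
      gcongr
      exact pow_le_one₀ hAK.rate_pos.le hAK.rate_lt_one.le
    _ ≤ r := by rwa [mul_one]

end Stability

section Feasibility

theorem Standing.convex_admissible (hS : S.Standing) {x y : Vec dx} {u v : ℕ → Vec du}
    (hx : S.Admissible Z x u) (hy : S.Admissible Z y v) {a b : ℝ} (ha : 0 ≤ a) (hb : 0 ≤ b)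
    (hab : a + b = 1) : S.Admissible Z (a • x + b • y) (a • u + b • v) := by
  refine ⟨fun k hk => ?_, ?_⟩
  · rw [openLoop_add, openLoop_smul, openLoop_smul]
    exact ⟨hS.convex_tightX (hx.1 k hk).1 (hy.1 k hk).1 ha hb hab,
      hS.convex_tightU (hx.1 k hk).2 (hy.1 k hk).2 ha hb hab⟩
  · rw [openLoop_add, openLoop_smul, openLoop_smul]
    exact hS.convex_tightO hx.2 hy.2 ha hb hab

theorem mem_backwardReach_iff (X : Set (Vec dx)) (U : Set (Vec du)) (Xf : Set (Vec dx)) (k : ℕ)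
    (x : Vec dx) : x ∈ S.backwardReach X U Xf k ↔ ∃ u : ℕ → Vec du,
      (∀ j < k, S.openLoop x u j ∈ X ∧ u j ∈ U) ∧ S.openLoop x u k ∈ Xf := by
  induction k generalizing x with
  | zero => simp [backwardReach, openLoop]
  | succ k ih =>
    constructor
    · rintro ⟨hx, u₀, hu₀, hreach⟩
      obtain ⟨u, hu, huf⟩ := (ih _).1 hreach
      refine ⟨fun j => j.casesOn u₀ u, fun j hj => ?_, ?_⟩
      · cases j with
        | zero => exact ⟨hx, hu₀⟩
        | succ j =>
          rw [openLoop_succ_left]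
          exact hu j (Nat.lt_of_succ_lt_succ hj)
      · rw [openLoop_succ_left]
        exact huf
    · rintro ⟨u, hu, huf⟩
      refine ⟨(hu 0 k.succ_pos).1, u 0, (hu 0 k.succ_pos).2, (ih _).2
        ⟨fun j => u (j + 1), fun j hj => ?_, ?_⟩⟩
      · rw [← openLoop_succ_left]
        exact hu (j + 1) (Nat.succ_lt_succ hj)
      · rw [← openLoop_succ_left]
        exact huf

theorem mem_feasible_iff {x : Vec dx} : x ∈ S.feasible Z ↔ ∃ u, S.Admissible Z x u :=
  mem_backwardReach_iff _ _ _ _ _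

theorem Admissible.mem_tightX (hS : S.Standing) {x : Vec dx} {u : ℕ → Vec du}
    (h : S.Admissible Z x u) : x ∈ S.tightX Z := (h.1 0 hS.N_pos).1

theorem Admissible.mem_tightU (hS : S.Standing) {x : Vec dx} {u : ℕ → Vec du}
    (h : S.Admissible Z x u) : u 0 ∈ S.tightU Z := (h.1 0 hS.N_pos).2

/-- The candidate input sequence at the next state: the tail of `u`, followed by LQR. It shows that
the MPC problem stays feasible along the closed loop. -/
noncomputable def shiftInput (S : ControlSystem dx du) (x : Vec dx) (u : ℕ → Vec du) :
    ℕ → Vec du :=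
  fun k => if k + 1 < S.N then u (k + 1) else mv S.K (S.openLoop x u S.N)

theorem openLoop_shiftInput (S : ControlSystem dx du) (x : Vec dx) (u : ℕ → Vec du) {k : ℕ}
    (hk : k + 1 ≤ S.N) : S.openLoop (S.step x (u 0)) (S.shiftInput x u) k
      = S.openLoop x u (k + 1) := by
  rw [openLoop_succ_left]
  refine S.openLoop_congr _ fun j hj => ?_
  rw [shiftInput, if_pos (by omega)]

theorem openLoop_shiftInput_last (hS : S.Standing) (x : Vec dx) (u : ℕ → Vec du) :
    S.openLoop (S.step x (u 0)) (S.shiftInput x u) S.N = mv S.AK (S.openLoop x u S.N) := by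
  obtain ⟨n, hn⟩ := Nat.exists_eq_succ_of_ne_zero hS.N_pos.ne'
  have hprev := S.openLoop_shiftInput x u hn.ge
  conv_lhs => rw [hn, openLoop, hprev, ← Nat.succ_eq_add_one, ← hn]
  rw [shiftInput, if_neg (by omega), step_lqr]

theorem Admissible.shift (hS : S.Standing) {x : Vec dx} {u : ℕ → Vec du}
    (h : S.Admissible Z x u) : S.Admissible Z (S.step x (u 0)) (S.shiftInput x u) := by
  refine ⟨fun k hk => ?_, ?_⟩
  · rw [S.openLoop_shiftInput x u hk, shiftInput]
    split_ifs with hlt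
    · exact h.1 (k + 1) hlt
    · rw [show k + 1 = S.N by omega]
      exact ⟨mem_tightX_of_mem_tightO h.2, mv_K_mem_tightU h.2⟩
  · rw [openLoop_shiftInput_last hS]
    exact mv_AK_mem_tightO h.2

/-- The two values differ by the first stage cost only, since the appended LQR step leaves the
terminal cost unchanged. -/
theorem Standing.V_shift (hS : S.Standing) (x : Vec dx) (u : ℕ → Vec du) :
    S.V (S.step x (u 0)) (S.shiftInput x u) = S.V x u - S.stageCost x (u 0) := by
  obtain ⟨n, hn⟩ := Nat.exists_eq_succ_of_ne_zero hS.N_pos.ne'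
  have hinit : ∀ k ∈ Finset.range n,
      quadForm S.inputWeight (S.shiftInput x u k
          - mv S.K (S.openLoop (S.step x (u 0)) (S.shiftInput x u) k))
        = quadForm S.inputWeight (u (k + 1) - mv S.K (S.openLoop x u (k + 1))) := fun k hk => by
    have hk := Finset.mem_range.1 hk
    rw [S.openLoop_shiftInput x u (by omega), shiftInput, if_pos (by omega)]
  have hlast : quadForm S.inputWeight (S.shiftInput x u n
      - mv S.K (S.openLoop (S.step x (u 0)) (S.shiftInput x u) n)) = 0 := by
    rw [S.openLoop_shiftInput x u (by omega), shiftInput, if_neg (by omega),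
      show n + 1 = S.N from hn.symm, sub_self, quadForm_zero]
  have hfirst := hS.stageCost_add_step x (u 0)
  rw [hS.V_eq, hS.V_eq, hn, Finset.sum_range_succ, Finset.sum_congr rfl hinit, hlast,
    Finset.sum_range_succ', openLoop]
  linarith

theorem IsMPCOptimal.V_step_le (hS : S.Standing) {x : Vec dx} {u v : ℕ → Vec du}
    (h : S.IsMPCOptimal Z x u) (h' : S.IsMPCOptimal Z (S.step x (u 0)) v) :
    S.V (S.step x (u 0)) v ≤ S.V x u - S.stageCost x (u 0) := by
  rw [← hS.V_shift]
  exact h'.2 _ (h.1.shift hS)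

/-- The open-loop input sequence played by the LQR controller from `x`. -/
noncomputable def lqrInput (S : ControlSystem dx du) (x : Vec dx) : ℕ → Vec du :=
  fun k => mv S.K (mv (S.AK ^ k) x)

theorem openLoop_lqrInput (S : ControlSystem dx du) (x : Vec dx) (t : ℕ) :
    S.openLoop x (S.lqrInput x) t = mv (S.AK ^ t) x := by
  induction t with
  | zero => simp [openLoop, one_mv]
  | succ t ih => rw [openLoop, ih, lqrInput, step_lqr, ← mul_mv, ← pow_succ']

theorem admissible_lqrInput {x : Vec dx} (hx : x ∈ S.tightO Z) :
    S.Admissible Z x (S.lqrInput x) := by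
  refine ⟨fun k _ => ?_, ?_⟩
  · rw [openLoop_lqrInput]
    exact mem_tightO_iff.1 hx k
  · rw [openLoop_lqrInput]
    exact mv_AK_pow_mem_tightO hx S.N

theorem tightO_subset_feasible : S.tightO Z ⊆ S.feasible Z :=
  fun _ hx => mem_feasible_iff.2 ⟨_, admissible_lqrInput hx⟩

theorem Standing.V_lqrInput (hS : S.Standing) (x : Vec dx) :
    S.V x (S.lqrInput x) = quadForm S.P x := by
  rw [hS.V_eq, Finset.sum_eq_zero, add_zero]
  intro k _
  rw [openLoop_lqrInput, lqrInput, sub_self, quadForm_zero]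

theorem IsMPCOptimal.first_input_of_mem_tightO (hS : S.Standing) {x : Vec dx} {u : ℕ → Vec du}
    (hu : S.IsMPCOptimal Z x u) (hx : x ∈ S.tightO Z) : u 0 = mv S.K x := by
  have hopt := hu.2 _ (admissible_lqrInput hx)
  rw [hS.V_lqrInput, hS.V_eq] at hopt
  have hfirst : quadForm S.inputWeight (u 0 - mv S.K x)
      ≤ ∑ k ∈ Finset.range S.N, quadForm S.inputWeight (u k - mv S.K (S.openLoop x u k)) :=
    Finset.single_le_sum (f := fun k => quadForm S.inputWeight (u k - mv S.K (S.openLoop x u k)))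
      (fun k _ => hS.quadForm_inputWeight_nonneg _) (Finset.mem_range.2 hS.N_pos)
  by_contra hne
  linarith [quadForm_pos hS.inputWeight_posDef (sub_ne_zero.2 hne)]

end Feasibility

section Robust

variable {ε : ℝ}

/-- The states at which the robust MPC problem is posed. -/
def robustDomain (S : ControlSystem dx du) (Z : Set (Vec dx)) : Set (Vec dx) :=
  (S.feasible Z + Z) ∩ S.X

theorem IsRMPCOptimal.isMPCOptimal {x y : Vec dx} {u : ℕ → Vec du}
    (h : S.IsRMPCOptimal Z x y u) : S.IsMPCOptimal Z y u :=
  ⟨h.1.2, fun v hv => h.2 y v h.1.1 hv⟩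

theorem IsDisturbanceInvariant.step_sub_step_mem
    (hZ : S.IsDisturbanceInvariant (closedBall 0 ε) Z)
    {x y w : Vec dx} (u : Vec du) (hxy : x - y ∈ Z) (hw : ‖w‖ ≤ ε) :
    S.step x (u + mv S.K (x - y)) + w - S.step y u ∈ Z := by
  have herr : S.step x (u + mv S.K (x - y)) + w - S.step y u = mv S.AK (x - y) + w := by
    rw [add_sub_right_comm, ← step_sub, add_sub_cancel_left, step_lqr]
  rw [herr]
  exact hZ.2 (Set.add_mem_add ⟨_, hxy, rfl⟩ (by simpa using hw))

theorem Admissible.mem_robustDomain (hS : S.Standing) {x y : Vec dx} {u : ℕ → Vec du}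
    (hy : S.Admissible Z y u) (hxy : x - y ∈ Z) : x ∈ S.robustDomain Z :=
  ⟨⟨y, mem_feasible_iff.2 ⟨u, hy⟩, x - y, hxy, by simp⟩, mem_X_of_sub_mem (hy.mem_tightX hS) hxy⟩

theorem feasible_subset_robustDomain (hS : S.Standing) (hZ : (0 : Vec dx) ∈ Z) :
    S.feasible Z ⊆ S.robustDomain Z := by
  intro x hx
  obtain ⟨u, hu⟩ := mem_feasible_iff.1 hx
  exact hu.mem_robustDomain hS (by simpa using hZ)

theorem IsRMPCOptimal.step_mem_robustDomain (hS : S.Standing)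
    (hZ : S.IsDisturbanceInvariant (closedBall 0 ε) Z) {x y w : Vec dx} {u : ℕ → Vec du}
    (h : S.IsRMPCOptimal Z x y u) (hw : ‖w‖ ≤ ε) :
    S.step x (u 0 + mv S.K (x - y)) + w ∈ S.robustDomain Z :=
  (h.1.2.shift hS).mem_robustDomain hS (hZ.step_sub_step_mem _ h.1.1 hw)

theorem IsRMPCOptimal.V_step_le (hS : S.Standing)
    (hZ : S.IsDisturbanceInvariant (closedBall 0 ε) Z) {x y w y' : Vec dx} {u u' : ℕ → Vec du}
    (h : S.IsRMPCOptimal Z x y u) (hw : ‖w‖ ≤ ε)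
    (h' : S.IsRMPCOptimal Z (S.step x (u 0 + mv S.K (x - y)) + w) y' u') :
    S.V y' u' ≤ S.V y u := by
  have hshift := h'.2 _ _ (hZ.step_sub_step_mem _ h.1.1 hw) (h.1.2.shift hS)
  rw [hS.V_shift] at hshift
  linarith [hS.stageCost_nonneg y (u 0)]

end Robust

end ControlSystem

namespace ControlSystem

variable {dx du : ℕ} {S : ControlSystem dx du} {Z : Set (Vec dx)} {ρ σ : ℝ}

section QuadraticProgram

/-- Extension of a finite input sequence by zero, which turns the decision variables of the MPC
problem into an input sequence. -/
noncomputable def extendInput {n : ℕ} (u : Fin n → Vec du) : ℕ → Vec du :=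
  fun k => if h : k < n then u ⟨k, h⟩ else 0

theorem extendInput_val {n : ℕ} (u : Fin n → Vec du) (i : Fin n) : extendInput u i = u i := by
  simp [extendInput]

theorem extendInput_restrict {n : ℕ} (u : ℕ → Vec du) {k : ℕ} (hk : k < n) :
    extendInput (fun i : Fin n => u i) k = u k := by
  simp [extendInput, hk]

theorem extendInput_add {n : ℕ} (u v : Fin n → Vec du) :
    extendInput (u + v) = extendInput u + extendInput v := by
  ext1 k
  simp only [extendInput, Pi.add_apply]
  split_ifs <;> simp

theorem extendInput_smul {n : ℕ} (c : ℝ) (u : Fin n → Vec du) :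
    extendInput (c • u) = c • extendInput u := by
  ext1 k
  simp only [extendInput, Pi.smul_apply]
  split_ifs <;> simp

/-- The input at time `k`, as a linear map of the initial state and the inputs of the MPC
problem. -/
noncomputable def inputMap (S : ControlSystem dx du) (k : ℕ) :
    Vec dx × (Fin S.N → Vec du) →ₗ[ℝ] Vec du where
  toFun z := extendInput z.2 k
  map_add' z z' := by rw [Prod.snd_add, extendInput_add, Pi.add_apply]
  map_smul' c z := by rw [Prod.smul_snd, extendInput_smul, Pi.smul_apply, RingHom.id_apply]

/-- The state at time `k`, as a linear map of the initial state and the inputs of the MPC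
problem. -/
noncomputable def stateMap (S : ControlSystem dx du) (k : ℕ) :
    Vec dx × (Fin S.N → Vec du) →ₗ[ℝ] Vec dx where
  toFun z := S.openLoop z.1 (extendInput z.2) k
  map_add' z z' := by rw [Prod.fst_add, Prod.snd_add, extendInput_add, openLoop_add]
  map_smul' c z := by
    rw [Prod.smul_fst, Prod.smul_snd, extendInput_smul, openLoop_smul, RingHom.id_apply]

/-- The bilinear form `⟨f z, M f z'⟩`, the pullback along `f` of the form of `M`. -/
noncomputable def pullbackForm {W : Type*} [AddCommGroup W] [Module ℝ W] {n : ℕ}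
    (M : Matrix (Fin n) (Fin n) ℝ) (f : W →ₗ[ℝ] Vec n) : LinearMap.BilinForm ℝ W :=
  (innerₗ (Vec n)).compl₁₂ f ((Matrix.toEuclideanLin M).comp f)

theorem pullbackForm_symm {W : Type*} [AddCommGroup W] [Module ℝ W] {n : ℕ}
    {M : Matrix (Fin n) (Fin n) ℝ} (hM : M.IsHermitian) (f : W →ₗ[ℝ] Vec n) (z z' : W) :
    pullbackForm M f z z' = pullbackForm M f z' z :=
  inner_mv_comm hM (f z) (f z')

/-- The bilinear form of the objective of the MPC problem. -/
noncomputable def valueForm (S : ControlSystem dx du) :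
    LinearMap.BilinForm ℝ (Vec dx × (Fin S.N → Vec du)) :=
  (∑ k ∈ Finset.range S.N, (pullbackForm S.Q (S.stateMap k) + pullbackForm S.R (S.inputMap k)))
    + pullbackForm S.P (S.stateMap S.N)

theorem valueForm_apply (S : ControlSystem dx du) (z z' : Vec dx × (Fin S.N → Vec du)) :
    S.valueForm z z' = (∑ k ∈ Finset.range S.N, (pullbackForm S.Q (S.stateMap k) z z'
      + pullbackForm S.R (S.inputMap k) z z')) + pullbackForm S.P (S.stateMap S.N) z z' := by
  simp [valueForm, LinearMap.sum_apply]

theorem valueForm_self (S : ControlSystem dx du) (z : Vec dx × (Fin S.N → Vec du)) :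
    S.valueForm z z = S.V z.1 (extendInput z.2) := by
  rw [valueForm_apply]
  rfl

theorem Standing.valueForm_isSymm (hS : S.Standing) : S.valueForm.IsSymm := by
  refine ⟨fun z z' => ?_⟩
  rw [valueForm_apply, valueForm_apply]
  simp only [pullbackForm_symm hS.Q_posSemidef.isHermitian _ z,
    pullbackForm_symm hS.R_posDef.isHermitian _ z, pullbackForm_symm hS.P_posDef.isHermitian _ z]

theorem Standing.stageCost_le_V (hS : S.Standing) (x : Vec dx) (u : ℕ → Vec du) {k : ℕ}
    (hk : k < S.N) : S.stageCost (S.openLoop x u k) (u k) ≤ S.V x u := by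
  refine (Finset.single_le_sum (f := fun k => S.stageCost (S.openLoop x u k) (u k))
    (fun k _ => hS.stageCost_nonneg _ _) (Finset.mem_range.2 hk)).trans ?_
  exact le_add_of_nonneg_right (quadForm_nonneg hS.P_posDef.posSemidef _)

theorem Standing.mul_sq_norm_le_valueForm (hS : S.Standing) {μ : ℝ}
    (hR : ∀ u : Vec du, μ * ‖u‖ ^ 2 ≤ quadForm S.R u) (z : Vec dx × (Fin S.N → Vec du)) :
    μ * ‖z.2‖ ^ 2 ≤ S.valueForm z z := by
  rw [valueForm_self]
  have hinput : ∀ i : Fin S.N, μ * ‖z.2 i‖ ^ 2 ≤ S.V z.1 (extendInput z.2) := fun i => by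
    rw [← extendInput_val z.2 i]
    exact ((hR _).trans (le_add_of_nonneg_left (quadForm_nonneg hS.Q_posSemidef _))).trans
      (hS.stageCost_le_V z.1 _ i.2)
  obtain ⟨i, hi⟩ : ∃ i, ‖z.2‖ = ‖z.2 i‖ := by
    have : Nonempty (Fin S.N) := ⟨⟨0, hS.N_pos⟩⟩
    obtain ⟨i, hi⟩ := Finite.exists_max fun i => ‖z.2 i‖
    exact ⟨i, le_antisymm ((pi_norm_le_iff_of_nonneg (norm_nonneg _)).2 hi) (norm_le_pi_norm _ _)⟩
  rw [hi]
  exact hinput i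

/-- The feasible set of the MPC problem as a set of pairs of a state of norm at most `β` and a
finite input sequence. -/
def boundedAdmissible (S : ControlSystem dx du) (Z : Set (Vec dx)) (β : ℝ) :
    Set (Vec dx × (Fin S.N → Vec du)) :=
  {z | ‖z.1‖ ≤ β ∧ S.Admissible Z z.1 (extendInput z.2)}

theorem IsMPCOptimal.isFiberMin {β : ℝ} {x : Vec dx} {u : ℕ → Vec du} (h : S.IsMPCOptimal Z x u)
    (hx : ‖x‖ ≤ β) :
    IsFiberMin (fun z => S.valueForm z z) (S.boundedAdmissible Z β) x (fun i : Fin S.N => u i) := by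
  have heq : ∀ k < S.N, u k = extendInput (fun i : Fin S.N => u i) k := fun k hk =>
    (extendInput_restrict u hk).symm
  refine ⟨⟨hx, h.1.congr heq⟩, fun v hv => ?_⟩
  simp only [valueForm_self]
  rw [← S.V_congr x heq]
  exact h.2 _ hv.2

theorem Standing.isClosed_boundedAdmissible (hS : S.Standing) (β : ℝ) :
    IsClosed (S.boundedAdmissible Z β) := by
  have hx : ∀ k, Continuous (S.stateMap k) := fun k => LinearMap.continuous_of_finiteDimensional _
  have hu : ∀ k, Continuous (S.inputMap k) := fun k => LinearMap.continuous_of_finiteDimensional _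
  have heq : S.boundedAdmissible Z β
      = {z | ‖z.1‖ ≤ β} ∩ ((⋂ k, ⋂ (_ : k < S.N), (S.stateMap k ⁻¹' S.tightX Z) ∩
        (S.inputMap k ⁻¹' S.tightU Z)) ∩ S.stateMap S.N ⁻¹' S.tightO Z) := by
    ext z
    simp only [Set.mem_inter_iff, Set.mem_iInter, Set.mem_preimage]
    rfl
  rw [heq]
  refine (isClosed_le (by fun_prop) continuous_const).inter (IsClosed.inter ?_ ?_)
  · exact isClosed_iInter fun k => isClosed_iInter fun _ =>
      (hS.isClosed_tightX.preimage (hx k)).inter (hS.isClosed_tightU.preimage (hu k))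
  · exact hS.isClosed_tightO.preimage (hx _)

theorem Standing.convex_boundedAdmissible (hS : S.Standing) (β : ℝ) :
    Convex ℝ (S.boundedAdmissible Z β) := by
  rintro z ⟨hz, hz'⟩ y ⟨hy, hy'⟩ a b ha hb hab
  refine ⟨?_, ?_⟩
  · exact mem_closedBall_zero_iff.1 (convex_closedBall 0 β (mem_closedBall_zero_iff.2 hz)
      (mem_closedBall_zero_iff.2 hy) ha hb hab)
  · have hconv := hS.convex_admissible hz' hy' ha hb hab
    rwa [← extendInput_smul, ← extendInput_smul, ← extendInput_add] at hconv

end QuadraticProgram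

section Constraints

/-- The states on which the constraints act: those before the horizon, followed by the first `n`
states of the LQR continuation. -/
noncomputable def constrainedState (S : ControlSystem dx du) (n : ℕ) :
    Fin S.N ⊕ Fin n → Vec dx × (Fin S.N → Vec du) →ₗ[ℝ] Vec dx
  | .inl k => S.stateMap k
  | .inr t => (Matrix.toEuclideanLin (S.AK ^ (t : ℕ))).comp (S.stateMap S.N)

/-- The inputs at the times of `constrainedState`. -/
noncomputable def constrainedInput (S : ControlSystem dx du) (n : ℕ) :
    Fin S.N ⊕ Fin n → Vec dx × (Fin S.N → Vec du) →ₗ[ℝ] Vec du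
  | .inl k => S.inputMap k
  | .inr t => (Matrix.toEuclideanLin S.K).comp
      ((Matrix.toEuclideanLin (S.AK ^ (t : ℕ))).comp (S.stateMap S.N))

theorem admissible_iff_constrained (n : ℕ) (z : Vec dx × (Fin S.N → Vec du)) :
    S.Admissible Z z.1 (extendInput z.2) ↔
      (∀ j, S.constrainedState n j z ∈ S.tightX Z ∧ S.constrainedInput n j z ∈ S.tightU Z) ∧
      ∀ t ≥ n, mv (S.AK ^ t) (S.stateMap S.N z) ∈ S.tightX Z ∧
        mv S.K (mv (S.AK ^ t) (S.stateMap S.N z)) ∈ S.tightU Z := by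
  rw [Sum.forall, Admissible, mem_tightO_iff]
  constructor
  · rintro ⟨hinit, hterm⟩
    exact ⟨⟨fun k => hinit k k.2, fun t => hterm t⟩, fun t _ => hterm t⟩
  · rintro ⟨⟨hinit, hmid⟩, htail⟩
    refine ⟨fun k hk => hinit ⟨k, hk⟩, fun t => ?_⟩
    rcases lt_or_ge t n with ht | ht
    · exact hmid ⟨t, ht⟩
    · exact htail t ht

/-- The linear functionals that bound the constrained states by the rows `a` and the constrained
inputs by the rows `a'`. -/
noncomputable def constraintRow (S : ControlSystem dx du) (n : ℕ) {ι ι' : Type*} (a : ι → Vec dx)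
    (a' : ι' → Vec du) :
    (Fin S.N ⊕ Fin n) × (ι ⊕ ι') → Vec dx × (Fin S.N → Vec du) →ₗ[ℝ] ℝ :=
  fun p => p.2.elim (fun i => (innerₗ (Vec dx) (a i)).comp (S.constrainedState n p.1))
    (fun i => (innerₗ (Vec du) (a' i)).comp (S.constrainedInput n p.1))

theorem eventually_constrained_add_smul {ι ι' : Type*} [Finite ι] [Finite ι'] {a : ι → Vec dx}
    {a' : ι' → Vec du} {h : ι → ℝ} {h' : ι' → ℝ}
    (hX : S.tightX Z = {x | ∀ i, inner ℝ (a i) x ≤ h i})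
    (hU : S.tightU Z = {u | ∀ i, inner ℝ (a' i) u ≤ h' i}) {n : ℕ}
    {z w : Vec dx × (Fin S.N → Vec du)}
    (hz : ∀ j, S.constrainedState n j z ∈ S.tightX Z ∧ S.constrainedInput n j z ∈ S.tightU Z)
    (hw : ∀ p, S.constraintRow n a a' p z = p.2.elim h h' → S.constraintRow n a a' p w = 0) :
    ∀ᶠ c : ℝ in 𝓝 0, ∀ j, S.constrainedState n j (z + c • w) ∈ S.tightX Z ∧
      S.constrainedInput n j (z + c • w) ∈ S.tightU Z := by
  rw [Filter.eventually_all]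
  intro j
  rw [hX, hU] at hz ⊢
  simp only [map_add, map_smul]
  exact (eventually_halfSpaces_add_smul (hz j).1 fun i hi => hw (j, .inl i) hi).and
    (eventually_halfSpaces_add_smul (hz j).2 fun i hi => hw (j, .inr i) hi)

/-- The terminal constraint consists of infinitely many half-spaces, but those at times `t ≥ n` are
inactive at all bounded states. -/
theorem isFiberwisePolyhedral_boundedAdmissible {ι ι' : Type*} [Finite ι] [Finite ι']
    {a : ι → Vec dx} {a' : ι' → Vec du} {h : ι → ℝ} {h' : ι' → ℝ} {β β' : ℝ} {n : ℕ}
    (hX : S.tightX Z = {x | ∀ i, inner ℝ (a i) x ≤ h i})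
    (hU : S.tightU Z = {u | ∀ i, inner ℝ (a' i) u ≤ h' i})
    (hbound : ∀ z ∈ S.boundedAdmissible Z β, ‖S.stateMap S.N z‖ < β')
    (htail : ∀ t ≥ n, ∀ x, ‖x‖ < β' →
      mv (S.AK ^ t) x ∈ S.tightX Z ∧ mv S.K (mv (S.AK ^ t) x) ∈ S.tightU Z) :
    IsFiberwisePolyhedral (S.constraintRow n a a') (fun p => p.2.elim h h')
      (S.boundedAdmissible Z β) := by
  intro z hz w hw
  have hcont : Continuous fun c : ℝ => ‖S.stateMap S.N (z + c • ((0 : Vec dx), w))‖ :=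
    ((LinearMap.continuous_of_finiteDimensional _).comp (by fun_prop)).norm
  have hnear : ∀ᶠ c : ℝ in 𝓝 0, ‖S.stateMap S.N (z + c • ((0 : Vec dx), w))‖ < β' :=
    hcont.continuousAt.eventually_lt continuousAt_const (by simpa using hbound z hz)
  filter_upwards [hnear, eventually_constrained_add_smul hX hU
    ((admissible_iff_constrained n z).1 hz.2).1 hw] with c hc hconstr
  exact ⟨by simpa using hz.1,
    (admissible_iff_constrained n _).2 ⟨hconstr, fun t ht => htail t ht _ hc⟩⟩

end Constraints

section Lipschitz

theorem LQRDecay.exists_forall_norm_mv_AK_pow_le (hAK : S.LQRDecay ρ σ) {r : ℝ} (hr : 0 < r)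
    (β : ℝ) : ∃ n : ℕ, ∀ t ≥ n, ∀ x : Vec dx, ‖x‖ ≤ β → ‖mv (S.AK ^ t) x‖ ≤ r := by
  have hlim : Filter.Tendsto (fun t => σ * ρ ^ t * β) Filter.atTop (𝓝 0) := by
    simpa using ((tendsto_pow_atTop_nhds_zero_of_lt_one hAK.rate_pos.le
      hAK.rate_lt_one).const_mul σ).mul_const β
  obtain ⟨n, hn⟩ := Filter.eventually_atTop.1 (hlim.eventually_le_const hr)
  refine ⟨n, fun t ht x hx => (hAK.norm_mv_AK_pow_le t x).trans (le_trans ?_ (hn t ht))⟩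
  have := hAK.const_pos
  have := hAK.rate_pos
  gcongr

theorem isBounded_image_mv {m n : ℕ} (M : Matrix (Fin m) (Fin n) ℝ) {Y : Set (Vec n)}
    (hY : Bornology.IsBounded Y) : Bornology.IsBounded (mv M '' Y) :=
  (hY.isCompact_closure.image (continuous_mv M)).isBounded.subset (Set.image_mono subset_closure)

theorem LQRDecay.exists_lipschitz_first_input (hAK : S.LQRDecay ρ σ) (hS : S.Standing) {r : ℝ}
    (hr : 0 < r) (β : ℝ) :
    ∃ L : ℝ, 0 ≤ L ∧ ∀ Z : Set (Vec dx), Bornology.IsBounded Z →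
      (∀ x : Vec dx, ‖x‖ ≤ r → x ∈ S.tightX Z ∧ mv S.K x ∈ S.tightU Z) →
      (∀ x ∈ S.feasible Z, ∃ u, S.IsMPCOptimal Z x u) →
      ∀ x y u v, ‖x‖ ≤ β → ‖y‖ ≤ β → S.IsMPCOptimal Z x u → S.IsMPCOptimal Z y v →
        ‖u 0 - v 0‖ ≤ L * ‖x - y‖ := by
  obtain ⟨mX, a, b, hX⟩ := hS.X_polyhedron
  obtain ⟨mU, a', b', hU⟩ := hS.U_polyhedron
  obtain ⟨μ, hμ, hR⟩ := exists_mul_sq_norm_le_quadForm hS.R_posDef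
  obtain ⟨β', -, hbound⟩ := hS.exists_openLoop_bound β S.N
  obtain ⟨n, hn⟩ := hAK.exists_forall_norm_mv_AK_pow_le hr (β' + 1)
  obtain ⟨L, hL⟩ := exists_lipschitz_fiberMin (q := S.valueForm) (S.constraintRow n a a') hμ
    hS.valueForm_isSymm (hS.mul_sq_norm_le_valueForm hR)
  refine ⟨L, L.coe_nonneg, fun Z hZ hball hopt x y u v hx hy hu hv => ?_⟩
  obtain ⟨h, hh⟩ := exists_pontryaginDiff_eq_halfSpaces a b hZ
  obtain ⟨h', hh'⟩ := exists_pontryaginDiff_eq_halfSpaces a' b' (isBounded_image_mv S.K hZ)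
  rw [← hX] at hh
  rw [← hU] at hh'
  have hpoly := isFiberwisePolyhedral_boundedAdmissible (β := β) hh hh'
    (fun z hz => (hbound z.1 (extendInput z.2) hz.1 (fun k hk => (hz.2.1 k hk).2.1) S.N
      le_rfl).trans_lt (lt_add_one β'))
    (fun t ht x hx => hball _ (hn t ht x hx.le))
  have hlip := hL _ _ (hS.convex_boundedAdmissible β) (hS.isClosed_boundedAdmissible β) hpoly
    (fun z hz => (hopt z.1 (mem_feasible_iff.2 ⟨_, hz.2⟩)).imp' _ fun _ hw => hw.isFiberMin hz.1)
    x y _ _ (hu.isFiberMin hx) (hv.isFiberMin hy)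
  rw [dist_eq_norm, dist_eq_norm] at hlip
  exact (norm_le_pi_norm ((fun i : Fin S.N => u i) - fun i : Fin S.N => v i)
    ⟨0, hS.N_pos⟩).trans hlip

end Lipschitz

end ControlSystem

section RealSequences

variable {ρ : ℝ}

theorem exists_time_le_of_contracted {η F H : ℝ} (hρ : ρ < 1) (hη : 0 < η) :
    ∃ T₀ : ℕ, ∀ f g : ℕ → ℝ, (∀ t, 0 ≤ f t) → (∀ t, f (t + 1) ≤ ρ * f t + g t) → f 0 ≤ F →
      (∀ n, ∑ t ∈ Finset.range n, g t ≤ H) → ∃ t ≤ T₀, f t ≤ η := by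
  have hpos : 0 < (1 - ρ) * η := mul_pos (sub_pos.2 hρ) hη
  obtain ⟨n, hn⟩ := exists_nat_gt ((F + H) / ((1 - ρ) * η))
  rw [div_lt_iff₀ hpos] at hn
  refine ⟨n, fun f g hf hfg hf0 hg => ?_⟩
  by_contra! hlarge
  have hdissipation : ∀ m,
      f m + (1 - ρ) * ∑ t ∈ Finset.range m, f t ≤ f 0 + ∑ t ∈ Finset.range m, g t := by
    intro m
    induction m with
    | zero => simp
    | succ m ih =>
      rw [Finset.sum_range_succ, Finset.sum_range_succ]
      linarith [hfg m]
  have hsum : (n : ℝ) * η ≤ ∑ t ∈ Finset.range n, f t := by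
    simpa using Finset.card_nsmul_le_sum (Finset.range n) f η fun t ht =>
      (hlarge t (Finset.mem_range.1 ht).le).le
  linarith [hdissipation n, hg n, hf n, mul_le_mul_of_nonneg_left hsum (sub_nonneg.2 hρ.le)]

theorem sq_mul_add_le (hρ0 : 0 ≤ ρ) (hρ1 : ρ < 1) (x y : ℝ) :
    (ρ * x + y) ^ 2 ≤ ρ * x ^ 2 + y ^ 2 / (1 - ρ) := by
  have : 0 < 1 - ρ := sub_pos.2 hρ1
  have hgap : ρ * x ^ 2 + y ^ 2 / (1 - ρ) - (ρ * x + y) ^ 2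
      = ρ * ((1 - ρ) * x - y) ^ 2 / (1 - ρ) := by
    field_simp
    ring
  exact sub_nonneg.1 (hgap ▸ by positivity)

theorem sum_range_le_of_eventually_geometric {f : ℕ → ℝ} {c d : ℝ} {m : ℕ} (hρ0 : 0 ≤ ρ)
    (hρ1 : ρ < 1) (hc : 0 ≤ c) (hd : 0 ≤ d) (hf : ∀ t, f t ≤ c)
    (hgeom : ∀ k, f (m + k) ≤ d * ρ ^ k) (T : ℕ) :
    ∑ t ∈ Finset.range T, f t ≤ m * c + d / (1 - ρ) := by
  have hhead : ∀ n, ∑ t ∈ Finset.range n, f t ≤ n * c := fun n => by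
    simpa using Finset.sum_le_card_nsmul (Finset.range n) f c fun t _ => hf t
  have : 0 < 1 - ρ := sub_pos.2 hρ1
  rcases le_total T m with hT | hT
  · have : (T : ℝ) ≤ m := by exact_mod_cast hT
    calc ∑ t ∈ Finset.range T, f t ≤ T * c := hhead T
      _ ≤ m * c := by gcongr
      _ ≤ m * c + d / (1 - ρ) := le_add_of_nonneg_right (by positivity)
  · obtain ⟨k, rfl⟩ := Nat.exists_eq_add_of_le hT
    rw [Finset.sum_range_add]
    refine add_le_add (hhead m) ?_
    calc ∑ t ∈ Finset.range k, f (m + t) ≤ ∑ t ∈ Finset.range k, d * ρ ^ t :=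
          Finset.sum_le_sum fun t _ => hgeom t
      _ = d * ∑ t ∈ Finset.range k, ρ ^ t := by rw [Finset.mul_sum]
      _ ≤ d * (1 - ρ)⁻¹ := by
          rw [← tsum_geometric_of_lt_one hρ0 hρ1]
          exact mul_le_mul_of_nonneg_left ((summable_geometric_of_lt_one hρ0 hρ1).sum_le_tsum _
            fun _ _ => by positivity) hd
      _ = d / (1 - ρ) := (div_eq_mul_inv _ _).symm

end RealSequences

namespace ControlSystem

variable {dx du : ℕ} {S : ControlSystem dx du} {Z : Set (Vec dx)} {ρ σ : ℝ}

section ContractingNorm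

/-- `ν` is a norm-like function, equivalent to the Euclidean norm up to the factor `σ`, which the
LQR loop contracts by the factor `ρ` in every single step. -/
structure IsContractingNorm (S : ControlSystem dx du) (ρ σ : ℝ) (ν : Vec dx → ℝ) : Prop where
  norm_le : ∀ x, ‖x‖ ≤ ν x
  le_mul_norm : ∀ x, ν x ≤ σ * ‖x‖
  add_le : ∀ x y, ν (x + y) ≤ ν x + ν y
  mv_AK_le : ∀ x, ν (mv S.AK x) ≤ ρ * ν x

theorem LQRDecay.exists_isContractingNorm (hAK : S.LQRDecay ρ σ) :
    ∃ ν, S.IsContractingNorm ρ σ ν := by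
  obtain ⟨ν, h₁, h₂, h₃, h₄⟩ := exists_contracting_norm hAK.rate_pos hAK.opNorm_le
  exact ⟨ν, h₁, h₂, h₃, h₄⟩

variable {ν : Vec dx → ℝ}

theorem IsContractingNorm.nonneg (hν : S.IsContractingNorm ρ σ ν) (x : Vec dx) : 0 ≤ ν x :=
  (norm_nonneg x).trans (hν.norm_le x)

theorem IsContractingNorm.step_le (hν : S.IsContractingNorm ρ σ ν) (x : Vec dx) (v : Vec du) :
    ν (mv S.AK x + mv S.B v) ≤ ρ * ν x + σ * ‖mv S.B v‖ :=
  (hν.add_le _ _).trans (add_le_add (hν.mv_AK_le x) (hν.le_mul_norm _))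

/-- `u` drives the states `x`, i.e. `x (t + 1) = A x t + B u t`. -/
def IsTrajectory (S : ControlSystem dx du) (x : ℕ → Vec dx) (u : ℕ → Vec du) : Prop :=
  ∀ t, x (t + 1) = S.step (x t) (u t)

theorem isTrajectory_rollout (S : ControlSystem dx du) (p : ℕ → Vec dx → Vec du) (x : Vec dx) :
    S.IsTrajectory (S.rollout p x) fun t => p t (S.rollout p x t) :=
  fun _ => rfl

theorem Standing.exists_reach_small (hS : S.Standing) (hAK : S.LQRDecay ρ σ)
    (hν : S.IsContractingNorm ρ σ ν) (b M : ℝ) {η : ℝ} (hη : 0 < η) :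
    ∃ T₀ : ℕ, ∀ (y : ℕ → Vec dx) (w : ℕ → Vec du), S.IsTrajectory y w → ‖y 0‖ ≤ b →
      (∀ n, ∑ t ∈ Finset.range n, quadForm S.inputWeight (w t - mv S.K (y t)) ≤ M) →
      ∃ t ≤ T₀, ν (y t) ≤ η := by
  obtain ⟨μ, hμ, hweight⟩ := exists_mul_sq_norm_le_quadForm hS.inputWeight_posDef
  have hρ := hAK.rate_pos
  have hσ := hAK.const_pos
  have h1ρ : 0 < 1 - ρ := sub_pos.2 hAK.rate_lt_one
  set a := (σ * opNorm S.B) ^ 2 / (1 - ρ) / μ with ha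
  have ha0 : 0 ≤ a := by positivity
  have hsucc : ∀ (x : Vec dx) (v : Vec du),
      ν (S.step x v) ^ 2 ≤ ρ * ν x ^ 2 + a * quadForm S.inputWeight (v - mv S.K x) := by
    intro x v
    have hstep : ν (S.step x v) ≤ ρ * ν x + σ * opNorm S.B * ‖v - mv S.K x‖ := by
      rw [← add_sub_cancel (mv S.K x) v, step_eq, add_sub_cancel, mul_assoc]
      exact (hν.step_le _ _).trans
        (add_le_add_right (mul_le_mul_of_nonneg_left (norm_mv_le _ _) hσ.le) _)
    calc ν (S.step x v) ^ 2 ≤ (ρ * ν x + σ * opNorm S.B * ‖v - mv S.K x‖) ^ 2 :=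
          pow_le_pow_left₀ (hν.nonneg _) hstep 2
      _ ≤ ρ * ν x ^ 2 + (σ * opNorm S.B * ‖v - mv S.K x‖) ^ 2 / (1 - ρ) :=
          sq_mul_add_le hρ.le hAK.rate_lt_one _ _
      _ = ρ * ν x ^ 2 + a * (μ * ‖v - mv S.K x‖ ^ 2) := by rw [ha]; field_simp
      _ ≤ _ := by gcongr; exact hweight _
  obtain ⟨T₀, hT₀⟩ := exists_time_le_of_contracted (F := (σ * b) ^ 2) (H := a * M)
    hAK.rate_lt_one (sq_pos_of_pos hη)
  refine ⟨T₀, fun y w hy hb hsum => ?_⟩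
  obtain ⟨t, ht, hle⟩ := hT₀ (fun t => ν (y t) ^ 2)
    (fun t => a * quadForm S.inputWeight (w t - mv S.K (y t))) (fun t => sq_nonneg _)
    (fun t => hy t ▸ hsucc _ _)
    (pow_le_pow_left₀ (hν.nonneg _) ((hν.le_mul_norm _).trans (by gcongr)) 2)
    (fun n => by rw [← Finset.mul_sum]; exact mul_le_mul_of_nonneg_left (hsum n) ha0)
  exact ⟨t, ht, (sq_le_sq₀ (hν.nonneg _) hη.le).1 hle⟩

end ContractingNorm

section Tracking

variable {x y : ℕ → Vec dx} {u w : ℕ → Vec du}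

theorem IsTrajectory.norm_sub_le (hx : S.IsTrajectory x u) (hy : S.IsTrajectory y w)
    (hxy : x 0 = y 0) {L e : ℝ} (hL : 0 ≤ L)
    (hlip : ∀ t, ‖u t - w t‖ ≤ L * ‖x t - y t‖ + e) (t : ℕ) :
    ‖x t - y t‖ ≤ opNorm S.B * e * (t * (1 + opNorm S.A + opNorm S.B * L) ^ t) := by
  have hA := opNorm_nonneg S.A
  have hB := opNorm_nonneg S.B
  have he : 0 ≤ e := by simpa [hxy] using (norm_nonneg _).trans (hlip 0)
  obtain ⟨a, ha⟩ : ∃ a, a = 1 + opNorm S.A + opNorm S.B * L := ⟨_, rfl⟩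
  have ha1 : 1 ≤ a := by linarith [mul_nonneg hB hL]
  rw [← ha]
  induction t with
  | zero => simp [hxy]
  | succ t ih =>
    have hpow : 1 ≤ a ^ (t + 1) := one_le_pow₀ ha1
    calc ‖x (t + 1) - y (t + 1)‖ = ‖S.step (x t - y t) (u t - w t)‖ := by rw [hx, hy, step_sub]
      _ ≤ opNorm S.A * ‖x t - y t‖ + opNorm S.B * ‖u t - w t‖ := S.norm_step_le _ _
      _ ≤ opNorm S.A * ‖x t - y t‖ + opNorm S.B * (L * ‖x t - y t‖ + e) := by
          gcongr; exact hlip t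
      _ ≤ a * ‖x t - y t‖ + opNorm S.B * e * 1 := by
          rw [ha]; linarith [norm_nonneg (x t - y t)]
      _ ≤ a * (opNorm S.B * e * (t * a ^ t)) + opNorm S.B * e * a ^ (t + 1) := by gcongr
      _ = opNorm S.B * e * ((t + 1 : ℕ) * a ^ (t + 1)) := by push_cast; ring

/-- The trajectory `(x, u)` imitates the reference trajectory `(y, w)` with accuracy `ε`: its inputs
are `L`-Lipschitz close to those of the reference up to `c ε`, both are driven by (nearly) LQR near
the origin, and from time `s` on `(x, u)` is an LQR trajectory. -/
structure IsTracking (S : ControlSystem dx du) (L c ε η : ℝ) (s : ℕ) (x y : ℕ → Vec dx)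
    (u w : ℕ → Vec du) : Prop where
  traj : S.IsTrajectory x u
  traj_ref : S.IsTrajectory y w
  init : x 0 = y 0
  lipschitz : ∀ t, ‖u t - w t‖ ≤ L * ‖x t - y t‖ + c * ε
  ref_eq_lqr : ∀ t, ‖y t‖ ≤ 2 * η → w t = mv S.K (y t)
  near_lqr : ∀ t, ‖x t‖ ≤ 2 * η → ‖mv S.B (u t - mv S.K (x t))‖ ≤ ε
  eq_lqr : ∀ t ≥ s, u t = mv S.K (x t)

variable {L c ε η : ℝ} {s t₀ : ℕ} {ν : Vec dx → ℝ}

theorem IsTracking.ref_le (h : S.IsTracking L c ε η s x y u w) (hρ : ρ < 1)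
    (hν : S.IsContractingNorm ρ σ ν) (hy : ν (y t₀) ≤ η) : ∀ t ≥ t₀, ν (y t) ≤ η := by
  intro t ht
  induction t, ht using Nat.le_induction with
  | base => exact hy
  | succ t ht ih =>
    rw [h.traj_ref, h.ref_eq_lqr t (by linarith [hν.norm_le (y t), hν.nonneg (y t)]), step_lqr]
    exact (hν.mv_AK_le _).trans ((mul_le_of_le_one_left (hν.nonneg _) hρ.le).trans ih)

theorem IsTracking.ref_input_eq (h : S.IsTracking L c ε η s x y u w) (hρ : ρ < 1)
    (hν : S.IsContractingNorm ρ σ ν) (hy : ν (y t₀) ≤ η) :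
    ∀ t ≥ t₀, w t = mv S.K (y t) := fun t ht =>
  h.ref_eq_lqr t (by linarith [hν.norm_le (y t), hν.nonneg (y t), h.ref_le hρ hν hy t ht])

theorem IsTracking.sub_succ (h : S.IsTracking L c ε η s x y u w) {t : ℕ}
    (hw : w t = mv S.K (y t)) :
    x (t + 1) - y (t + 1) = mv S.AK (x t - y t) + mv S.B (u t - mv S.K (x t)) := by
  rw [h.traj, h.traj_ref, hw, step_lqr, mv_sub S.AK, ← add_sub_right_comm, ← step_eq,
    add_sub_cancel]

theorem IsTracking.sub_le_of_reached (h : S.IsTracking L c ε η s x y u w)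
    (hAK : S.LQRDecay ρ σ) (hν : S.IsContractingNorm ρ σ ν) (hy : ν (y t₀) ≤ η) {g : ℝ}
    (hg : σ * ‖x t₀ - y t₀‖ ≤ g) (hgη : g ≤ η) (hstep : ρ * g + σ * ε ≤ g) :
    ∀ t ≥ t₀, ν (x t - y t) ≤ g := by
  intro t ht
  induction t, ht using Nat.le_induction with
  | base => exact (hν.le_mul_norm _).trans hg
  | succ t ht ih =>
    have hx : ‖x t‖ ≤ 2 * η := by
      have := hν.add_le (x t - y t) (y t)
      rw [sub_add_cancel] at this
      linarith [hν.norm_le (x t), h.ref_le hAK.rate_lt_one hν hy t ht]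
    have hρ := hAK.rate_pos
    have hσ := hAK.const_pos
    rw [h.sub_succ (h.ref_input_eq hAK.rate_lt_one hν hy t ht)]
    calc ν (mv S.AK (x t - y t) + mv S.B (u t - mv S.K (x t)))
        ≤ ρ * ν (x t - y t) + σ * ‖mv S.B (u t - mv S.K (x t))‖ := hν.step_le _ _
      _ ≤ ρ * g + σ * ε := by gcongr; exact h.near_lqr t hx
      _ ≤ g := hstep

theorem IsTracking.sub_le_geometric (h : S.IsTracking L c ε η s x y u w)
    (hAK : S.LQRDecay ρ σ) (hν : S.IsContractingNorm ρ σ ν) (hy : ν (y t₀) ≤ η) {m : ℕ}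
    (ht₀ : t₀ ≤ m) (hs : s ≤ m) (k : ℕ) :
    ν (x (m + k) - y (m + k)) ≤ ν (x m - y m) * ρ ^ k := by
  induction k with
  | zero => simp
  | succ k ih =>
    rw [← add_assoc, h.sub_succ (h.ref_input_eq hAK.rate_lt_one hν hy _ (by lia)),
      h.eq_lqr _ (by lia), sub_self, mv_zero, add_zero, pow_succ]
    linarith [hν.mv_AK_le (x (m + k) - y (m + k)), mul_le_mul_of_nonneg_left ih hAK.rate_pos.le]

theorem IsTracking.norm_sub_le_geometric (h : S.IsTracking L c ε η s x y u w)
    (hAK : S.LQRDecay ρ σ) (hν : S.IsContractingNorm ρ σ ν) (hy : ν (y t₀) ≤ η) {m : ℕ} {g : ℝ}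
    (ht₀ : t₀ ≤ m) (hs : s ≤ m) (hg : ν (x m - y m) ≤ g) (k : ℕ) :
    ‖x (m + k) - y (m + k)‖ ≤ g * ρ ^ k ∧
      ‖u (m + k) - w (m + k)‖ ≤ opNorm S.K * (g * ρ ^ k) := by
  have hρ := hAK.rate_pos
  have hdiff : ‖x (m + k) - y (m + k)‖ ≤ g * ρ ^ k :=
    ((hν.norm_le _).trans (h.sub_le_geometric hAK hν hy ht₀ hs k)).trans (by gcongr)
  refine ⟨hdiff, ?_⟩
  rw [h.eq_lqr _ (by lia), h.ref_input_eq hAK.rate_lt_one hν hy _ (by lia), ← mv_sub]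
  exact (norm_mv_le _ _).trans (mul_le_mul_of_nonneg_left hdiff (opNorm_nonneg _))

theorem exists_tracking_gain (hAK : S.LQRDecay ρ σ) (hν : S.IsContractingNorm ρ σ ν)
    (hL : 0 ≤ L) (hc : 0 ≤ c) (T₀ : ℕ) :
    ∃ G : ℝ, 0 ≤ G ∧ ∀ (x y : ℕ → Vec dx) (u w : ℕ → Vec du) (ε η : ℝ) (s t₀ : ℕ), 0 ≤ ε →
      S.IsTracking L c ε η s x y u w → t₀ ≤ T₀ → ν (y t₀) ≤ η → G * ε ≤ η →
      (∀ t, ‖x t - y t‖ ≤ G * ε) ∧ ∀ t ≥ t₀, ν (x t - y t) ≤ G * ε := by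
  have hσ := hAK.const_pos
  have h1ρ : 0 < 1 - ρ := sub_pos.2 hAK.rate_lt_one
  have hA := opNorm_nonneg S.A
  have hB := opNorm_nonneg S.B
  obtain ⟨a, ha⟩ : ∃ a, a = 1 + opNorm S.A + opNorm S.B * L := ⟨_, rfl⟩
  have ha1 : 1 ≤ a := by linarith [mul_nonneg hB hL]
  obtain ⟨H, hH⟩ : ∃ H, H = opNorm S.B * c * (T₀ * a ^ T₀) := ⟨_, rfl⟩
  have hH0 : 0 ≤ H := by rw [hH]; positivity
  have hκ0 : 0 ≤ σ / (1 - ρ) := by positivity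
  have hκ : (1 - ρ) * (σ / (1 - ρ)) = σ := mul_div_cancel₀ σ h1ρ.ne'
  obtain ⟨G, hG⟩ : ∃ G, G = (1 + σ) * H + σ / (1 - ρ) := ⟨_, rfl⟩
  have hG0 : 0 ≤ G := by rw [hG]; positivity
  have hHG : H ≤ G := by linarith [mul_nonneg hσ.le hH0]
  have hρG : ρ * G + σ ≤ G := by
    have : 0 ≤ (1 - ρ) * ((1 + σ) * H) := by positivity
    rw [hG]
    linarith
  refine ⟨G, hG0, fun x y u w ε η s t₀ hε h ht₀ hy hGη => ?_⟩
  have hearly : ∀ t ≤ t₀, ‖x t - y t‖ ≤ H * ε := by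
    intro t ht
    have hT : (t : ℝ) ≤ T₀ := by exact_mod_cast ht.trans ht₀
    calc ‖x t - y t‖ ≤ opNorm S.B * (c * ε) * (t * a ^ t) :=
          ha ▸ h.traj.norm_sub_le h.traj_ref h.init hL h.lipschitz t
      _ ≤ opNorm S.B * (c * ε) * (T₀ * a ^ T₀) := by gcongr; exact ht.trans ht₀
      _ = H * ε := by rw [hH]; ring
  have hlate := h.sub_le_of_reached hAK hν hy (g := G * ε)
    (calc σ * ‖x t₀ - y t₀‖ ≤ σ * (H * ε) := by gcongr; exact hearly t₀ le_rfl
      _ = σ * H * ε := (mul_assoc _ _ _).symm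
      _ ≤ G * ε := by gcongr; linarith) hGη
    (calc ρ * (G * ε) + σ * ε = (ρ * G + σ) * ε := by ring
      _ ≤ G * ε := by gcongr)
  refine ⟨fun t => ?_, hlate⟩
  rcases le_total t t₀ with ht | ht
  · exact (hearly t ht).trans (by gcongr)
  · exact (hν.norm_le _).trans (hlate t ht)

theorem stageCost_sub_le (S : ControlSystem dx du) {x y : Vec dx} {u v : Vec du} {β γ d e : ℝ}
    (hx : ‖x‖ ≤ β ∧ ‖y‖ ≤ β) (hu : ‖u‖ ≤ γ ∧ ‖v‖ ≤ γ) (hxy : ‖x - y‖ ≤ d) (huv : ‖u - v‖ ≤ e) :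
    S.stageCost x u - S.stageCost y v
      ≤ opNorm S.Q * (2 * β) * d + opNorm S.R * (2 * γ) * e := by
  have hQ := opNorm_nonneg S.Q
  have hR := opNorm_nonneg S.R
  calc S.stageCost x u - S.stageCost y v
      = (quadForm S.Q x - quadForm S.Q y) + (quadForm S.R u - quadForm S.R v) :=
        add_sub_add_comm _ _ _ _
    _ ≤ opNorm S.Q * (‖x‖ + ‖y‖) * ‖x - y‖ + opNorm S.R * (‖u‖ + ‖v‖) * ‖u - v‖ :=
        add_le_add (quadForm_sub_le _ _ _) (quadForm_sub_le _ _ _)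
    _ ≤ _ := by
        have hβ : 0 ≤ β := (norm_nonneg x).trans hx.1
        have hγ : 0 ≤ γ := (norm_nonneg u).trans hu.1
        gcongr <;> linarith

theorem exists_sum_stageCost_sub_le (hAK : S.LQRDecay ρ σ) (hν : S.IsContractingNorm ρ σ ν)
    {β γ : ℝ} (hL : 0 ≤ L) (hc : 0 ≤ c) (hβ : 0 ≤ β) (hγ : 0 ≤ γ) (T₀ : ℕ) :
    ∃ C G : ℝ, 0 ≤ C ∧ 0 ≤ G ∧ ∀ (x y : ℕ → Vec dx) (u w : ℕ → Vec du) (ε η : ℝ) (s t₀ : ℕ),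
      0 ≤ ε → S.IsTracking L c ε η s x y u w → (∀ t, ‖x t‖ ≤ β ∧ ‖y t‖ ≤ β) →
      (∀ t, ‖u t‖ ≤ γ ∧ ‖w t‖ ≤ γ) → t₀ ≤ T₀ → ν (y t₀) ≤ η → G * ε ≤ η →
      ∀ T : ℕ, ∑ t ∈ Finset.range T, (S.stageCost (x t) (u t) - S.stageCost (y t) (w t))
        ≤ C * (s + 1) * ε := by
  obtain ⟨G, hG0, hG⟩ := exists_tracking_gain hAK hν hL hc T₀
  have hρ := hAK.rate_pos
  have h1ρ : 0 < 1 - ρ := sub_pos.2 hAK.rate_lt_one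
  have hQ := opNorm_nonneg S.Q
  have hR := opNorm_nonneg S.R
  have hK := opNorm_nonneg S.K
  obtain ⟨c₁, hc₁⟩ : ∃ c₁, c₁ = opNorm S.Q * (2 * β) * G + opNorm S.R * (2 * γ) * (L * G + c) :=
    ⟨_, rfl⟩
  obtain ⟨c₂, hc₂⟩ : ∃ c₂, c₂ = opNorm S.Q * (2 * β) * G
    + opNorm S.R * (2 * γ) * (opNorm S.K * G) := ⟨_, rfl⟩
  have hc₁0 : 0 ≤ c₁ := by rw [hc₁]; positivity
  have hc₂0 : 0 ≤ c₂ := by rw [hc₂]; positivity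
  refine ⟨(T₀ + 1) * c₁ + c₂ / (1 - ρ), G, by positivity, hG0, ?_⟩
  intro x y u w ε η s t₀ hε h hxβ huγ ht₀ hy hGη T
  obtain ⟨hall, hlate⟩ := hG x y u w ε η s t₀ hε h ht₀ hy hGη
  have hbounded : ∀ t, S.stageCost (x t) (u t) - S.stageCost (y t) (w t) ≤ c₁ * ε := fun t => by
    have hlip : ‖u t - w t‖ ≤ L * (G * ε) + c * ε := (h.lipschitz t).trans (by gcongr; exact hall t)
    calc _ ≤ opNorm S.Q * (2 * β) * (G * ε) + opNorm S.R * (2 * γ) * (L * (G * ε) + c * ε) :=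
          S.stageCost_sub_le (hxβ t) (huγ t) (hall t) hlip
      _ = c₁ * ε := by rw [hc₁]; ring
  have hgeom : ∀ k, S.stageCost (x (T₀ + s + k)) (u (T₀ + s + k))
      - S.stageCost (y (T₀ + s + k)) (w (T₀ + s + k)) ≤ c₂ * ε * ρ ^ k := fun k => by
    obtain ⟨hdiff, hinput⟩ := h.norm_sub_le_geometric hAK hν hy (m := T₀ + s) (by lia) (by lia)
      (hlate _ (by lia)) k
    calc _ ≤ opNorm S.Q * (2 * β) * (G * ε * ρ ^ k)
            + opNorm S.R * (2 * γ) * (opNorm S.K * (G * ε * ρ ^ k)) :=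
          S.stageCost_sub_le (hxβ _) (huγ _) hdiff hinput
      _ = c₂ * ε * ρ ^ k := by rw [hc₂]; ring
  calc _ ≤ (T₀ + s : ℕ) * (c₁ * ε) + c₂ * ε / (1 - ρ) :=
        sum_range_le_of_eventually_geometric hρ.le hAK.rate_lt_one (by positivity) (by positivity)
          hbounded hgeom T
    _ = (T₀ + s) * (c₁ * ε) + c₂ / (1 - ρ) * ε := by push_cast; ring
    _ ≤ (T₀ + 1) * (s + 1) * (c₁ * ε) + c₂ / (1 - ρ) * (s + 1) * ε := by
        have hdiv : 0 ≤ c₂ / (1 - ρ) := by positivity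
        have hT₀s : (0 : ℝ) ≤ T₀ * s := by positivity
        gcongr
        · linarith
        · exact le_mul_of_one_le_right hdiv (le_add_of_nonneg_left s.cast_nonneg)
    _ = _ := by ring

end Tracking

end ControlSystem

namespace ControlSystem

variable {dx du : ℕ} {S : ControlSystem dx du} {Z : Set (Vec dx)} {ρ σ : ℝ}

section NominalLoop

variable {π : Vec dx → Vec du} {x : Vec dx} {b M β : ℝ}

theorem Standing.cost_add (hS : S.Standing) (p : ℕ → Vec dx → Vec du) (x : Vec dx) (n : ℕ) :
    S.cost p n x + quadForm S.P (S.rollout p x n) = quadForm S.P x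
      + ∑ t ∈ Finset.range n,
        quadForm S.inputWeight (p t (S.rollout p x t) - mv S.K (S.rollout p x t)) := by
  induction n with
  | zero => simp [cost, rollout]
  | succ n ih =>
    have hstep := hS.stageCost_add_step (S.rollout p x n) (p n (S.rollout p x n))
    simp only [cost, rollout, Finset.sum_range_succ] at ih ⊢
    linarith

theorem Standing.cost_nonneg (hS : S.Standing) (p : ℕ → Vec dx → Vec du) (n : ℕ) (x : Vec dx) :
    0 ≤ S.cost p n x :=
  Finset.sum_nonneg fun _ _ => hS.stageCost_nonneg _ _

theorem IsTightMPC.exists_isMPCOptimal_rollout (hS : S.Standing) (hπ : S.IsTightMPC Z π)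
    {u : ℕ → Vec du} (hu : S.Admissible Z x u) (n : ℕ) :
    ∃ v, S.IsMPCOptimal Z (S.rollout (fun _ => π) x n) v ∧
      π (S.rollout (fun _ => π) x n) = v 0 ∧
      S.cost (fun _ => π) n x + S.V (S.rollout (fun _ => π) x n) v ≤ S.V x u := by
  induction n with
  | zero =>
    obtain ⟨v, hv, hπv⟩ := hπ x (mem_feasible_iff.2 ⟨u, hu⟩)
    exact ⟨v, hv, hπv, by simpa [cost, rollout] using hv.2 u hu⟩
  | succ n ih =>
    obtain ⟨v, hv, hπv, hcost⟩ := ih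
    have hnext : S.rollout (fun _ => π) x (n + 1) = S.step (S.rollout (fun _ => π) x n) (v 0) := by
      rw [rollout, hπv]
    obtain ⟨v', hv', hπv'⟩ := hπ _ (mem_feasible_iff.2 ⟨_, hv.1.shift hS⟩)
    rw [hnext]
    refine ⟨v', hv', hπv', ?_⟩
    rw [cost, Finset.sum_range_succ, ← cost, hπv]
    linarith [hv.V_step_le hS hv']

theorem IsTightMPC.sum_inputWeight_le (hS : S.Standing) (hπ : S.IsTightMPC Z π)
    {u : ℕ → Vec du} (hu : S.Admissible Z x u) (n : ℕ) :
    ∑ t ∈ Finset.range n, quadForm S.inputWeight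
      (π (S.rollout (fun _ => π) x t) - mv S.K (S.rollout (fun _ => π) x t)) ≤ S.V x u := by
  obtain ⟨v, -, -, hV⟩ := hπ.exists_isMPCOptimal_rollout hS hu n
  linarith [hS.cost_add (fun _ => π) x n, hS.quadForm_le_V (S.rollout (fun _ => π) x n) v,
    quadForm_nonneg hS.P_posDef.posSemidef x]

/-- Uniformly in the tightening of the constraints, `M` bounds the MPC objective on the ball of
radius `b`, and `β` bounds all states whose optimal value is at most `M`. -/
structure IsNominalBound (S : ControlSystem dx du) (b M β : ℝ) : Prop where
  nonneg : 0 ≤ β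
  V_le : ∀ {Z x u}, ‖x‖ ≤ b → S.Admissible Z x u → S.V x u ≤ M
  norm_le_of_V_le : ∀ {y u}, S.V y u ≤ M → ‖y‖ ≤ β

theorem Standing.exists_isNominalBound (hS : S.Standing) (b : ℝ) :
    ∃ M β, S.IsNominalBound b M β := by
  obtain ⟨β, -, hβ⟩ := hS.exists_openLoop_bound b S.N
  have hQ := opNorm_nonneg S.Q
  have hR := opNorm_nonneg S.R
  have hP := opNorm_nonneg S.P
  obtain ⟨β', hβ'⟩ := exists_norm_le_of_quadForm_le hS.P_posDef
    (S.N • (opNorm S.Q * β ^ 2 + opNorm S.R * S.inputBound ^ 2) + opNorm S.P * β ^ 2)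
  refine ⟨_, max β' 0, le_max_right _ _, fun {Z x u} hx hu => ?_,
    fun hV => (hβ' _ ((hS.quadForm_le_V _ _).trans hV)).trans (le_max_left _ _)⟩
  have hstate := hβ x u hx fun k hk => (hu.1 k hk).2.1
  refine add_le_add ?_ ((quadForm_le _ _).trans (by gcongr; exact hstate _ le_rfl))
  refine (Finset.sum_le_card_nsmul _ _ (opNorm S.Q * β ^ 2 + opNorm S.R * S.inputBound ^ 2)
    fun k hk => (S.stageCost_le _ _).trans ?_).trans_eq (by rw [Finset.card_range])
  have hk := Finset.mem_range.1 hk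
  gcongr
  exacts [hstate k hk.le, hS.norm_le_inputBound (hu.1 k hk).2.1]

theorem LQRDecay.exists_robustMPC_eq_lqr (hAK : S.LQRDecay ρ σ) (hS : S.Standing) {r : ℝ}
    (hr : 0 < r) :
    ∃ ζ : ℝ, 0 < ζ ∧ ∀ Z : Set (Vec dx), (0 : Vec dx) ∈ Z →
      (∀ x : Vec dx, ‖x‖ ≤ r → x ∈ S.tightX Z ∧ mv S.K x ∈ S.tightU Z) →
      ∀ x : Vec dx, ‖x‖ ≤ ζ → x ∈ S.tightO Z ∧
        ∀ y u, S.IsRMPCOptimal Z x y u → u 0 + mv S.K (x - y) = mv S.K x := by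
  obtain ⟨μ, hμ, hP⟩ := exists_mul_sq_norm_le_quadForm hS.P_posDef
  have hσ := hAK.const_pos
  have hP0 := opNorm_nonneg S.P
  obtain ⟨q, hq⟩ : ∃ q, q = Real.sqrt (opNorm S.P / μ) := ⟨_, rfl⟩
  have hq0 : 0 ≤ q := hq ▸ Real.sqrt_nonneg _
  have hqsq : μ * q ^ 2 = opNorm S.P := by
    rw [hq, Real.sq_sqrt (by positivity), mul_div_cancel₀ _ hμ.ne']
  refine ⟨r / (σ * (1 + q)), by positivity, fun Z h0 htight x hx => ?_⟩
  rw [le_div_iff₀ (by positivity)] at hx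
  have hxO : x ∈ S.tightO Z := hAK.mem_tightO_of_norm_le htight <| by
    linarith [mul_nonneg (mul_nonneg hσ.le hq0) (norm_nonneg x)]
  refine ⟨hxO, fun y u h => ?_⟩
  have hyx : ‖y‖ ≤ q * ‖x‖ := by
    refine le_of_sq_le_sq (le_of_mul_le_mul_left ?_ hμ) (by positivity)
    calc μ * ‖y‖ ^ 2 ≤ S.V y u := (hP y).trans (hS.quadForm_le_V y u)
      _ ≤ S.V x (S.lqrInput x) := h.2 x _ (by simpa using h0) (admissible_lqrInput hxO)
      _ ≤ opNorm S.P * ‖x‖ ^ 2 := (hS.V_lqrInput x).trans_le (quadForm_le S.P x)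
      _ = μ * (q * ‖x‖) ^ 2 := by rw [← hqsq]; ring
  have hyO : y ∈ S.tightO Z := hAK.mem_tightO_of_norm_le htight <| by
    linarith [mul_le_mul_of_nonneg_left hyx hσ.le, mul_nonneg hσ.le (norm_nonneg x)]
  rw [h.isMPCOptimal.first_input_of_mem_tightO hS hyO, ← mv_add, add_sub_cancel]

end NominalLoop

section Switching

variable {p : ℕ → Vec dx → Vec du} {s : ℕ}

theorem rollout_congr (S : ControlSystem dx du) (x : Vec dx) {p q : ℕ → Vec dx → Vec du} {t : ℕ}
    (h : ∀ k < t, p k = q k) : S.rollout p x t = S.rollout q x t := by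
  induction t with
  | zero => rfl
  | succ t ih =>
    rw [rollout, rollout, ih fun k hk => h k (hk.trans t.lt_succ_self), h t t.lt_succ_self]

/-- The policy `p` up to time `s`, and LQR from then on. -/
noncomputable def switched (S : ControlSystem dx du) (p : ℕ → Vec dx → Vec du) (s : ℕ) :
    ℕ → Vec dx → Vec du := fun t => if t < s then p t else S.lqr

theorem switched_of_lt (S : ControlSystem dx du) (p : ℕ → Vec dx → Vec du) {t : ℕ} (h : t < s) :
    S.switched p s t = p t :=
  if_pos h

theorem switched_of_ge (S : ControlSystem dx du) (p : ℕ → Vec dx → Vec du) {t : ℕ} (h : s ≤ t) :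
    S.switched p s t = S.lqr :=
  if_neg h.not_gt

theorem rollout_switched (S : ControlSystem dx du) (p : ℕ → Vec dx → Vec du) {t : ℕ}
    (h : t ≤ s) (x : Vec dx) : S.rollout (S.switched p s) x t = S.rollout p x t :=
  S.rollout_congr x fun _ hk => S.switched_of_lt p (hk.trans_le h)

theorem rollout_switched_add (S : ControlSystem dx du) (p : ℕ → Vec dx → Vec du) (s k : ℕ)
    (x : Vec dx) : S.rollout (S.switched p s) x (s + k) = mv (S.AK ^ k) (S.rollout p x s) := by
  induction k with
  | zero => rw [add_zero, pow_zero, one_mv, rollout_switched _ _ le_rfl]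
  | succ k ih =>
    rw [← add_assoc, rollout, ih, switched_of_ge _ _ (by lia), lqr, step_lqr, ← mul_mv,
      ← pow_succ']

theorem Standing.cost_switched_le (hS : S.Standing) {x : Vec dx} {c d : ℝ} (T : ℕ)
    (hearly : ∀ t < s, S.stageCost (S.rollout p x t) (p t (S.rollout p x t)) ≤ c)
    (hfinal : quadForm S.P (S.rollout p x s) ≤ d) :
    S.cost (S.switched p s) T x ≤ s * c + d := by
  have hlate : ∀ k, S.cost (S.switched p s) (s + k) x
      + quadForm S.P (mv (S.AK ^ k) (S.rollout p x s))
      = S.cost p s x + quadForm S.P (S.rollout p x s) := fun k => by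
    have hprefix : ∑ t ∈ Finset.range s, quadForm S.inputWeight
          (S.switched p s t (S.rollout (S.switched p s) x t)
            - mv S.K (S.rollout (S.switched p s) x t))
        = ∑ t ∈ Finset.range s, quadForm S.inputWeight
          (p t (S.rollout p x t) - mv S.K (S.rollout p x t)) :=
      Finset.sum_congr rfl fun t ht => by
        rw [switched_of_lt _ _ (Finset.mem_range.1 ht),
          rollout_switched _ _ (Finset.mem_range.1 ht).le]
    rw [← rollout_switched_add, hS.cost_add, hS.cost_add, Finset.sum_range_add, hprefix]
    simp [switched_of_ge, lqr]
  have hcost : S.cost p s x ≤ s * c := by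
    simpa [cost] using Finset.sum_le_card_nsmul (Finset.range s) _ c fun t ht =>
      hearly t (Finset.mem_range.1 ht)
  calc S.cost (S.switched p s) T x ≤ S.cost (S.switched p s) (s + T) x :=
        Finset.sum_le_sum_of_subset_of_nonneg (Finset.range_subset_range.2 (by lia))
          fun _ _ _ => hS.stageCost_nonneg _ _
    _ ≤ s * c + d := by
        linarith [hlate T, quadForm_nonneg hS.P_posDef.posSemidef
          (mv (S.AK ^ T) (S.rollout p x s))]

end Switching

section ImitationRun

/-- Along its own loop from `x`, the policy `p` is `ε / ‖B‖`-close to `expert` before time `s`, so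
that it acts as a disturbance of size at most `ε` on the loop of `expert`. -/
def Imitates (S : ControlSystem dx du) (ε : ℝ) (expert : Vec dx → Vec du)
    (p : ℕ → Vec dx → Vec du) (s : ℕ) (x : Vec dx) : Prop :=
  ∀ t < s, ‖expert (S.rollout p x t) - p t (S.rollout p x t)‖ ≤ ε / opNorm S.B

/-- From `x`, the policy `p` imitates the robust MPC controller `expert` until time `s`, at which it
has reached the terminal set. The disturbance invariant set `Z` has radius at most `κ ε`. -/
structure IsImitationRun (S : ControlSystem dx du) (κ b ε : ℝ) (Z : Set (Vec dx))
    (expert : Vec dx → Vec du) (p : ℕ → Vec dx → Vec du) (s : ℕ) (x : Vec dx) : Prop where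
  eps_pos : 0 < ε
  eps_le_one : ε ≤ 1
  invariant : S.IsDisturbanceInvariant (closedBall 0 ε) Z
  subset_closedBall : Z ⊆ closedBall 0 (κ * ε)
  robustMPC : S.IsRobustMPC Z expert
  feasible : x ∈ S.feasible Z
  norm_le : ‖x‖ ≤ b
  reach : S.rollout p x s ∈ S.tightO Z
  imitates : S.Imitates ε expert p s x

variable {κ b ε M β L : ℝ} {expert piRef : Vec dx → Vec du} {p : ℕ → Vec dx → Vec du} {s t : ℕ}
  {x : Vec dx}

theorem IsImitationRun.zero_mem (h : S.IsImitationRun κ b ε Z expert p s x) :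
    (0 : Vec dx) ∈ Z :=
  mem_of_mem_nhds h.invariant.1

theorem norm_mv_B_le (hS : S.Standing) {d : Vec du} (hd : ‖d‖ ≤ ε / opNorm S.B) :
    ‖mv S.B d‖ ≤ ε := by
  rw [le_div_iff₀' (opNorm_pos hS.B_ne_zero)] at hd
  exact (norm_mv_le _ _).trans hd

theorem step_eq_add_mv (S : ControlSystem dx du) (x : Vec dx) (u v : Vec du) :
    S.step x u = S.step x v + mv S.B (u - v) := by
  rw [step, step, mv_sub, add_assoc, add_sub_cancel]

theorem Imitates.norm_mv_B_sub_le (h : S.Imitates ε expert p s x) (hS : S.Standing)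
    (ht : t < s) : ‖mv S.B (p t (S.rollout p x t) - expert (S.rollout p x t))‖ ≤ ε :=
  norm_mv_B_le hS (norm_sub_rev (expert _) _ ▸ h t ht)

theorem Imitates.mono (h : S.Imitates ε expert p s x) (ht : t ≤ s) : S.Imitates ε expert p t x :=
  fun k hk => h k (hk.trans_le ht)

theorem IsRobustMPC.rollout_mem_robustDomain (hexpert : S.IsRobustMPC Z expert) (hS : S.Standing)
    (hZ : S.IsDisturbanceInvariant (closedBall 0 ε) Z) (hx : x ∈ S.feasible Z)
    (h : S.Imitates ε expert p t x) : S.rollout p x t ∈ S.robustDomain Z := by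
  induction t with
  | zero => exact feasible_subset_robustDomain hS (mem_of_mem_nhds hZ.1) hx
  | succ t ih =>
    obtain ⟨y, u, hyu, hu⟩ := hexpert _ (ih (h.mono t.le_succ))
    rw [rollout, S.step_eq_add_mv _ _ (expert (S.rollout p x t)), hu]
    exact hyu.step_mem_robustDomain hS hZ (hu ▸ h.norm_mv_B_sub_le hS t.lt_succ_self)

theorem IsImitationRun.rollout_mem_robustDomain (h : S.IsImitationRun κ b ε Z expert p s x)
    (hS : S.Standing) (ht : t ≤ s) : S.rollout p x t ∈ S.robustDomain Z :=
  h.robustMPC.rollout_mem_robustDomain hS h.invariant h.feasible (h.imitates.mono ht)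

theorem IsImitationRun.exists_nominal_V_le (h : S.IsImitationRun κ b ε Z expert p s x)
    (hS : S.Standing) (hβ : S.IsNominalBound b M β) (ht : t ≤ s) :
    ∃ y u, S.IsRMPCOptimal Z (S.rollout p x t) y u ∧
      expert (S.rollout p x t) = u 0 + mv S.K (S.rollout p x t - y) ∧ S.V y u ≤ M := by
  induction t with
  | zero =>
    obtain ⟨v, hv⟩ := mem_feasible_iff.1 h.feasible
    obtain ⟨y, u, hyu, hexpert⟩ := h.robustMPC _ (h.rollout_mem_robustDomain hS ht)
    exact ⟨y, u, hyu, hexpert,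
      (hyu.2 x v (by simpa [rollout] using h.zero_mem) hv).trans (hβ.V_le h.norm_le hv)⟩
  | succ t ih =>
    obtain ⟨y, u, hyu, hexpert, hV⟩ := ih (by lia)
    obtain ⟨y', u', hyu', hexpert'⟩ := h.robustMPC _ (h.rollout_mem_robustDomain hS ht)
    refine ⟨y', u', hyu', hexpert', le_trans ?_ hV⟩
    refine hyu.V_step_le hS h.invariant (h.imitates.norm_mv_B_sub_le hS ht) ?_
    rwa [← hexpert, ← step_eq_add_mv]

theorem IsImitationRun.exists_nominal (h : S.IsImitationRun κ b ε Z expert p s x)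
    (hS : S.Standing) (hβ : S.IsNominalBound b M β) (ht : t ≤ s) :
    ∃ y u, S.IsMPCOptimal Z y u ∧ ‖y‖ ≤ β ∧ ‖S.rollout p x t - y‖ ≤ κ * ε ∧
      expert (S.rollout p x t) = u 0 + mv S.K (S.rollout p x t - y) := by
  obtain ⟨y, u, hyu, hexpert, hV⟩ := h.exists_nominal_V_le hS hβ ht
  exact ⟨y, u, hyu.isMPCOptimal, hβ.norm_le_of_V_le hV,
    by simpa using h.subset_closedBall hyu.1.1, hexpert⟩

theorem IsImitationRun.norm_rollout_le (h : S.IsImitationRun κ b ε Z expert p s x)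
    (hS : S.Standing) (hβ : S.IsNominalBound b M β) (hκ : 0 ≤ κ) (ht : t ≤ s) :
    ‖S.rollout p x t‖ ≤ β + κ := by
  obtain ⟨y, -, -, hy, hxy, -⟩ := h.exists_nominal hS hβ ht
  calc ‖S.rollout p x t‖ ≤ ‖y‖ + ‖S.rollout p x t - y‖ := norm_le_norm_add_norm_sub' _ _
    _ ≤ β + κ := add_le_add hy (hxy.trans (mul_le_of_le_one_right hκ h.eps_le_one))

/-- The deviation `e` from the nominal input granted by an imitation run, relative to `ε`: the
nominal state is off by at most `κ ε`, and the expert's input is imitated up to `ε / ‖B‖`. -/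
noncomputable def imitationError (S : ControlSystem dx du) (κ L : ℝ) : ℝ :=
  (L + opNorm S.K) * κ + 1 / opNorm S.B

theorem imitationError_nonneg (S : ControlSystem dx du) (hκ : 0 ≤ κ) (hL : 0 ≤ L) :
    0 ≤ S.imitationError κ L :=
  add_nonneg (mul_nonneg (add_nonneg hL (opNorm_nonneg _)) hκ) (one_div_nonneg.2 (opNorm_nonneg _))

theorem IsImitationRun.norm_policy_sub_le_of_nominal (h : S.IsImitationRun κ b ε Z expert p s x)
    (ht : t < s) {y : Vec dx} {v : Vec du} (hxy : ‖S.rollout p x t - y‖ ≤ κ * ε)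
    (hexpert : expert (S.rollout p x t) = v + mv S.K (S.rollout p x t - y)) :
    ‖p t (S.rollout p x t) - v‖ ≤ S.imitationError κ 0 * ε := by
  have hK := opNorm_nonneg S.K
  calc ‖p t (S.rollout p x t) - v‖
      = ‖(p t (S.rollout p x t) - expert (S.rollout p x t)) + mv S.K (S.rollout p x t - y)‖ := by
        rw [hexpert]; abel_nf
    _ ≤ ε / opNorm S.B + opNorm S.K * (κ * ε) := by
        refine (norm_add_le _ _).trans (add_le_add (norm_sub_rev (expert _) _ ▸ h.imitates t ht) ?_)
        exact (norm_mv_le _ _).trans (by gcongr)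
    _ = S.imitationError κ 0 * ε := by rw [imitationError]; ring

theorem IsImitationRun.norm_policy_le (h : S.IsImitationRun κ b ε Z expert p s x)
    (hS : S.Standing) (hβ : S.IsNominalBound b M β) (hκ : 0 ≤ κ) (ht : t < s) :
    ‖p t (S.rollout p x t)‖ ≤ S.inputBound + S.imitationError κ 0 := by
  obtain ⟨y, u, hu, -, hxy, hexpert⟩ := h.exists_nominal hS hβ ht.le
  calc ‖p t (S.rollout p x t)‖ ≤ ‖u 0‖ + ‖p t (S.rollout p x t) - u 0‖ :=
        norm_le_norm_add_norm_sub' _ _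
    _ ≤ S.inputBound + S.imitationError κ 0 * ε :=
        add_le_add (hS.norm_le_inputBound (hu.1.mem_tightU hS).1)
          (h.norm_policy_sub_le_of_nominal ht hxy hexpert)
    _ ≤ _ := by
        gcongr
        exact mul_le_of_le_one_right (S.imitationError_nonneg hκ le_rfl) h.eps_le_one

theorem IsImitationRun.norm_policy_sub_le (h : S.IsImitationRun κ b ε Z expert p s x)
    (hS : S.Standing) (hβ : S.IsNominalBound b M β) (hL0 : 0 ≤ L) {y : Vec dx} {v : ℕ → Vec du}
    (hL : ∀ z u, ‖z‖ ≤ β → S.IsMPCOptimal Z z u → ‖u 0 - v 0‖ ≤ L * ‖z - y‖) (ht : t < s) :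
    ‖p t (S.rollout p x t) - v 0‖
      ≤ L * ‖S.rollout p x t - y‖ + S.imitationError κ L * ε := by
  obtain ⟨z, u, hu, hz, hxz, hexpert⟩ := h.exists_nominal hS hβ ht.le
  have hzy : ‖z - y‖ ≤ κ * ε + ‖S.rollout p x t - y‖ := by
    refine (norm_sub_le_norm_sub_add_norm_sub z (S.rollout p x t) y).trans ?_
    rw [norm_sub_rev z]
    gcongr
  calc ‖p t (S.rollout p x t) - v 0‖ ≤ ‖p t (S.rollout p x t) - u 0‖ + ‖u 0 - v 0‖ :=
        norm_sub_le_norm_sub_add_norm_sub _ _ _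
    _ ≤ S.imitationError κ 0 * ε + L * ‖z - y‖ :=
        add_le_add (h.norm_policy_sub_le_of_nominal ht hxz hexpert) (hL z u hz hu)
    _ ≤ S.imitationError κ 0 * ε + L * (κ * ε + ‖S.rollout p x t - y‖) := by gcongr
    _ = L * ‖S.rollout p x t - y‖ + S.imitationError κ L * ε := by
        simp only [imitationError]; ring

end ImitationRun

end ControlSystem

namespace ControlSystem

section Regret

variable {dx du : ℕ} {S : ControlSystem dx du} {Z : Set (Vec dx)} {ρ σ κ b ε M β β' L η : ℝ}
  {expert piRef : Vec dx → Vec du} {p : ℕ → Vec dx → Vec du} {s t : ℕ} {x : Vec dx}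

theorem IsImitationRun.rollout_switched_mem_tightO (h : S.IsImitationRun κ b ε Z expert p s x)
    (ht : s ≤ t) : S.rollout (S.switched p s) x t ∈ S.tightO Z := by
  obtain ⟨k, rfl⟩ := Nat.exists_eq_add_of_le ht
  rw [rollout_switched_add]
  exact mv_AK_pow_mem_tightO h.reach k

theorem IsImitationRun.norm_rollout_switched_le (h : S.IsImitationRun κ b ε Z expert p s x)
    (hAK : S.LQRDecay ρ σ) (hS : S.Standing) (hβ : S.IsNominalBound b M β) (hκ : 0 ≤ κ) (t : ℕ) :
    ‖S.rollout (S.switched p s) x t‖ ≤ (1 + σ) * (β + κ) := by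
  have hσ := hAK.const_pos
  have hβκ : 0 ≤ β + κ := add_nonneg hβ.nonneg hκ
  rcases le_total t s with ht | ht
  · rw [rollout_switched _ _ ht]
    exact (h.norm_rollout_le hS hβ hκ ht).trans (le_mul_of_one_le_left hβκ (by linarith))
  · obtain ⟨k, rfl⟩ := Nat.exists_eq_add_of_le ht
    rw [rollout_switched_add]
    calc ‖mv (S.AK ^ k) (S.rollout p x s)‖ ≤ σ * ρ ^ k * ‖S.rollout p x s‖ :=
          hAK.norm_mv_AK_pow_le k _
      _ ≤ σ * 1 * (β + κ) := by
          gcongr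
          exacts [pow_le_one₀ hAK.rate_pos.le hAK.rate_lt_one.le,
            h.norm_rollout_le hS hβ hκ le_rfl]
      _ ≤ (1 + σ) * (β + κ) := by gcongr; linarith

theorem IsImitationRun.norm_switched_le (h : S.IsImitationRun κ b ε Z expert p s x)
    (hS : S.Standing) (hβ : S.IsNominalBound b M β) (hκ : 0 ≤ κ)
    (hx : ∀ t, ‖S.rollout (S.switched p s) x t‖ ≤ β') (t : ℕ) :
    ‖S.switched p s t (S.rollout (S.switched p s) x t)‖
      ≤ S.inputBound + S.imitationError κ 0 + opNorm S.K * β' := by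
  have hK := opNorm_nonneg S.K
  rcases lt_or_ge t s with ht | ht
  · rw [switched_of_lt _ _ ht, rollout_switched _ _ ht.le]
    exact (h.norm_policy_le hS hβ hκ ht).trans
      (le_add_of_nonneg_right (mul_nonneg hK ((norm_nonneg _).trans (hx 0))))
  · rw [switched_of_ge _ _ ht, lqr]
    refine ((norm_mv_le _ _).trans (mul_le_mul_of_nonneg_left (hx t) hK)).trans ?_
    exact le_add_of_nonneg_left
      (add_nonneg hS.inputBound_nonneg (S.imitationError_nonneg hκ le_rfl))

theorem Standing.exists_cost_switched_le (hS : S.Standing) (hκ : 0 ≤ κ) (b : ℝ) :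
    ∃ C : ℝ, 0 ≤ C ∧ ∀ {ε Z expert p s x}, S.IsImitationRun κ b ε Z expert p s x →
      ∀ T, S.cost (S.switched p s) T x ≤ C * (s + 1) := by
  obtain ⟨M, β, hβ⟩ := hS.exists_isNominalBound b
  have hQ := opNorm_nonneg S.Q
  have hR := opNorm_nonneg S.R
  have hP := opNorm_nonneg S.P
  obtain ⟨c, hc⟩ : ∃ c, c = opNorm S.Q * (β + κ) ^ 2
    + opNorm S.R * (S.inputBound + S.imitationError κ 0) ^ 2 := ⟨_, rfl⟩
  have hc0 : 0 ≤ c := by rw [hc]; positivity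
  have hd0 : 0 ≤ opNorm S.P * (β + κ) ^ 2 := by positivity
  refine ⟨c + opNorm S.P * (β + κ) ^ 2, add_nonneg hc0 hd0, fun {ε Z expert p s x} h T => ?_⟩
  calc S.cost (S.switched p s) T x ≤ s * c + opNorm S.P * (β + κ) ^ 2 := by
        refine hS.cost_switched_le T (fun t ht => ?_) ?_
        · rw [hc]
          refine (S.stageCost_le _ _).trans ?_
          gcongr
          exacts [h.norm_rollout_le hS hβ hκ ht.le, h.norm_policy_le hS hβ hκ ht]
        · refine (quadForm_le _ _).trans ?_
          gcongr
          exact h.norm_rollout_le hS hβ hκ le_rfl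
    _ ≤ (c + opNorm S.P * (β + κ) ^ 2) * (s + 1) := by
        linarith [mul_nonneg hd0 s.cast_nonneg]

theorem IsTightMPC.eq_lqr (hS : S.Standing) (href : S.IsTightMPC Z piRef) {y : Vec dx}
    (hy : y ∈ S.tightO Z) : piRef y = mv S.K y := by
  obtain ⟨u, hu, hpiRef⟩ := href y (tightO_subset_feasible hy)
  rw [hpiRef, hu.first_input_of_mem_tightO hS hy]

theorem IsTightMPC.norm_rollout_le (hS : S.Standing) (href : S.IsTightMPC Z piRef)
    (hβ : S.IsNominalBound b M β) (hx : x ∈ S.feasible Z) (hxb : ‖x‖ ≤ b) (t : ℕ) :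
    ‖S.rollout (fun _ => piRef) x t‖ ≤ β := by
  obtain ⟨u, hu⟩ := mem_feasible_iff.1 hx
  obtain ⟨v, -, -, hv⟩ := href.exists_isMPCOptimal_rollout hS hu t
  refine hβ.norm_le_of_V_le (u := v) ?_
  linarith [hS.cost_nonneg (fun _ => piRef) t x, hβ.V_le hxb hu]

theorem IsTightMPC.norm_input_le (hS : S.Standing) (href : S.IsTightMPC Z piRef)
    (hx : x ∈ S.feasible Z) (t : ℕ) :
    ‖piRef (S.rollout (fun _ => piRef) x t)‖ ≤ S.inputBound := by
  obtain ⟨u, hu⟩ := mem_feasible_iff.1 hx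
  obtain ⟨v, hv, hpiRef, -⟩ := href.exists_isMPCOptimal_rollout hS hu t
  exact hpiRef ▸ hS.norm_le_inputBound (hv.1.mem_tightU hS).1

theorem IsImitationRun.norm_switched_sub_le (h : S.IsImitationRun κ b ε Z expert p s x)
    (hS : S.Standing) (href : S.IsTightMPC Z piRef) (hβ : S.IsNominalBound b M β) (hκ : 0 ≤ κ)
    (hL0 : 0 ≤ L) (hββ' : β ≤ β') (hx : ∀ t, ‖S.rollout (S.switched p s) x t‖ ≤ β')
    (hL : ∀ x y u v, ‖x‖ ≤ β' → ‖y‖ ≤ β' → S.IsMPCOptimal Z x u → S.IsMPCOptimal Z y v →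
      ‖u 0 - v 0‖ ≤ L * ‖x - y‖) (t : ℕ) :
    ‖S.switched p s t (S.rollout (S.switched p s) x t) - piRef (S.rollout (fun _ => piRef) x t)‖
      ≤ L * ‖S.rollout (S.switched p s) x t - S.rollout (fun _ => piRef) x t‖
        + S.imitationError κ L * ε := by
  obtain ⟨u, hu⟩ := mem_feasible_iff.1 h.feasible
  obtain ⟨v, hv, hpiRef, -⟩ := href.exists_isMPCOptimal_rollout hS hu t
  have hy := (href.norm_rollout_le hS hβ h.feasible h.norm_le t).trans hββ'
  rw [hpiRef]
  rcases lt_or_ge t s with ht | ht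
  · rw [switched_of_lt _ _ ht, rollout_switched _ _ ht.le]
    exact h.norm_policy_sub_le hS hβ hL0 (fun z u hz hu => hL _ _ _ _ (hz.trans hββ') hy hu hv) ht
  · have hO := h.rollout_switched_mem_tightO ht
    obtain ⟨w, hw, -⟩ := href _ (tightO_subset_feasible hO)
    rw [switched_of_ge _ _ ht, lqr, ← hw.first_input_of_mem_tightO hS hO]
    exact (hL _ _ _ _ (hx t) hy hw hv).trans
      (le_add_of_nonneg_right (mul_nonneg (S.imitationError_nonneg hκ hL0) h.eps_pos.le))

theorem IsImitationRun.isTracking (h : S.IsImitationRun κ b ε Z expert p s x)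
    (hS : S.Standing) (href : S.IsTightMPC Z piRef) (hβ : S.IsNominalBound b M β) (hκ : 0 ≤ κ)
    (hL0 : 0 ≤ L) (hββ' : β ≤ β') (hx : ∀ t, ‖S.rollout (S.switched p s) x t‖ ≤ β')
    (hL : ∀ x y u v, ‖x‖ ≤ β' → ‖y‖ ≤ β' → S.IsMPCOptimal Z x u → S.IsMPCOptimal Z y v →
      ‖u 0 - v 0‖ ≤ L * ‖x - y‖)
    (hη : ∀ x : Vec dx, ‖x‖ ≤ 2 * η → x ∈ S.tightO Z ∧
      ∀ y u, S.IsRMPCOptimal Z x y u → u 0 + mv S.K (x - y) = mv S.K x) :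
    S.IsTracking L (S.imitationError κ L) ε η s (S.rollout (S.switched p s) x)
      (S.rollout (fun _ => piRef) x)
      (fun t => S.switched p s t (S.rollout (S.switched p s) x t))
      (fun t => piRef (S.rollout (fun _ => piRef) x t)) where
  traj := S.isTrajectory_rollout _ _
  traj_ref := S.isTrajectory_rollout _ _
  init := rfl
  lipschitz := h.norm_switched_sub_le hS href hβ hκ hL0 hββ' hx hL
  ref_eq_lqr _ ht := href.eq_lqr hS (hη _ ht).1
  near_lqr t ht := by
    rcases lt_or_ge t s with hts | hts
    · rw [rollout_switched _ _ hts.le] at ht ⊢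
      rw [switched_of_lt _ _ hts]
      obtain ⟨y, u, hyu, hexpert, -⟩ := h.exists_nominal_V_le hS hβ hts.le
      rw [← (hη _ ht).2 y u hyu, ← hexpert]
      exact h.imitates.norm_mv_B_sub_le hS hts
    · rw [switched_of_ge _ _ hts, lqr, sub_self, mv_zero, norm_zero]
      exact h.eps_pos.le
  eq_lqr t ht := by rw [switched_of_ge _ _ ht, lqr]

theorem LQRDecay.div_one_sub_nonneg (hAK : S.LQRDecay ρ σ) : 0 ≤ σ / (1 - ρ) :=
  div_nonneg hAK.const_pos.le (sub_nonneg.2 hAK.rate_lt_one.le)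

theorem LQRDecay.exists_regret_le_of_eps_le (hAK : S.LQRDecay ρ σ) (hS : S.Standing) (b : ℝ) :
    ∃ C ε₀ : ℝ, 0 ≤ C ∧ 0 < ε₀ ∧ ∀ {ε Z expert p s x},
      S.IsImitationRun (σ / (1 - ρ)) b ε Z expert p s x → ε ≤ ε₀ →
      ∀ piRef, S.IsTightMPC Z piRef → ∀ T,
        S.cost (S.switched p s) T x - S.cost (fun _ => piRef) T x ≤ C * (s + 1) * ε := by
  have hκ := hAK.div_one_sub_nonneg
  have hσ := hAK.const_pos
  obtain ⟨M, β, hβ⟩ := hS.exists_isNominalBound b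
  obtain ⟨ε₁, hε₁, r, hr, htight⟩ := hAK.exists_ball_subset_tight hS
  obtain ⟨ζ, hζ, hζlqr⟩ := hAK.exists_robustMPC_eq_lqr hS hr
  obtain ⟨ν, hν⟩ := hAK.exists_isContractingNorm
  obtain ⟨β', hβ'⟩ : ∃ β', β' = (1 + σ) * (β + σ / (1 - ρ)) := ⟨_, rfl⟩
  have hββ' : β ≤ β' := (le_add_of_nonneg_right hκ).trans
    (hβ' ▸ le_mul_of_one_le_left (add_nonneg hβ.nonneg hκ) (by linarith))
  obtain ⟨L, hL0, hL⟩ := hAK.exists_lipschitz_first_input hS hr β'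
  have hK0 : 0 ≤ opNorm S.K * β' := mul_nonneg (opNorm_nonneg _) (hβ.nonneg.trans hββ')
  have hU0 := hS.inputBound_nonneg
  have he0 := S.imitationError_nonneg hκ le_rfl
  obtain ⟨T₀, hT₀⟩ := hS.exists_reach_small hAK hν b M (half_pos hζ)
  obtain ⟨C, G, hC, hG, hregret⟩ := exists_sum_stageCost_sub_le hAK hν hL0
    (S.imitationError_nonneg hκ hL0) (hβ.nonneg.trans hββ')
    (add_nonneg (add_nonneg hU0 he0) hK0) T₀
  have hG1 : 0 < G + 1 := by positivity
  refine ⟨C, min ε₁ (ζ / 2 / (G + 1)), hC, lt_min hε₁ (by positivity), ?_⟩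
  intro ε Z expert p s x h hε piRef href T
  have hGε : G * ε ≤ ζ / 2 := by
    linarith [(le_div_iff₀ hG1).1 (hε.trans (min_le_right _ _)), h.eps_pos]
  have hball := htight ε (hε.trans (min_le_left _ _)) Z h.invariant.1 h.subset_closedBall
    ⟨_, h.reach⟩
  obtain ⟨u, hu⟩ := mem_feasible_iff.1 h.feasible
  obtain ⟨t₀, ht₀, hsmall⟩ := hT₀ _ _ (S.isTrajectory_rollout (fun _ => piRef) x) h.norm_le
    fun n => (href.sum_inputWeight_le hS hu n).trans (hβ.V_le h.norm_le hu)
  have hx : ∀ t, ‖S.rollout (S.switched p s) x t‖ ≤ β' :=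
    hβ' ▸ h.norm_rollout_switched_le hAK hS hβ hκ
  have htracking := h.isTracking (η := ζ / 2) hS href hβ hκ hL0 hββ' hx
    (hL Z (isBounded_closedBall.subset h.subset_closedBall) hball fun y hy =>
      (href y hy).imp fun _ => And.left)
    (by rw [mul_div_cancel₀ _ two_ne_zero]; exact hζlqr Z h.zero_mem hball)
  rw [cost, cost, ← Finset.sum_sub_distrib]
  exact hregret _ _ _ _ ε _ s t₀ h.eps_pos.le htracking
    (fun t => ⟨hx t, (href.norm_rollout_le hS hβ h.feasible h.norm_le t).trans hββ'⟩)
    (fun t => ⟨h.norm_switched_le hS hβ hκ hx t,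
      (href.norm_input_le hS h.feasible t).trans (by linarith)⟩) ht₀ hsmall hGε T

theorem LQRDecay.exists_regret_le (hAK : S.LQRDecay ρ σ) (hS : S.Standing) (b : ℝ) :
    ∃ C : ℝ, 0 ≤ C ∧ ∀ {ε Z expert p s x},
      S.IsImitationRun (σ / (1 - ρ)) b ε Z expert p s x → ∀ piRef, S.IsTightMPC Z piRef → ∀ T,
        S.cost (S.switched p s) T x - S.cost (fun _ => piRef) T x ≤ C * (s + 1) * ε := by
  obtain ⟨C, ε₀, hC, hε₀, hsmall⟩ := hAK.exists_regret_le_of_eps_le hS b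
  obtain ⟨C', hC', hlarge⟩ := hS.exists_cost_switched_le hAK.div_one_sub_nonneg b
  refine ⟨C + C' / ε₀, by positivity, fun {ε Z expert p s x} h piRef href T => ?_⟩
  have hε := h.eps_pos
  rcases le_total ε ε₀ with hle | hge
  · refine (hsmall h hle piRef href T).trans ?_
    gcongr
    exact le_add_of_nonneg_right (by positivity)
  · calc S.cost (S.switched p s) T x - S.cost (fun _ => piRef) T x
        ≤ C' * (s + 1) := (sub_le_self _ (hS.cost_nonneg _ T x)).trans (hlarge h T)
      _ = C' / ε₀ * (s + 1) * ε₀ := by field_simp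
      _ ≤ (C + C' / ε₀) * (s + 1) * ε := by
          gcongr
          exact le_add_of_nonneg_left hC

end Regret

end ControlSystem

section Schedule

theorem one_div_mul_log_sq_le (t : ℕ) :
    1 / (((t : ℝ) + 2) * Real.log ((t : ℝ) + 3) ^ 2)
      ≤ 2 * (1 / Real.log ((t : ℝ) + 2) - 1 / Real.log ((t : ℝ) + 3)) := by
  have hlog2 : 0 < Real.log ((t : ℝ) + 2) := Real.log_pos (by linarith [t.cast_nonneg (α := ℝ)])
  have hmono : Real.log ((t : ℝ) + 2) ≤ Real.log ((t : ℝ) + 3) :=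
    Real.log_le_log (by positivity) (by linarith)
  have hlog3 := hlog2.trans_le hmono
  have hincrement : 1 ≤ 2 * (Real.log ((t : ℝ) + 3) - Real.log ((t : ℝ) + 2)) * ((t : ℝ) + 2) := by
    have := Real.one_sub_inv_le_log_of_pos (x := ((t : ℝ) + 3) / (t + 2)) (by positivity)
    rw [inv_div, Real.log_div (by positivity) (by positivity), one_sub_div (by positivity),
      div_le_iff₀ (by positivity)] at this
    nlinarith
  rw [div_sub_div _ _ hlog2.ne' hlog3.ne', ← mul_div_assoc,
    div_le_div_iff₀ (by positivity) (by positivity)]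
  nlinarith [mul_le_mul_of_nonneg_right hmono hlog3.le,
    mul_le_mul_of_nonneg_right hincrement (sq_nonneg (Real.log ((t : ℝ) + 3)))]

theorem sum_one_div_mul_log_sq_le (n : ℕ) :
    ∑ t ∈ Finset.range n, 1 / (((t : ℝ) + 2) * Real.log ((t : ℝ) + 3) ^ 2)
      ≤ 2 * (1 / Real.log 2 - 1 / Real.log ((n : ℝ) + 2)) := by
  induction n with
  | zero => simp
  | succ n ih =>
    rw [Finset.sum_range_succ, Nat.cast_succ, show (n : ℝ) + 1 + 2 = n + 3 by ring]
    linarith [one_div_mul_log_sq_le n]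

theorem summable_schedule :
    Summable fun t : ℕ => 1 / (((t : ℝ) + 1) * Real.log ((t : ℝ) + 2) ^ 2) := by
  rw [← summable_nat_add_iff 1]
  have hsum : Summable fun t : ℕ => 1 / (((t : ℝ) + 2) * Real.log ((t : ℝ) + 3) ^ 2) := by
    refine summable_of_sum_range_le (c := 2 * (1 / Real.log 2)) (fun t => by positivity)
      fun n => (sum_one_div_mul_log_sq_le n).trans ?_
    have : 0 ≤ 1 / Real.log ((n : ℝ) + 2) :=
      one_div_nonneg.2 (Real.log_nonneg (by linarith [n.cast_nonneg (α := ℝ)]))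
    linarith
  refine hsum.congr fun t => ?_
  push_cast
  ring_nf

theorem scheduleConst_pos : 0 < scheduleConst := by
  refine summable_schedule.tsum_pos (fun t => by positivity) 0 ?_
  have : 0 < Real.log 2 := Real.log_pos one_lt_two
  simp only [Nat.cast_zero, zero_add, one_mul]
  positivity

theorem le_numSamples (n t : ℕ) : (n : ℝ) ≤ numSamples n t :=
  le_trans (le_add_of_nonneg_left (by have := scheduleConst_pos; positivity)) (Nat.le_ceil _)

theorem one_div_numSamples_succ_le {n : ℕ} (hn : 0 < n) (t : ℕ) :
    1 / (numSamples n (t + 1) : ℝ)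
      ≤ 1 / (scheduleConst * n) * (1 / (((t : ℝ) + 1) * Real.log ((t : ℝ) + 2) ^ 2)) := by
  have := scheduleConst_pos
  have hlog : 0 < Real.log ((t : ℝ) + 2) := Real.log_pos (by linarith [t.cast_nonneg (α := ℝ)])
  rw [one_div_mul_one_div]
  refine one_div_le_one_div_of_le (by positivity) (le_trans ?_ (Nat.le_ceil _))
  rw [Nat.cast_succ, show (t : ℝ) + 1 + 1 = t + 2 by ring, ← mul_assoc]
  calc scheduleConst * n * ((t : ℝ) + 1) * Real.log ((t : ℝ) + 2) ^ 2
      ≤ scheduleConst * n * ((t : ℝ) + 1) * (⌈Real.log ((t : ℝ) + 2) ^ 2⌉₊ : ℝ) := by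
        gcongr
        exact Nat.le_ceil _
    _ ≤ _ := le_add_of_nonneg_right n.cast_nonneg

theorem sum_one_div_numSamples_le {n : ℕ} (hn : 0 < n) (T : ℕ) :
    ∑ t ∈ Finset.range T, 1 / (numSamples n t : ℝ) ≤ 2 / n := by
  have := scheduleConst_pos
  have hlater : ∑ t ∈ Finset.range T, 1 / (numSamples n (t + 1) : ℝ) ≤ 1 / n := by
    refine (Finset.sum_le_sum fun t _ => one_div_numSamples_succ_le hn t).trans ?_
    rw [← Finset.mul_sum]
    calc _ ≤ 1 / (scheduleConst * n) * scheduleConst :=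
          mul_le_mul_of_nonneg_left
            (summable_schedule.sum_le_tsum (Finset.range T) fun t _ => by positivity)
            (by positivity)
      _ = 1 / n := by field_simp
  calc ∑ t ∈ Finset.range T, 1 / (numSamples n t : ℝ)
      ≤ ∑ t ∈ Finset.range (T + 1), 1 / (numSamples n t : ℝ) :=
        Finset.sum_le_sum_of_subset_of_nonneg (Finset.range_subset_range.2 T.le_succ)
          fun _ _ _ => by positivity
    _ ≤ 1 / n + 1 / n := by
        rw [Finset.sum_range_succ']
        exact add_le_add hlater
          (one_div_le_one_div_of_le (by exact_mod_cast hn) (le_numSamples n 0))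
    _ = 2 / n := by ring

end Schedule

section FreshSamples

variable {Ω α ι κ : Type*} [MeasurableSpace Ω] [mα : MeasurableSpace α] {μ : Measure Ω}
  {ν : Measure α} {X : ι → Ω → α}

theorem measureReal_exists_mem_le_card_mul [IsFiniteMeasure μ] {s : Finset ι} {p : ι → Ω → Prop}
    {c : ℝ} (h : ∀ i ∈ s, μ.real {ω | p i ω} ≤ c) :
    μ.real {ω | ∃ i ∈ s, p i ω} ≤ s.card * c := by
  have hunion : {ω | ∃ i ∈ s, p i ω} = ⋃ i ∈ s, {ω | p i ω} := by
    ext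
    simp
  rw [hunion, ← nsmul_eq_mul]
  exact (measureReal_biUnion_finset_le _ _).trans (Finset.sum_le_card_nsmul _ _ _ h)

theorem measure_biInter_preimage_toMeasurable (hX : iIndepFun X μ) (hmeas : ∀ j, Measurable (X j))
    (hlaw : ∀ j, μ.map (X j) = ν) (I : Finset ι) (A : Set α) :
    μ (⋂ j ∈ I, X j ⁻¹' toMeasurable ν A) = ν A ^ I.card := by
  rw [hX.measure_inter_preimage_eq_mul I fun _ _ => measurableSet_toMeasurable ν A]
  refine Finset.prod_eq_pow_card fun j _ => ?_
  rw [← Measure.map_apply (hmeas j) (measurableSet_toMeasurable ν A), hlaw, measure_toMeasurable]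

theorem measureReal_inter_biInter_preimage_le [IsFiniteMeasure μ] (hX : iIndepFun X μ)
    (hmeas : ∀ j, Measurable (X j)) (hlaw : ∀ j, μ.map (X j) = ν) {J : Set ι} {I : Finset ι}
    (hJI : Disjoint J I) {E : Set Ω} (hE : MeasurableSet[⨆ j ∈ J, mα.comap (X j)] E) (A : Set α) :
    μ.real (E ∩ ⋂ j ∈ I, X j ⁻¹' A) ≤ μ.real E * ν.real A ^ I.card := by
  have hindep : Indep (⨆ j ∈ J, mα.comap (X j)) (⨆ j ∈ (I : Set ι), mα.comap (X j)) μ :=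
    indep_iSup_of_disjoint (fun j => (hmeas j).comap_le) hX.iIndep hJI
  have hG : MeasurableSet[⨆ j ∈ (I : Set ι), mα.comap (X j)]
      (⋂ j ∈ I, X j ⁻¹' toMeasurable ν A) :=
    MeasurableSet.biInter I.countable_toSet fun j hj =>
      le_iSup₂ (f := fun j (_ : j ∈ (I : Set ι)) => mα.comap (X j)) j hj _
        ⟨_, measurableSet_toMeasurable ν A, rfl⟩
  calc μ.real (E ∩ ⋂ j ∈ I, X j ⁻¹' A)
      ≤ μ.real (E ∩ ⋂ j ∈ I, X j ⁻¹' toMeasurable ν A) :=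
        measureReal_mono (Set.inter_subset_inter_right _
          (Set.iInter₂_mono fun _ _ => Set.preimage_mono (subset_toMeasurable ν A)))
    _ = μ.real E * ν.real A ^ I.card := by
        simp only [measureReal_def]
        rw [(Indep_iff _ _ _).1 hindep _ _ hE hG,
          measure_biInter_preimage_toMeasurable hX hmeas hlaw, ENNReal.toReal_mul,
          ENNReal.toReal_pow]

/-- A union bound over the choices `F` would lose a factor `#s`; conditioning on the value of `F`,
which is independent of the fresh samples, does not. -/
theorem measureReal_forall_mem_le_pow [IsProbabilityMeasure μ] (hX : iIndepFun X μ)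
    (hmeas : ∀ j, Measurable (X j)) (hlaw : ∀ j, μ.map (X j) = ν) {J : Set ι} {I : Finset ι}
    (hJI : Disjoint J I) {F : Ω → κ} {s : Finset κ}
    (hF : ∀ k ∈ s, MeasurableSet[⨆ j ∈ J, mα.comap (X j)] (F ⁻¹' {k})) (A : κ → Set α) {c : ℝ}
    (hc : 0 ≤ c) :
    μ.real {ω | F ω ∈ s ∧ ν.real (A (F ω)) ≤ c ∧ ∀ j ∈ I, X j ω ∈ A (F ω)} ≤ c ^ I.card := by
  classical
  set small := s.filter fun k => ν.real (A k) ≤ c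
  have hfiber : ∀ k ∈ small, MeasurableSet (F ⁻¹' {k}) := fun k hk =>
    iSup₂_le (fun j _ => (hmeas j).comap_le) _ (hF k (Finset.mem_filter.1 hk).1)
  calc _ ≤ μ.real (⋃ k ∈ small, F ⁻¹' {k} ∩ ⋂ j ∈ I, X j ⁻¹' A k) := by
        refine measureReal_mono (fun ω ⟨hs, hA, hmem⟩ => ?_) (measure_ne_top _ _)
        exact Set.mem_biUnion (Finset.mem_filter.2 ⟨hs, hA⟩) ⟨rfl, Set.mem_iInter₂.2 hmem⟩
    _ ≤ ∑ k ∈ small, μ.real (F ⁻¹' {k} ∩ ⋂ j ∈ I, X j ⁻¹' A k) :=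
        measureReal_biUnion_finset_le _ _
    _ ≤ ∑ k ∈ small, μ.real (F ⁻¹' {k}) * c ^ I.card := by
        refine Finset.sum_le_sum fun k hk => ?_
        obtain ⟨hs, hA⟩ := Finset.mem_filter.1 hk
        refine (measureReal_inter_biInter_preimage_le hX hmeas hlaw hJI (hF k hs) _).trans ?_
        gcongr
    _ = μ.real (⋃ k ∈ small, F ⁻¹' {k}) * c ^ I.card := by
        rw [← Finset.sum_mul, measureReal_biUnion_finset (Set.pairwiseDisjoint_fiber F _) hfiber]
    _ ≤ c ^ I.card := mul_le_of_le_one_left (by positivity) measureReal_le_one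

theorem measureReal_le_exp_neg_of_le_compl [IsProbabilityMeasure ν] {A : Set α} {q : ℝ}
    (hA : MeasurableSet A) (hq : q ≤ ν.real Aᶜ) : ν.real A ≤ Real.exp (-q) := by
  rw [probReal_compl_eq_one_sub hA] at hq
  linarith [Real.one_sub_le_exp_neg q]

theorem ofReal_one_sub_le_measure [IsProbabilityMeasure ν] {A : Set α} {q : ℝ}
    (hA : ν.real Aᶜ ≤ q) : ENNReal.ofReal (1 - q) ≤ ν A := by
  have hcover : 1 ≤ ν.real A + ν.real Aᶜ := by
    simpa using measureReal_union_le (μ := ν) A Aᶜ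
  exact ENNReal.ofReal_le_of_le_toReal (by linarith [ν.real_def A])

end FreshSamples

namespace ControlSystem

section Imitation

variable {dx du : ℕ} {S : ControlSystem dx du} {Z : Set (Vec dx)} {D : Measure (Vec dx)} {ε : ℝ}
  {expert : Vec dx → Vec du} {p : ℕ → Vec dx → Vec du} {s t τ : ℕ} {x : Vec dx}

theorem measurable_rollout (S : ControlSystem dx du) (hp : ∀ k < t, Measurable (p k)) :
    Measurable (S.rollout p · t) := by
  induction t with
  | zero => exact measurable_id
  | succ t ih =>
    have hstate := ih fun k hk => hp k (hk.trans t.lt_succ_self)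
    exact ((continuous_mv S.A).measurable.comp hstate).add
      ((continuous_mv S.B).measurable.comp ((hp t t.lt_succ_self).comp hstate))

theorem IsRobustMPC.imitates_of_inputBound_le (hexpert : S.IsRobustMPC Z expert) (hS : S.Standing)
    (hZ : S.IsDisturbanceInvariant (closedBall 0 ε) Z) (hexpertU : ∀ x ∈ S.X, expert x ∈ S.U)
    (hpU : ∀ t < s, ∀ x ∈ S.X, p t x ∈ S.U) (hx : x ∈ S.feasible Z)
    (hε : 2 * (opNorm S.B * S.inputBound) ≤ ε) : S.Imitates ε expert p s x := by
  intro t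
  induction t using Nat.strong_induction_on with
  | _ t ih =>
    intro ht
    have hX : S.rollout p x t ∈ S.X := (hexpert.rollout_mem_robustDomain hS hZ hx
      fun k hk => ih k hk (hk.trans ht)).2
    rw [le_div_iff₀' (opNorm_pos hS.B_ne_zero)]
    calc opNorm S.B * ‖expert (S.rollout p x t) - p t (S.rollout p x t)‖
        ≤ opNorm S.B * (S.inputBound + S.inputBound) :=
          mul_le_mul_of_nonneg_left ((norm_sub_le _ _).trans
            (add_le_add (hS.norm_le_inputBound (hexpertU _ hX))
              (hS.norm_le_inputBound (hpU t ht _ hX)))) (opNorm_nonneg _)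
      _ ≤ ε := by linarith

/-- The disturbance is the error in the input, as long as it is under control. -/
theorem IsReachTime.ae_rollout_mem_tightO (hτ : S.IsReachTime Z ε D expert τ) (hS : S.Standing)
    (hε : 0 ≤ ε) (p : ℕ → Vec dx → Vec du) :
    ∀ᵐ x ∂D, S.Imitates ε expert p τ x → S.rollout p x τ ∈ S.tightO Z := by
  filter_upwards [hτ.2] with x hx himit
  set w : ℕ → Vec dx := fun t =>
    if t < τ then mv S.B (p t (S.rollout p x t) - expert (S.rollout p x t)) else 0 with hw
  have hwε : ∀ t, w t ∈ closedBall (0 : Vec dx) ε := by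
    intro t
    by_cases ht : t < τ
    · simpa [hw, ht] using himit.norm_mv_B_sub_le hS ht
    · simpa [hw, ht] using hε
  have hrollout : ∀ t ≤ τ, S.disturbed expert w x t = S.rollout p x t := by
    intro t
    induction t with
    | zero => exact fun _ => rfl
    | succ t ih =>
      intro ht
      rw [disturbed, ih (Nat.le_of_succ_le ht), rollout, hw, S.step_eq_add_mv _ (p t _)]
      exact congrArg _ (if_pos (Nat.lt_of_succ_le ht))
  exact hrollout τ le_rfl ▸ hx w hwε

end Imitation

end ControlSystem

namespace TrainingRun

variable {Ω : Type*} {dx du : ℕ} {r : TrainingRun Ω dx du} {S : ControlSystem dx du}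

section SwitchTime

variable {Z : Set (Vec dx)} {T ℓ t : ℕ} {ω : Ω}

theorem switchTime_le (r : TrainingRun Ω dx du) (S : ControlSystem dx du) (Z : Set (Vec dx))
    (T ℓ : ℕ) (ω : Ω) : r.switchTime S Z T ℓ ω ≤ T :=
  Nat.sInf_le (Or.inr rfl)

theorem exists_notMem_of_lt_switchTime (ht : 1 ≤ t) (h : t < r.switchTime S Z T ℓ ω) :
    ∃ i < ℓ, S.rollout (r.learned ω) (r.test t i ω) t ∉ S.tightO Z := by
  by_contra! hpass
  exact Nat.notMem_of_lt_sInf h (Or.inl ⟨ht, hpass⟩)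

theorem forall_mem_of_switchTime_lt (h : r.switchTime S Z T ℓ ω < T) :
    ∀ i < ℓ, S.rollout (r.learned ω) (r.test (r.switchTime S Z T ℓ ω) i ω)
      (r.switchTime S Z T ℓ ω) ∈ S.tightO Z :=
  (Nat.sInf_mem (s := {t | 1 ≤ t ∧ ∀ i < ℓ,
    S.rollout (r.learned ω) (r.test t i ω) t ∈ S.tightO Z} ∪ {T}) ⟨T, Or.inr rfl⟩).elim
      (fun hmem => hmem.2) (fun heq => absurd heq h.ne)

end SwitchTime

section Samples

/-- The family of all initial states sampled in a run: `Sum.inl (t, i)` is the `i`-th training state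
of stage `t` and `Sum.inr (t, i)` the `i`-th test state of time `t`. -/
def sample (r : TrainingRun Ω dx du) : (ℕ × ℕ) ⊕ (ℕ × ℕ) → Ω → Vec dx :=
  fun j => Sum.elim (fun p : ℕ × ℕ => r.train p.1 p.2) (fun p : ℕ × ℕ => r.test p.1 p.2) j

/-- The time to which the trajectory from a sampled initial state is run. -/
def stage : (ℕ × ℕ) ⊕ (ℕ × ℕ) → ℕ := Sum.elim Prod.fst Prod.fst

theorem past_le_iSup_comap_sample (r : TrainingRun Ω dx du) {s t : ℕ} (hst : s < t) :
    r.past s ≤ ⨆ j ∈ {j | stage j < t}, MeasurableSpace.comap (r.sample j) inferInstance :=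
  iSup_le fun k => iSup_le fun i => sup_le
    (le_iSup₂_of_le (f := fun j (_ : j ∈ {j | stage j < t}) =>
      MeasurableSpace.comap (r.sample j) inferInstance)
      (Sum.inl (k.1, i)) (k.2.trans_lt hst) le_rfl)
    (le_iSup₂_of_le (f := fun j (_ : j ∈ {j | stage j < t}) =>
      MeasurableSpace.comap (r.sample j) inferInstance)
      (Sum.inr (k.1, i)) (k.2.trans_lt hst) le_rfl)

variable [MeasurableSpace Ω] {μ : Measure Ω} {D : Measure (Vec dx)} {Z : Set (Vec dx)}
  {expert : Vec dx → Vec du} {models : Finset (Vec dx → Vec du)} {T n ℓ t : ℕ} {c : ℝ}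

theorem IsForwardSwitch.measurable_sample (h : r.IsForwardSwitch S μ D Z expert models T n ℓ)
    (j : (ℕ × ℕ) ⊕ (ℕ × ℕ)) : Measurable (r.sample j) :=
  j.rec (fun _ => h.train_measurable _ _) fun _ => h.test_measurable _ _

theorem IsForwardSwitch.map_sample (h : r.IsForwardSwitch S μ D Z expert models T n ℓ)
    (j : (ℕ × ℕ) ⊕ (ℕ × ℕ)) : μ.map (r.sample j) = D :=
  j.rec (fun _ => h.train_law _ _) fun _ => h.test_law _ _

theorem IsForwardSwitch.measurableSet_history (h : r.IsForwardSwitch S μ D Z expert models T n ℓ)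
    (ht : t ≤ T) {p : Fin t → Vec dx → Vec du} (hp : ∀ s, p s ∈ models) :
    MeasurableSet[⨆ j ∈ {j | stage j < t}, MeasurableSpace.comap (r.sample j) inferInstance]
      ((fun ω (s : Fin t) => r.policy s ω) ⁻¹' {p}) := by
  have hinter : (fun ω (s : Fin t) => r.policy s ω) ⁻¹' {p} =
      ⋂ s : Fin t, {ω | r.policy s ω = p s} := by
    ext ω
    simp [funext_iff]
  rw [hinter]
  exact MeasurableSet.iInter fun s => r.past_le_iSup_comap_sample s.2 _
    (h.nonanticipating s (s.2.trans_le ht) (p s) (hp s))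

theorem IsForwardSwitch.measureReal_forall_sample_mem_le [IsProbabilityMeasure μ]
    (h : r.IsForwardSwitch S μ D Z expert models T n ℓ) (ht : t ≤ T)
    {I : Finset ((ℕ × ℕ) ⊕ (ℕ × ℕ))} (hI : ∀ j ∈ I, stage j = t) (B : Set (Vec dx))
    (hc : 0 ≤ c) :
    μ.real {ω | t ≤ r.switchTime S Z T ℓ ω ∧ D.real ((S.rollout (r.learned ω) · t) ⁻¹' B) ≤ c ∧
      ∀ j ∈ I, S.rollout (r.learned ω) (r.sample j ω) t ∈ B} ≤ c ^ I.card := by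
  classical
  set extend : (Fin t → Vec dx → Vec du) → ℕ → Vec dx → Vec du :=
    fun p => Function.extend Fin.val p 0
  have hrollout : ∀ ω x, S.rollout (extend fun s => r.policy s ω) x t =
      S.rollout (r.learned ω) x t := fun ω x =>
    S.rollout_congr x fun k hk => Fin.val_injective.extend_apply _ _ (⟨k, hk⟩ : Fin t)
  have hJI : Disjoint {j | stage j < t} I :=
    Set.disjoint_left.2 fun j hj hjI => (hI j hjI).not_lt hj
  refine le_trans (measureReal_mono fun ω ⟨hω, hB, hmem⟩ => ?_)
    (measureReal_forall_mem_le_pow (X := r.sample) (s := Fintype.piFinset fun _ => models) h.indep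
      h.measurable_sample h.map_sample hJI
      (fun p hp => h.measurableSet_history ht (Fintype.mem_piFinset.1 hp))
      (fun p => (S.rollout (extend p) · t) ⁻¹' B) hc)
  refine ⟨Fintype.mem_piFinset.2 fun s => (h.erm ω s (s.2.trans_le hω)).1, ?_, ?_⟩
  · simpa only [hrollout] using hB
  · simpa only [Set.mem_preimage, hrollout] using hmem

theorem IsForwardSwitch.measureReal_forall_train_mem_le [IsProbabilityMeasure μ]
    (h : r.IsForwardSwitch S μ D Z expert models T n ℓ) (ht : t ≤ T) (I : Finset ℕ)
    (B : Set (Vec dx)) (hc : 0 ≤ c) :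
    μ.real {ω | t ≤ r.switchTime S Z T ℓ ω ∧ D.real ((S.rollout (r.learned ω) · t) ⁻¹' B) ≤ c ∧
      ∀ i ∈ I, S.rollout (r.learned ω) (r.train t i ω) t ∈ B} ≤ c ^ I.card := by
  simpa [sample] using h.measureReal_forall_sample_mem_le ht
    (I := I.map ((Function.Embedding.sectR t ℕ).trans .inl)) (by simp [stage]) B hc

theorem IsForwardSwitch.measureReal_forall_test_mem_le [IsProbabilityMeasure μ]
    (h : r.IsForwardSwitch S μ D Z expert models T n ℓ) (ht : t ≤ T) (I : Finset ℕ)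
    (B : Set (Vec dx)) (hc : 0 ≤ c) :
    μ.real {ω | t ≤ r.switchTime S Z T ℓ ω ∧ D.real ((S.rollout (r.learned ω) · t) ⁻¹' B) ≤ c ∧
      ∀ i ∈ I, S.rollout (r.learned ω) (r.test t i ω) t ∈ B} ≤ c ^ I.card := by
  simpa [sample] using h.measureReal_forall_sample_mem_le ht
    (I := I.map ((Function.Embedding.sectR t ℕ).trans .inr)) (by simp [stage]) B hc

end Samples

end TrainingRun

namespace TrainingRun

variable {Ω : Type*} {dx du : ℕ} {r : TrainingRun Ω dx du} {S : ControlSystem dx du}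
  {D : Measure (Vec dx)} {Z : Set (Vec dx)}
  {expert : Vec dx → Vec du} {models : Finset (Vec dx → Vec du)} {T n ℓ s t τ : ℕ} {ε δ Λ q : ℝ}
  {ω : Ω}

/-- The initial states from which the learned loop is, at time `t`, in a state where the controller
of stage `t` differs from the expert; their probability is the generalization error of stage `t`. -/
def disagreement (r : TrainingRun Ω dx du) (S : ControlSystem dx du) (expert : Vec dx → Vec du)
    (ω : Ω) (t : ℕ) : Set (Vec dx) :=
  {x | expert (S.rollout (r.learned ω) x t) ≠ r.policy t ω (S.rollout (r.learned ω) x t)}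

theorem measureReal_not_imitates_le [IsFiniteMeasure D] (hε : 0 ≤ ε) (hn : 0 < n) (hΛ : 0 ≤ Λ)
    (h : ∀ t < s, D.real (r.disagreement S expert ω t) ≤ Λ / numSamples n t) :
    D.real {x | ¬S.Imitates ε expert (r.learned ω) s x} ≤ Λ * (2 / n) := by
  have hsub : {x | ¬S.Imitates ε expert (r.learned ω) s x} ⊆
      ⋃ t ∈ Finset.range s, r.disagreement S expert ω t := by
    intro x hx
    by_contra hagree
    simp only [Set.mem_iUnion, Finset.mem_range, not_exists] at hagree
    refine hx fun t ht => ?_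
    have heq : expert _ = _ := not_not.1 (hagree t ht)
    simpa [learned, heq] using div_nonneg hε (opNorm_nonneg S.B)
  calc _ ≤ ∑ t ∈ Finset.range s, D.real (r.disagreement S expert ω t) :=
        (measureReal_mono hsub (measure_ne_top _ _)).trans (measureReal_biUnion_finset_le _ _)
    _ ≤ ∑ t ∈ Finset.range s, Λ * (1 / numSamples n t) :=
        Finset.sum_le_sum fun t ht => (h t (Finset.mem_range.1 ht)).trans_eq (by ring)
    _ ≤ Λ * (2 / n) := by
        rw [← Finset.mul_sum]
        exact mul_le_mul_of_nonneg_left (sum_one_div_numSamples_le hn s) hΛ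

variable [MeasurableSpace Ω] {μ : Measure Ω}

theorem IsForwardSwitch.expert_eq_policy_of_train
    (h : r.IsForwardSwitch S μ D Z expert models T n ℓ) (hexpert : expert ∈ models)
    (ht : t < r.switchTime S Z T ℓ ω) {i : ℕ} (hi : i ∈ Finset.range (numSamples n t)) :
    expert (S.rollout (r.learned ω) (r.train t i ω) t)
      = r.policy t ω (S.rollout (r.learned ω) (r.train t i ω) t) := by
  have hloss : r.empLoss S expert n t ω (r.policy t ω) ≤ 0 :=
    ((h.erm ω t ht).2 expert hexpert).trans_eq (by simp [empLoss])
  have hpos : 0 < 1 / (numSamples n t : ℝ) :=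
    one_div_pos.2 (Nat.cast_pos.2 (Nat.zero_lt_of_lt (Finset.mem_range.1 hi)))
  refine sub_eq_zero.1 (norm_le_zero_iff.1 ?_)
  exact (Finset.single_le_sum (f := fun i => ‖expert (S.rollout (r.learned ω) (r.train t i ω) t)
    - r.policy t ω (S.rollout (r.learned ω) (r.train t i ω) t)‖)
    (fun _ _ => norm_nonneg _) hi).trans (nonpos_of_mul_nonpos_right hloss hpos)

theorem IsForwardSwitch.measurable_rollout (h : r.IsForwardSwitch S μ D Z expert models T n ℓ)
    (hmodels : ∀ π ∈ models, Measurable π) (ht : t ≤ r.switchTime S Z T ℓ ω) :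
    Measurable (S.rollout (r.learned ω) · t) :=
  S.measurable_rollout fun k hk => hmodels _ (h.erm ω k (hk.trans_le ht)).1

theorem IsForwardSwitch.measureReal_le_disagreement_le [IsProbabilityMeasure μ]
    [IsProbabilityMeasure D] (h : r.IsForwardSwitch S μ D Z expert models T n ℓ)
    (hexpert : expert ∈ models) (hmodels : ∀ π ∈ models, Measurable π) (ht : t < T) (q : ℝ) :
    μ.real {ω | t < r.switchTime S Z T ℓ ω ∧ q ≤ D.real (r.disagreement S expert ω t)}
      ≤ models.card * Real.exp (-(q * numSamples n t)) := by
  set agreement : (Vec dx → Vec du) → Set (Vec dx) := fun π => {y | expert y = π y}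
  have hmodel : ∀ π ∈ models, μ.real {ω | t ≤ r.switchTime S Z T ℓ ω ∧
      D.real ((S.rollout (r.learned ω) · t) ⁻¹' agreement π) ≤ Real.exp (-q) ∧
      ∀ i ∈ Finset.range (numSamples n t),
        S.rollout (r.learned ω) (r.train t i ω) t ∈ agreement π}
      ≤ Real.exp (-(q * numSamples n t)) := fun π _ => by
    refine (h.measureReal_forall_train_mem_le ht.le _ _ (Real.exp_nonneg _)).trans_eq ?_
    rw [Finset.card_range, ← Real.exp_nat_mul]
    ring_nf
  refine le_trans (measureReal_mono ?_ (measure_ne_top _ _))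
    (measureReal_exists_mem_le_card_mul hmodel)
  rintro ω ⟨hω, hq⟩
  have hπ := (h.erm ω t hω).1
  have hrollout := h.measurable_rollout hmodels hω.le
  refine ⟨r.policy t ω, hπ, hω.le, measureReal_le_exp_neg_of_le_compl ?_ hq,
    fun i hi => h.expert_eq_policy_of_train hexpert hω hi⟩
  exact measurableSet_eq_fun ((hmodels _ hexpert).comp hrollout) ((hmodels _ hπ).comp hrollout)

theorem IsForwardSwitch.measureReal_exists_le_disagreement_le [IsProbabilityMeasure μ]
    [IsProbabilityMeasure D] (h : r.IsForwardSwitch S μ D Z expert models T n ℓ)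
    (hexpert : expert ∈ models) (hmodels : ∀ π ∈ models, Measurable π) (hn : 0 < n) (Λ : ℝ) :
    μ.real {ω | ∃ t < r.switchTime S Z T ℓ ω,
        Λ / numSamples n t ≤ D.real (r.disagreement S expert ω t)}
      ≤ T * (models.card * Real.exp (-Λ)) := by
  have hnum : ∀ t, (numSamples n t : ℝ) ≠ 0 := fun t =>
    ((Nat.cast_pos.2 hn).trans_le (le_numSamples n t)).ne'
  have hstage : ∀ t ∈ Finset.range T, μ.real {ω | t < r.switchTime S Z T ℓ ω ∧
      Λ / numSamples n t ≤ D.real (r.disagreement S expert ω t)}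
      ≤ models.card * Real.exp (-Λ) := fun t ht => by
    simpa only [div_mul_cancel₀ _ (hnum t)] using h.measureReal_le_disagreement_le hexpert hmodels
      (Finset.mem_range.1 ht) (Λ / numSamples n t)
  refine le_trans (measureReal_mono ?_ (measure_ne_top _ _))
    ((measureReal_exists_mem_le_card_mul hstage).trans_eq (by rw [Finset.card_range]))
  rintro ω ⟨t, ht, hle⟩
  exact ⟨t, Finset.mem_range.2 (ht.trans_le (r.switchTime_le S Z T ℓ ω)), ht, hle⟩

theorem IsForwardSwitch.exists_imitation_rate_of_le [IsProbabilityMeasure μ]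
    [IsProbabilityMeasure D] (h : r.IsForwardSwitch S μ D Z expert models T n ℓ)
    (hexpert : expert ∈ models) (hmodels : ∀ π ∈ models, Measurable π) (hε : 0 ≤ ε) (hδ : 0 < δ)
    (hδ1 : δ < 1) (hT : 1 ≤ T) (hℓ : 1 ≤ ℓ)
    (hn : 2 * ℓ * Real.log (2 * T * ℓ * models.card / δ) / δ ≤ n) :
    ∃ (bad : Set Ω) (q : ℝ), μ.real bad ≤ δ ∧ 0 ≤ q ∧ ℓ * q ≤ δ ∧
      ∀ ω ∉ bad, ∀ s ≤ r.switchTime S Z T ℓ ω,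
        D.real {x | ¬S.Imitates ε expert (r.learned ω) s x} ≤ q := by
  set m : ℝ := 2 * T * ℓ * models.card with hm
  have hcard : 1 ≤ models.card := Finset.card_pos.2 ⟨_, hexpert⟩
  have hℓ' : (1 : ℝ) ≤ ℓ := by exact_mod_cast hℓ
  have hm1 : 1 ≤ m := by
    have : 1 ≤ 2 * T * ℓ * models.card := Nat.succ_le_of_lt (by positivity)
    rw [hm]
    exact_mod_cast this
  set Λ := Real.log (m / δ)
  have hΛ : 0 < Λ := Real.log_pos ((one_lt_div hδ).2 (hδ1.trans_le hm1))
  have hn0 : (0 : ℝ) < n := lt_of_lt_of_le (by positivity) hn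
  refine ⟨_, Λ * (2 / n), (h.measureReal_exists_le_disagreement_le hexpert hmodels
    (Nat.cast_pos.1 hn0) Λ).trans ?_, by positivity, ?_, fun ω hω s hs => ?_⟩
  · rw [Real.exp_neg, Real.exp_log (by positivity), inv_div]
    calc T * (models.card * (δ / m)) = δ / (2 * ℓ) := by rw [hm]; field_simp
      _ ≤ δ := div_le_self hδ.le (by linarith)
  · rw [div_le_iff₀ hδ] at hn
    rw [mul_div_assoc', mul_div_assoc', div_le_iff₀ hn0]
    linarith
  · exact measureReal_not_imitates_le hε (Nat.cast_pos.1 hn0) hΛ.le fun t ht =>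
      (not_le.1 fun hle => hω ⟨t, ht.trans_le hs, hle⟩).le

/-- The bound on `n` is void if `ε` is large relative to the bound on the inputs, but then every
controller imitates the expert. -/
theorem IsForwardSwitch.exists_imitation_rate [IsProbabilityMeasure μ]
    [IsProbabilityMeasure D] (h : r.IsForwardSwitch S μ D Z expert models T n ℓ)
    (hS : S.Standing) (hZ : S.IsDisturbanceInvariant (closedBall 0 ε) Z)
    (hexpert : S.IsRobustMPC Z expert) (hmem : expert ∈ models)
    (hmodels : ∀ π ∈ models, Measurable π ∧ ∀ x ∈ S.X, π x ∈ S.U)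
    (hD : ∀ᵐ x ∂D, x ∈ S.feasible Z) (hε : 0 < ε) (hδ : 0 < δ) (hδ1 : δ < 1) (hT : 1 ≤ T)
    (hℓ : 1 ≤ ℓ) (hn : 14 * ℓ * opNorm S.B * S.inputBound *
      Real.log (2 * T * ℓ * models.card / δ) / (ε * δ) ≤ n) :
    ∃ (bad : Set Ω) (q : ℝ), μ.real bad ≤ δ ∧ 0 ≤ q ∧ ℓ * q ≤ δ ∧
      ∀ ω ∉ bad, ∀ s ≤ r.switchTime S Z T ℓ ω,
        D.real {x | ¬S.Imitates ε expert (r.learned ω) s x} ≤ q := by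
  rcases le_or_gt (2 * (opNorm S.B * S.inputBound)) ε with hsmall | hlarge
  · refine ⟨∅, 0, by simpa using hδ.le, le_rfl, by simpa using hδ.le, fun ω _ s hs => le_of_eq ?_⟩
    refine (measureReal_eq_zero_iff (measure_ne_top _ _)).2 (ae_iff.1 (hD.mono fun x hx => ?_))
    exact hexpert.imitates_of_inputBound_le hS hZ (hmodels _ hmem).2
      (fun t ht => (hmodels _ (h.erm ω t (ht.trans_le hs)).1).2) hx hsmall
  · refine h.exists_imitation_rate_of_le hmem (fun π hπ => (hmodels π hπ).1) hε.le hδ hδ1 hT hℓ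
      (le_trans ?_ hn)
    have hm : 1 ≤ 2 * (T : ℝ) * ℓ * models.card := by
      have hcard : 1 ≤ models.card := Finset.card_pos.2 ⟨_, hmem⟩
      have : 1 ≤ 2 * T * ℓ * models.card := Nat.succ_le_of_lt (by positivity)
      exact_mod_cast this
    set Λ := Real.log (2 * T * ℓ * models.card / δ)
    have hΛ : 0 ≤ Λ := Real.log_nonneg ((one_le_div hδ).2 (hδ1.le.trans hm))
    rw [div_le_div_iff₀ hδ (by positivity)]
    have : 0 ≤ ℓ * Λ * δ := by positivity
    nlinarith

end TrainingRun

theorem one_sub_pow_le_div {δ : ℝ} {T ℓ : ℕ} (hδ : 0 < δ) (hδ1 : δ ≤ 1) (hT : 1 ≤ T)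
    (hℓ : Real.log (T / δ) / δ ≤ ℓ) : (1 - δ) ^ ℓ ≤ δ / T := by
  have hT0 : (0 : ℝ) < T := Nat.cast_pos.2 hT
  calc (1 - δ) ^ ℓ ≤ Real.exp (-δ) ^ ℓ :=
        pow_le_pow_left₀ (sub_nonneg.2 hδ1) (Real.one_sub_le_exp_neg δ) ℓ
    _ = Real.exp (-(ℓ * δ)) := by rw [← Real.exp_nat_mul, mul_neg]
    _ ≤ Real.exp (-Real.log (T / δ)) :=
        Real.exp_le_exp.2 (neg_le_neg ((div_le_iff₀ hδ).1 hℓ))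
    _ = δ / T := by rw [Real.exp_neg, Real.exp_log (div_pos hT0 hδ), inv_div]

namespace TrainingRun

variable {Ω : Type*} {dx du : ℕ} {r : TrainingRun Ω dx du}
  {S : ControlSystem dx du} {D : Measure (Vec dx)} {Z : Set (Vec dx)}
  {expert : Vec dx → Vec du} {models : Finset (Vec dx → Vec du)} {T n ℓ t τ : ℕ} {ε δ q : ℝ}
  {ω : Ω}

theorem measureReal_rollout_notMem_tightO_le [IsFiniteMeasure D] (hτ : S.IsReachTime Z ε D expert τ)
    (hS : S.Standing) (hε : 0 ≤ ε)
    (himit : D.real {x | ¬S.Imitates ε expert (r.learned ω) τ x} ≤ q) :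
    D.real ((S.rollout (r.learned ω) · τ) ⁻¹' (S.tightO Z)ᶜ) ≤ q := by
  refine le_trans (ENNReal.toReal_mono (measure_ne_top _ _) (measure_mono_ae ?_)) himit
  filter_upwards [hτ.ae_rollout_mem_tightO hS hε (r.learned ω)] with x hx hmiss himit
  exact hmiss (hx himit)

theorem mem_goodEvent [IsProbabilityMeasure D] (hτ : S.IsReachTime Z ε D expert τ) (hτT : τ ≤ T)
    (hS : S.Standing) (hε : 0 ≤ ε) (hqδ : q ≤ δ)
    (himit : ∀ s ≤ r.switchTime S Z T ℓ ω,
      D.real {x | ¬S.Imitates ε expert (r.learned ω) s x} ≤ q)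
    (hreach : r.switchTime S Z T ℓ ω < T → 1 - δ < D.real (r.reachEvent S Z T ℓ ω))
    (hmiss : τ < r.switchTime S Z T ℓ ω →
      q < D.real ((S.rollout (r.learned ω) · τ) ⁻¹' (S.tightO Z)ᶜ)) :
    ω ∈ r.goodEvent S D Z ε δ expert T ℓ τ := by
  have hle : r.switchTime S Z T ℓ ω ≤ τ := le_of_not_gt fun hlt =>
    (hmiss hlt).not_ge (measureReal_rollout_notMem_tightO_le hτ hS hε (himit τ hlt.le))
  refine ⟨hle, ?_, ofReal_one_sub_le_measure ((himit _ le_rfl).trans hqδ)⟩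
  rcases hle.eq_or_lt with heq | hlt
  · refine ofReal_one_sub_le_measure (le_trans ?_ hqδ)
    have := measureReal_rollout_notMem_tightO_le hτ hS hε (himit τ heq.ge)
    rwa [reachEvent, heq]
  · exact (ENNReal.ofReal_le_ofReal (hreach (hlt.trans_le hτT)).le).trans_eq ofReal_measureReal

variable [MeasurableSpace Ω] {μ : Measure Ω}

theorem IsForwardSwitch.measureReal_reachEvent_le [IsProbabilityMeasure μ]
    (h : r.IsForwardSwitch S μ D Z expert models T n ℓ) (hδ : 0 < δ) (hδ1 : δ ≤ 1) (hT : 1 ≤ T)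
    (hℓ : Real.log (T / δ) / δ ≤ ℓ) :
    μ.real {ω | r.switchTime S Z T ℓ ω < T ∧ D.real (r.reachEvent S Z T ℓ ω) ≤ 1 - δ} ≤ δ := by
  have hstage : ∀ t ∈ Finset.range T, μ.real {ω | t ≤ r.switchTime S Z T ℓ ω ∧
      D.real ((S.rollout (r.learned ω) · t) ⁻¹' S.tightO Z) ≤ 1 - δ ∧
      ∀ i ∈ Finset.range ℓ, S.rollout (r.learned ω) (r.test t i ω) t ∈ S.tightO Z}
      ≤ δ / T := fun t ht => by
    refine (h.measureReal_forall_test_mem_le (Finset.mem_range.1 ht).le _ _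
      (sub_nonneg.2 hδ1)).trans ?_
    rw [Finset.card_range]
    exact one_sub_pow_le_div hδ hδ1 hT hℓ
  have hsum : (Finset.range T).card * (δ / T) = δ := by
    rw [Finset.card_range, mul_div_cancel₀ _ (Nat.cast_ne_zero.2 (Nat.one_le_iff_ne_zero.1 hT))]
  refine le_trans (measureReal_mono ?_ (measure_ne_top _ _))
    ((measureReal_exists_mem_le_card_mul hstage).trans_eq hsum)
  rintro ω ⟨hω, hreach⟩
  exact ⟨_, Finset.mem_range.2 hω, le_rfl, hreach,
    fun i hi => forall_mem_of_switchTime_lt hω i (Finset.mem_range.1 hi)⟩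

theorem IsForwardSwitch.measureReal_lt_switchTime_le [IsProbabilityMeasure μ]
    (h : r.IsForwardSwitch S μ D Z expert models T n ℓ) (ht : 1 ≤ t) (htT : t ≤ T) (hq : 0 ≤ q) :
    μ.real {ω | t < r.switchTime S Z T ℓ ω ∧
      D.real ((S.rollout (r.learned ω) · t) ⁻¹' (S.tightO Z)ᶜ) ≤ q} ≤ ℓ * q := by
  have htest : ∀ i ∈ Finset.range ℓ, μ.real {ω | t ≤ r.switchTime S Z T ℓ ω ∧
      D.real ((S.rollout (r.learned ω) · t) ⁻¹' (S.tightO Z)ᶜ) ≤ q ∧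
      ∀ j ∈ ({i} : Finset ℕ), S.rollout (r.learned ω) (r.test t j ω) t ∈ (S.tightO Z)ᶜ}
      ≤ q := fun i _ => by
    simpa only [Finset.card_singleton, pow_one] using
      h.measureReal_forall_test_mem_le htT {i} (S.tightO Z)ᶜ hq
  refine le_trans (measureReal_mono ?_ (measure_ne_top _ _))
    ((measureReal_exists_mem_le_card_mul htest).trans_eq (by rw [Finset.card_range]))
  rintro ω ⟨hω, hmiss⟩
  obtain ⟨i, hi, hnot⟩ := exists_notMem_of_lt_switchTime ht hω
  exact ⟨i, Finset.mem_range.2 hi, hω.le, hmiss, fun j hj => Finset.mem_singleton.1 hj ▸ hnot⟩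

theorem IsForwardSwitch.ofReal_le_measure_goodEvent [IsProbabilityMeasure μ]
    [IsProbabilityMeasure D] (h : r.IsForwardSwitch S μ D Z expert models T n ℓ)
    (hS : S.Standing) (hZ : S.IsDisturbanceInvariant (closedBall 0 ε) Z)
    (hexpert : S.IsRobustMPC Z expert) (hmem : expert ∈ models)
    (hmodels : ∀ π ∈ models, Measurable π ∧ ∀ x ∈ S.X, π x ∈ S.U)
    (hD : ∀ᵐ x ∂D, x ∈ S.feasible Z) (hε : 0 < ε) (hδ : 0 < δ) (hδ1 : δ < 1)
    (hτ : S.IsReachTime Z ε D expert τ) (hτT : τ ≤ T) (hℓ : 10 * Real.log (T / δ) / δ ≤ ℓ)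
    (hn : 14 * ℓ * opNorm S.B * S.inputBound *
      Real.log (2 * T * ℓ * models.card / δ) / (ε * δ) ≤ n) :
    ENNReal.ofReal (1 - 3 * δ) ≤ μ (r.goodEvent S D Z ε δ expert T ℓ τ) := by
  have hT : 1 ≤ T := hτ.1.trans hτT
  have hlog : 0 < Real.log (T / δ) :=
    Real.log_pos ((one_lt_div hδ).2 (hδ1.trans_le (Nat.one_le_cast.2 hT)))
  have hlogℓ : Real.log (T / δ) / δ ≤ ℓ :=
    (div_le_div_of_nonneg_right (by linarith) hδ.le).trans hℓ
  have hℓ1 : 1 ≤ ℓ := Nat.cast_pos.1 ((div_pos hlog hδ).trans_le hlogℓ)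
  obtain ⟨bad, q, hbad, hq, hℓq, himit⟩ :=
    h.exists_imitation_rate hS hZ hexpert hmem hmodels hD hε hδ hδ1 hT hℓ1 hn
  have hqδ : q ≤ δ := (le_mul_of_one_le_left hq (Nat.one_le_cast.2 hℓ1)).trans hℓq
  have hreach := h.measureReal_reachEvent_le hδ hδ1.le hT hlogℓ
  have hmiss := (h.measureReal_lt_switchTime_le hτ.1 hτT hq).trans hℓq
  set badReach := {ω | r.switchTime S Z T ℓ ω < T ∧ D.real (r.reachEvent S Z T ℓ ω) ≤ 1 - δ}
  set badMiss := {ω | τ < r.switchTime S Z T ℓ ω ∧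
    D.real ((S.rollout (r.learned ω) · τ) ⁻¹' (S.tightO Z)ᶜ) ≤ q}
  have hsub : (r.goodEvent S D Z ε δ expert T ℓ τ)ᶜ ⊆ bad ∪ badReach ∪ badMiss := by
    refine Set.compl_subset_comm.1 fun ω hω => ?_
    simp only [Set.mem_compl_iff, Set.mem_union, not_or] at hω
    exact mem_goodEvent hτ hτT hS hε.le hqδ (himit ω hω.1.1)
      (fun hlt => not_le.1 fun hle => hω.1.2 ⟨hlt, hle⟩)
      (fun hlt => not_le.1 fun hle => hω.2 ⟨hlt, hle⟩)
  refine ofReal_one_sub_le_measure ?_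
  linarith [measureReal_mono hsub (measure_ne_top μ _),
    measureReal_union_le (μ := μ) (bad ∪ badReach) badMiss,
    measureReal_union_le (μ := μ) bad badReach]

end TrainingRun

theorem theorem3 {dx du : ℕ} (S : ControlSystem dx du) (hS : S.Standing)
    (ρ σ b : ℝ) (hρ0 : 0 < ρ) (hρ1 : ρ < 1) (hσ : 0 < σ)
    (hdecay : ∀ k : ℕ, opNorm (S.AK ^ k) ≤ σ * ρ ^ k) :
    ∃ C : ℝ, 0 < C ∧
      ∀ (ε δ : ℝ), 0 < ε → ε < 1 → 0 < δ → δ < 1 →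
      ∀ (Z : Set (Vec dx)), S.IsDisturbanceInvariant (closedBall 0 ε) Z →
        Z ⊆ closedBall 0 (σ / (1 - ρ) * ε) →
      ∀ (piRef : Vec dx → Vec du), S.IsTightMPC Z piRef →
      ∀ (expert : Vec dx → Vec du), S.IsRobustMPC Z expert →
      ∀ (D : Measure (Vec dx)) [IsProbabilityMeasure D],
        (∀ᵐ x ∂D, x ∈ S.feasible Z ∧ ‖x‖ ≤ b) →
      ∀ (models : Finset (Vec dx → Vec du)), expert ∈ models →
        (∀ π ∈ models, Measurable π ∧ ∀ x ∈ S.X, π x ∈ S.U) →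
      ∀ (τ : ℕ), S.IsReachTime Z ε D expert τ →
      ∀ (T n ℓ : ℕ), 10 * Real.log (T / δ) / δ ≤ ℓ →
        14 * ℓ * opNorm S.B * S.inputBound * Real.log (2 * T * ℓ * models.card / δ) / (ε * δ) ≤ n →
      ∀ {Ω : Type*} [MeasurableSpace Ω] (μ : Measure Ω) [IsProbabilityMeasure μ]
        (r : TrainingRun Ω dx du), r.IsForwardSwitch S μ D Z expert models T n ℓ →
        (τ ≤ T → ENNReal.ofReal (1 - 3 * δ) ≤ μ (r.goodEvent S D Z ε δ expert T ℓ τ)) ∧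
        ∀ ω ∈ r.goodEvent S D Z ε δ expert T ℓ τ,
        ∀ x₀ ∈ S.feasible Z, ‖x₀‖ ≤ b →
          x₀ ∈ r.reachEvent S Z T ℓ ω → x₀ ∈ r.closeEvent S Z ε expert T ℓ ω →
          S.cost (r.output S Z T ℓ ω) T x₀ - S.cost (fun _ => piRef) T x₀ ≤ C * τ * ε := by
  have hAK : S.LQRDecay ρ σ := ⟨hρ0, hρ1, hσ, hdecay⟩
  obtain ⟨C, hC, hregret⟩ := hAK.exists_regret_le hS b
  refine ⟨2 * C + 1, by positivity, ?_⟩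
  intro ε δ hε hε1 hδ hδ1 Z hZ hZκ piRef href expert hexpert D _ hD models hmem hmodels τ hτ T n ℓ
    hℓ hn Ω _ μ _ r hr
  refine ⟨fun hτT => hr.ofReal_le_measure_goodEvent hS hZ hexpert hmem hmodels
    (hD.mono fun _ => And.left) hε hδ hδ1 hτ hτT hℓ hn, fun ω hω x₀ hx₀ hb hreach hclose => ?_⟩
  have hrun : S.IsImitationRun (σ / (1 - ρ)) b ε Z expert (r.learned ω) (r.switchTime S Z T ℓ ω)
      x₀ := ⟨hε, hε1.le, hZ, hZκ, hexpert, hx₀, hb, hreach, hclose⟩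
  have hswitch : (r.switchTime S Z T ℓ ω : ℝ) ≤ τ := Nat.cast_le.2 hω.1
  have hτ1 : (1 : ℝ) ≤ τ := Nat.one_le_cast.2 hτ.1
  calc _ ≤ C * (r.switchTime S Z T ℓ ω + 1) * ε := hregret hrun piRef href T
    _ ≤ C * (τ + τ) * ε := by gcongr
    _ ≤ (2 * C + 1) * τ * ε := by linarith [mul_nonneg (zero_le_one.trans hτ1) hε.le]
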